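/- Let $d\ge 2$ and $m\ge1$. Let $A=(a_{ij}^{\alpha\beta}(y))$, $1\le i,j\le d$, $1\le\alpha,\beta\le m$, be smooth and $\mathbb Z^d$-periodic on $\mathbb R^d$, and satisfy, for some $\mu>0$, $\mu|\xi|^2\le a_{ij}^{\alpha\beta}(y)\xi_i^\alpha\xi_j^\beta\le\mu^{-1}|\xi|^2$ for all $y\in\mathbb R^d$ and $\xi=(\xi_i^\alpha)\in\mathbb R^{m\times d}$ (repeated indices are summed). Let $n\in\mathbb S^{d-1}$, $a\in\mathbb R$, and let $T\in\mathbb R^d$ satisfy $|T|\le1$ and $T\cdot n=0$. Suppose that $n$ satisfies the Diophantine condition $$|(I-n\otimes n)\xi|\ge\kappa|\xi|^{-2}\quad\text{for all }\xi\in\mathbb Z^d\setminus\{0\}$$ with a constant $\kappa>0$. Then for every $g\in C^\infty(\mathbb T^d;\mathbb R^m)$ the Neumann problem $$\operatorname{div}(A\nabla u)=0\ \text{ in }\{x\in\mathbb R^d: x\cdot n<-a\},\qquad n\cdot A\nabla u=T\cdot\nabla g\ \text{ on }\{x\in\mathbb R^d:x\cdot n=-a\}$$ has a solution $u$ with values in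 $\mathbb R^m$, smooth up to the boundary, such that for all integers $\ell\ge1$, all multi-indices $\alpha$ with $|\alpha|\ge1$, and all $x$ with $x\cdot n\le -a$, $$|u(x)|\le\frac{C}{\kappa(1+\kappa|x\cdot n+a|)^{\ell}},\qquad |\partial_x^\alpha u(x)|\le\frac{C}{(1+\kappa|x\cdot n+a|)^{\ell}}.$$ Here $C$ depends at most on $d$, $m$, $\mu$, $\alpha$, $\ell$ and on upper bounds for the $C^k(\mathbb T^d)$ norms of $A$ and $g$, for some $k=k(d,\alpha,\ell)$; in particular $C$ does not depend on $\kappa$, $n$, $T$ or $a$. The solution $u$ does not depend on $\alpha$ and $\ell$. -/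

import Mathlib

open scoped ContDiff

noncomputable section

namespace HalfSpaceNeumann

/-- The integer vector `z ∈ ℤ^d`, seen in Euclidean space `ℝ^d`. -/
def intVec {d : ℕ} (z : Fin d → ℤ) : EuclideanSpace ℝ (Fin d) :=
  WithLp.toLp 2 fun i => (z i : ℝ)

/-- `f(y + z) = f(y)` for all `y ∈ ℝ^d` and `z ∈ ℤ^d`: `f` is a function on the torus. -/
def IsPeriodic {d : ℕ} {F : Type*} (f : EuclideanSpace ℝ (Fin d) → F) : Prop :=
  ∀ (y : EuclideanSpace ℝ (Fin d)) (z : Fin d → ℤ), f (y + intVec z) = f y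

/-- The `C^k(𝕋^d)` norm of `f` (the maximum of the sup norms of the derivatives of order at most
`k`) is at most `K`. -/
def CkNormLE {d : ℕ} {F : Type*} [NormedAddCommGroup F] [NormedSpace ℝ F]
    (k : ℕ) (f : EuclideanSpace ℝ (Fin d) → F) (K : ℝ) : Prop :=
  ∀ j ≤ k, ∀ y, ‖iteratedFDeriv ℝ j f y‖ ≤ K

/-- Coefficient tensors `a i j α β = a_{ij}^{αβ}`. -/
abbrev Coeff (d m : ℕ) : Type := Fin d → Fin d → Fin m → Fin m → ℝ

/-- `μ |ξ|² ≤ a_{ij}^{αβ}(y) ξ_i^α ξ_j^β ≤ μ⁻¹ |ξ|²` for all `y` and all `ξ = (ξ_i^α)`. -/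
def IsElliptic {d m : ℕ} (μ : ℝ) (A : EuclideanSpace ℝ (Fin d) → Coeff d m) : Prop :=
  ∀ (y : EuclideanSpace ℝ (Fin d)) (ξ : Fin d → Fin m → ℝ),
    μ * ∑ i, ∑ α, ξ i α ^ 2 ≤ ∑ i, ∑ j, ∑ α, ∑ β, A y i j α β * ξ i α * ξ j β ∧
    ∑ i, ∑ j, ∑ α, ∑ β, A y i j α β * ξ i α * ξ j β ≤ 1 / μ * ∑ i, ∑ α, ξ i α ^ 2

/-- `|(I - n ⊗ n) ξ| ≥ κ |ξ|⁻²` for all `ξ ∈ ℤ^d \ {0}`. -/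
def IsDiophantine {d : ℕ} (n : EuclideanSpace ℝ (Fin d)) (κ : ℝ) : Prop :=
  ∀ ξ : Fin d → ℤ, ξ ≠ 0 →
    κ * (‖intVec ξ‖ ^ 2)⁻¹ ≤ ‖intVec ξ - inner ℝ n (intVec ξ) • n‖

/-- The open half-space `{x : x · n < -a}`, with outward unit normal `n`. -/
def halfSpace {d : ℕ} (n : EuclideanSpace ℝ (Fin d)) (a : ℝ) : Set (EuclideanSpace ℝ (Fin d)) :=
  {x | inner ℝ x n < -a}

/-- The closed half-space `{x : x · n ≤ -a}`. -/
def closedHalfSpace {d : ℕ} (n : EuclideanSpace ℝ (Fin d)) (a : ℝ) :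
    Set (EuclideanSpace ℝ (Fin d)) :=
  {x | inner ℝ x n ≤ -a}

/-- The bounding hyperplane `{x : x · n = -a}`. -/
def boundaryPlane {d : ℕ} (n : EuclideanSpace ℝ (Fin d)) (a : ℝ) :
    Set (EuclideanSpace ℝ (Fin d)) :=
  {x | inner ℝ x n = -a}

/-- `(a ∇u)_i^α = ∑_{j,β} a_{ij}^{αβ} ∂_j u^β`, where `L` is the derivative of `u` at the point. -/
def flux {d m : ℕ} (a : Coeff d m)
    (L : EuclideanSpace ℝ (Fin d) →L[ℝ] EuclideanSpace ℝ (Fin m)) (i : Fin d) (α : Fin m) : ℝ :=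
  ∑ j, ∑ β, a i j α β * L (EuclideanSpace.single j 1) β

/-- `u` is a smooth (up to the boundary) solution of `div(A∇u) = 0` in the half-space
`{x · n < -a}` with `n · A∇u = T · ∇g` on its boundary. Derivatives at a boundary point are taken
from within the closed half-space; the values of `u` outside it play no role. -/
structure IsSmoothSolution {d m : ℕ} (A : EuclideanSpace ℝ (Fin d) → Coeff d m)
    (n : EuclideanSpace ℝ (Fin d)) (a : ℝ) (T : EuclideanSpace ℝ (Fin d))
    (g u : EuclideanSpace ℝ (Fin d) → EuclideanSpace ℝ (Fin m)) : Prop where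
  smooth : ContDiffOn ℝ ∞ u (closedHalfSpace n a)
  equation : ∀ x ∈ halfSpace n a, ∀ α : Fin m,
    ∑ i, fderiv ℝ (fun y => flux (A y) (fderiv ℝ u y) i α) x (EuclideanSpace.single i 1) = 0
  boundary : ∀ x ∈ boundaryPlane n a, ∀ α : Fin m,
    ∑ i, n i * flux (A x) (fderivWithin ℝ u (closedHalfSpace n a) x) i α = fderiv ℝ g x T α

end HalfSpaceNeumann

end

open scoped ContDiff

noncomputable section

namespace HalfSpaceNeumann

/-! ### Characters, the torus and means of periodic functions -/

section
open MeasureTheory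

variable {d : ℕ}

/-! Look for the solution in quasi-periodic form: `u(x) = V(x, t)`, where `t = -(x·n + a)` is the
depth and `V(y, t)` is periodic in `y`. The gradient of `u` becomes `F = (∇_y - n ∂_t) V`, and the
half-space problem becomes a problem on `𝕋^d × [0, ∞)` whose coefficients do not depend on `t`. It
is degenerate: only the `d` components of `F` are controlled by ellipticity, not all `d + 1`
derivatives of `V`.

Everything is drawn from the energies `e_s(t) = ⟨A F, n W_s² V⟩`, with `W_s` the Fourier multiplier
`(1 + ε|ζ|)^s`. The equation gives `e_s' = -⟨W_s A F, W_s F⟩ ≤ -c ‖W_s F‖²`. The weighted coercivity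
holds because `ε` is chosen so small that the commutator of `A` with the weight is absorbed
(`coercive_weightOp_kernelOp`). With `V = 0` at the far end `t = R`, the energies are nonnegative
and decreasing.

Three facts give the estimates. First, since `T ⊥ n`, both `T·∇V` and `T·∇∂_t V` are controlled by
`F`, the second with the loss of one derivative, which falls on `g`. So `e_s(0)` is bounded
independently of `κ` (`energy_zero_le`). Second, the flux through each level `t = const` has mean
zero, so `e_s` only sees `V` minus its mean. The Diophantine condition bounds this part by `F` with
a factor `1/κ` and a loss of two derivatives. Hence `κ e_s ≤ C ‖W_{s+2} F‖² ≤ -C' e_{s+2}'`, and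
therefore `κ t e_s(t) ≤ C'' e_{s+2}(t/2)`. Iteration gives any power of `(1 + κt)⁻¹`, at two
derivatives per power (`energy_decay`). Third, the equation expresses normal derivatives of `F`
through tangential ones (`norm_deriv_flux_le`), which turns the energy bounds into pointwise ones in
`t` and gives all derivatives of `u` without any `1/κ`. The function `V` itself costs one factor
`1/κ`: its oscillating part by the Diophantine condition, its mean by integrating `∂_t V` from the
far end.

For existence, `V` is restricted to a finite set `S` of frequencies and to `[0, R]`. This is a
linear ODE in finite dimension, and the boundary value problem is solvable because it has at most
one solution (`exists_isBoundarySol`). The estimates are independent of `S` and `R`. If `S` contains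
all frequencies up to `N`, the resulting functions satisfy the equation and the boundary condition
up to an error `O(1/N)`. They converge along an ultrafilter, with all derivatives, to a single `u`
that inherits the estimates of every order. -/

/-- The character `y ↦ exp (2πi ζ·y)` of the torus. -/
def wave (ζ : Fin d → ℤ) (y : EuclideanSpace ℝ (Fin d)) : ℂ :=
  Complex.exp (2 * Real.pi * Complex.I * ∑ i, (ζ i : ℂ) * (y i : ℂ))

theorem norm_wave (ζ : Fin d → ℤ) (y : EuclideanSpace ℝ (Fin d)) : ‖wave ζ y‖ = 1 := by
  have : wave ζ y = Complex.exp ((2 * Real.pi * ∑ i, (ζ i : ℝ) * y i : ℝ) * Complex.I) := by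
    unfold wave; congr 1; push_cast; ring
  rw [this, Complex.norm_exp_ofReal_mul_I]

theorem wave_add (ζ η : Fin d → ℤ) (y : EuclideanSpace ℝ (Fin d)) :
    wave (ζ + η) y = wave ζ y * wave η y := by
  unfold wave
  rw [← Complex.exp_add, ← mul_add, ← Finset.sum_add_distrib]
  congr 2
  exact Finset.sum_congr rfl fun i _ => by push_cast [Pi.add_apply]; ring

theorem wave_zero (y : EuclideanSpace ℝ (Fin d)) : wave 0 y = 1 := by
  simp [wave]

theorem conj_wave (ζ : Fin d → ℤ) (y : EuclideanSpace ℝ (Fin d)) :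
    (starRingEnd ℂ) (wave ζ y) = wave (-ζ) y := by
  unfold wave
  rw [← Complex.exp_conj]
  congr 1
  simp [Complex.conj_ofReal, Finset.sum_neg_distrib, Complex.conj_ofNat]

theorem wave_intVec (ζ z : Fin d → ℤ) : wave ζ (intVec z) = 1 := by
  unfold wave
  rw [Complex.exp_eq_one_iff]
  refine ⟨∑ i, ζ i * z i, ?_⟩
  simp [intVec]; ring

theorem wave_add_right (ζ : Fin d → ℤ) (y x : EuclideanSpace ℝ (Fin d)) :
    wave ζ (y + x) = wave ζ y * wave ζ x := by
  unfold wave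
  rw [← Complex.exp_add, ← mul_add, ← Finset.sum_add_distrib]
  congr 2
  exact Finset.sum_congr rfl fun i _ => by simp; ring

theorem isPeriodic_wave (ζ : Fin d → ℤ) : IsPeriodic (wave ζ) := fun y z => by
  rw [wave_add_right, wave_intVec, mul_one]

theorem contDiff_wave (ζ : Fin d → ℤ) : ContDiff ℝ ∞ (wave ζ) := by
  unfold wave
  have h : ∀ i : Fin d, ContDiff ℝ ∞ (fun y : EuclideanSpace ℝ (Fin d) => ((y i : ℝ) : ℂ)) :=
    fun i => Complex.ofRealCLM.contDiff.comp (EuclideanSpace.proj (𝕜 := ℝ) i).contDiff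
  exact Complex.contDiff_exp.comp
    (contDiff_const.mul (ContDiff.sum fun i _ => contDiff_const.mul (h i)))

/-- The derivative of a character in the direction `w`. -/
theorem hasDerivAt_wave_line (ζ : Fin d → ℤ) (y w : EuclideanSpace ℝ (Fin d)) (t : ℝ) :
    HasDerivAt (fun s : ℝ => wave ζ (y + s • w))
      (2 * Real.pi * Complex.I * (∑ i, (ζ i : ℂ) * (w i : ℂ)) * wave ζ (y + t • w)) t := by
  have h : ∀ i : Fin d, HasDerivAt (fun s : ℝ => (((y + s • w) i : ℝ) : ℂ)) (w i : ℂ) t := by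
    intro i
    have : HasDerivAt (fun s : ℝ => (y + s • w) i) (w i) t := by
      simpa using ((hasDerivAt_id t).mul_const (w i)).const_add (y i)
    exact this.ofReal_comp
  have h2 := (HasDerivAt.fun_sum fun i (_ : i ∈ Finset.univ) => (h i).const_mul (ζ i : ℂ)).const_mul
    (2 * Real.pi * Complex.I)
  refine h2.cexp.congr_deriv ?_
  rw [mul_comm]
  rfl

theorem fderiv_wave (ζ : Fin d → ℤ) (y w : EuclideanSpace ℝ (Fin d)) :
    fderiv ℝ (wave ζ) y w = 2 * Real.pi * Complex.I * (∑ i, (ζ i : ℂ) * (w i : ℂ)) * wave ζ y := by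
  have h1 := ((contDiff_wave ζ).differentiable (by simp) y).hasFDerivAt
  have h2 := h1.hasLineDerivAt w
  have h3 := hasDerivAt_wave_line ζ y w 0
  rw [zero_smul, add_zero] at h3
  exact HasDerivAt.unique h2 h3

/-- The quotient map `ℝ^d → 𝕋^d`. -/
def toTorus (y : EuclideanSpace ℝ (Fin d)) : UnitAddTorus (Fin d) := fun i => (y i : UnitAddCircle)

/-- A representative in `[0,1)^d` of a point of the torus. -/
def torusRep (θ : UnitAddTorus (Fin d)) : EuclideanSpace ℝ (Fin d) :=
  WithLp.toLp 2 fun i => (AddCircle.equivIco 1 0 (θ i) : ℝ)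

theorem toTorus_torusRep (θ : UnitAddTorus (Fin d)) : toTorus (torusRep θ) = θ := by
  funext i
  exact AddCircle.coe_equivIco

theorem exists_intVec_of_toTorus_eq {x y : EuclideanSpace ℝ (Fin d)} (h : toTorus x = toTorus y) :
    ∃ z : Fin d → ℤ, x = y + intVec z := by
  have h1 : ∀ i, ∃ z : ℤ, x i - y i = z := by
    intro i
    have := congrFun h i
    have h2 : ((x i - y i : ℝ) : AddCircle (1 : ℝ)) = 0 := by
      rw [AddCircle.coe_sub]; exact sub_eq_zero.2 this
    obtain ⟨z, hz⟩ := (AddCircle.coe_eq_zero_iff (1 : ℝ)).1 h2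
    exact ⟨z, by rw [← hz]; simp⟩
  choose z hz using h1
  refine ⟨z, ?_⟩
  ext i
  simp only [intVec, PiLp.add_apply]
  linarith [hz i]

theorem IsPeriodic.apply_torusRep {F : Type*} {f : EuclideanSpace ℝ (Fin d) → F} (hf : IsPeriodic f)
    {θ : UnitAddTorus (Fin d)} {x : EuclideanSpace ℝ (Fin d)} (h : toTorus x = θ) :
    f (torusRep θ) = f x := by
  obtain ⟨z, hz⟩ := exists_intVec_of_toTorus_eq ((toTorus_torusRep θ).trans h.symm)
  rw [hz, hf]

theorem isOpenQuotientMap_toTorus : IsOpenQuotientMap (toTorus (d := d)) := by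
  have h : IsOpenQuotientMap (Pi.map fun (_ : Fin d) (x : ℝ) => (x : UnitAddCircle)) :=
    IsOpenQuotientMap.piMap fun i => QuotientAddGroup.isOpenQuotientMap_mk
  exact h.comp (EuclideanSpace.equiv (Fin d) ℝ).toHomeomorph.isOpenQuotientMap

/-- The representative map `torusRep` is itself discontinuous, but composed with a periodic function
it is the descent of that function along the quotient map `toTorus`. -/
theorem IsPeriodic.continuous_torusRep {F : Type*} [TopologicalSpace F]
    {f : EuclideanSpace ℝ (Fin d) → F} (hf : IsPeriodic f) (hc : Continuous f) :
    Continuous fun θ => f (torusRep θ) := by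
  rw [isOpenQuotientMap_toTorus.isQuotientMap.continuous_iff]
  convert hc using 1
  funext x
  exact hf.apply_torusRep rfl

/-- The normalized Haar measure of the torus. -/
def torusMeasure (d : ℕ) : Measure (UnitAddTorus (Fin d)) :=
  Measure.pi fun _ => AddCircle.haarAddCircle

instance : IsProbabilityMeasure (torusMeasure d) := by
  unfold torusMeasure; infer_instance

instance : (torusMeasure d).IsAddHaarMeasure := by
  unfold torusMeasure; infer_instance

/-- The mean over the torus of a periodic function. -/
def torusMean {F : Type*} [NormedAddCommGroup F] [NormedSpace ℝ F]
    (f : EuclideanSpace ℝ (Fin d) → F) : F :=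
  ∫ θ, f (torusRep θ) ∂torusMeasure d

section mean
variable {F : Type*} {f : EuclideanSpace ℝ (Fin d) → F}

theorem IsPeriodic.comp_add_right (hf : IsPeriodic f) (w : EuclideanSpace ℝ (Fin d)) :
    IsPeriodic fun y => f (y + w) := fun y z => by
  have := hf (y + w) z
  change f (y + intVec z + w) = f (y + w)
  rw [← this]; congr 1; abel

variable [NormedAddCommGroup F]

theorem IsPeriodic.integrable (hf : IsPeriodic f) (hc : Continuous f) :
    Integrable (fun θ => f (torusRep θ)) (torusMeasure d) :=
  (hf.continuous_torusRep hc).integrable_of_hasCompactSupport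
    (HasCompactSupport.of_compactSpace _)

variable [NormedSpace ℝ F]

theorem torusMean_add_right (hf : IsPeriodic f) (w : EuclideanSpace ℝ (Fin d)) :
    torusMean (fun y => f (y + w)) = torusMean f := by
  unfold torusMean
  refine Eq.trans ?_ (integral_add_right_eq_self (fun θ => f (torusRep θ)) (toTorus w))
  refine integral_congr_ae (Filter.Eventually.of_forall fun θ => ?_)
  have h : toTorus (torusRep θ + w) = θ + toTorus w := by
    funext i
    have := congrFun (toTorus_torusRep θ) i
    simp only [toTorus, PiLp.add_apply, AddCircle.coe_add, Pi.add_apply] at this ⊢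
    rw [this]
  exact (hf.apply_torusRep h).symm

theorem IsPeriodic.fderiv_apply (hf : IsPeriodic f) (w : EuclideanSpace ℝ (Fin d)) :
    IsPeriodic fun y => fderiv ℝ f y w := fun y z => by
  have h : (fun y => f (y + intVec z)) = f := funext fun y => hf y z
  have := fderiv_comp_add_right (𝕜 := ℝ) (f := f) (x := y) (intVec z)
  rw [h] at this
  simp only [← this]

/-- The mean of a derivative vanishes. -/
theorem torusMean_fderiv [CompleteSpace F] (hf : IsPeriodic f) (hc : ContDiff ℝ 1 f)
    (w : EuclideanSpace ℝ (Fin d)) : torusMean (fun y => fderiv ℝ f y w) = 0 := by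
  have hper := hf.fderiv_apply w
  have hcont : Continuous fun y => fderiv ℝ f y w :=
    (hc.continuous_fderiv (by simp)).clm_apply continuous_const
  have hcc := hper.continuous_torusRep hcont
  obtain ⟨B, hB⟩ : ∃ B, ∀ y, ‖fderiv ℝ f y w‖ ≤ B := by
    obtain ⟨B, hB⟩ := isCompact_univ.exists_bound_of_continuousOn hcc.continuousOn
    exact ⟨B, fun y => by simpa [hper.apply_torusRep rfl] using hB (toTorus y) trivial⟩
  have hline : ∀ (y : EuclideanSpace ℝ (Fin d)) (s : ℝ),
      HasDerivAt (fun t : ℝ => f (y + t • w)) (fderiv ℝ f (y + s • w) w) s := by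
    intro y s
    have h1 := (hc.differentiable (by simp) (y + s • w)).hasFDerivAt
    have h2 : HasDerivAt (fun t : ℝ => y + t • w) w s := by
      simpa using ((hasDerivAt_id s).smul_const w).const_add y
    exact h1.comp_hasDerivAt s h2
  -- Differentiate `t ↦ torusMean (f(· + t w))` under the integral sign. By translation invariance
  -- of the measure this function of `t` is constant, so no boundary terms have to be discussed.
  have key := hasDerivAt_integral_of_dominated_loc_of_deriv_le (μ := torusMeasure d)
    (F := fun (t : ℝ) θ => f (torusRep θ + t • w))
    (F' := fun (t : ℝ) θ => fderiv ℝ f (torusRep θ + t • w) w) (x₀ := (0 : ℝ))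
    (s := Set.univ) (bound := fun _ => B) Filter.univ_mem
    (Filter.Eventually.of_forall fun t =>
      (((hf.comp_add_right (t • w)).integrable
        (hc.continuous.comp (continuous_id.add continuous_const))).aestronglyMeasurable))
    (by simpa using hf.integrable hc.continuous)
    (by simpa using (hper.integrable hcont).aestronglyMeasurable)
    (Filter.Eventually.of_forall fun θ t _ => hB _) (integrable_const B)
    (Filter.Eventually.of_forall fun θ t _ => hline _ t)
  have hconst : (fun t : ℝ => ∫ θ, f (torusRep θ + t • w) ∂torusMeasure d) =
      fun _ => torusMean f := funext fun t => torusMean_add_right hf (t • w)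
  rw [hconst] at key
  have := key.2.unique (hasDerivAt_const _ _)
  simpa [torusMean] using this

end mean

end

/-! ### Fourier coefficients: decay and inversion -/

section
open MeasureTheory

variable {d : ℕ}

theorem summable_int_inv_sq : Summable fun z : ℤ => (((1 : ℝ) + ‖z‖) ^ 2)⁻¹ := by
  have h : Summable fun n : ℕ => (((1 : ℝ) + n) ^ 2)⁻¹ := by
    have := (summable_nat_add_iff 1).2 (Real.summable_nat_pow_inv.2 (by norm_num : 1 < 2))
    refine this.congr fun n => ?_
    push_cast; rw [add_comm]
  refine Summable.of_nat_of_neg ?_ ?_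
  · simpa using h
  · simpa using h

/-- `∑_{ζ ∈ ℤ^d} (1 + |ζ|)^{-2d}` converges. -/
theorem summable_weight (d : ℕ) : Summable fun ζ : Fin d → ℤ => (((1 : ℝ) + ‖ζ‖) ^ (2 * d))⁻¹ := by
  set f : ℤ → ℝ := fun z => (((1 : ℝ) + ‖z‖) ^ 2)⁻¹ with hf
  have hf0 : ∀ z, 0 ≤ f z := fun z => by positivity
  -- The norm on `ℤ^d` is the sup norm, so it dominates every coordinate. The exponent `2 * d`
  -- supplies one summable square for each of them.
  have hle : ∀ ζ : Fin d → ℤ, (((1 : ℝ) + ‖ζ‖) ^ (2 * d))⁻¹ ≤ ∏ i, f (ζ i) := by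
    intro ζ
    rw [hf]
    simp only
    rw [Finset.prod_inv_distrib, pow_mul]
    have : ∏ i, ((1 : ℝ) + ‖ζ i‖) ^ 2 ≤ ∏ i : Fin d, ((1 : ℝ) + ‖ζ‖) ^ 2 :=
      Finset.prod_le_prod (fun i _ => by positivity) fun i _ => by
        gcongr; exact norm_le_pi_norm ζ i
    rw [Finset.prod_const, Finset.card_univ, Fintype.card_fin] at this
    exact inv_anti₀ (Finset.prod_pos fun i _ => by positivity) this
  refine Summable.of_nonneg_of_le (fun ζ => by positivity) hle ?_
  refine summable_of_sum_le (c := ∏ _i : Fin d, ∑' z, f z)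
    (fun ζ => Finset.prod_nonneg fun i _ => hf0 _) fun u => ?_
  -- Enlarging the finite set to the product of its projections makes the sum factor over the
  -- coordinates.
  calc ∑ ζ ∈ u, ∏ i, f (ζ i)
      ≤ ∑ ζ ∈ Fintype.piFinset (fun i => u.image fun ζ => ζ i), ∏ i, f (ζ i) := by
        refine Finset.sum_le_sum_of_subset_of_nonneg (fun ζ hζ => ?_)
          fun ζ _ _ => Finset.prod_nonneg fun i _ => hf0 _
        exact Fintype.mem_piFinset.2 fun i => Finset.mem_image_of_mem _ hζ
    _ = ∏ i, ∑ z ∈ u.image (fun ζ => ζ i), f z := (Finset.prod_univ_sum _ _).symm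
    _ ≤ ∏ _i : Fin d, ∑' z, f z := Finset.prod_le_prod
        (fun i _ => Finset.sum_nonneg fun z _ => hf0 z)
        fun i _ => summable_int_inv_sq.sum_le_tsum _ fun z _ => hf0 z

/-- The Fourier coefficients of a periodic function. -/
def fcoeff (f : EuclideanSpace ℝ (Fin d) → ℂ) (ζ : Fin d → ℤ) : ℂ :=
  torusMean fun y => wave (-ζ) y * f y

theorem norm_torusMean_le {F : Type*} [NormedAddCommGroup F] [NormedSpace ℝ F]
    {f : EuclideanSpace ℝ (Fin d) → F} {B : ℝ} (hB : ∀ y, ‖f y‖ ≤ B) : ‖torusMean f‖ ≤ B := by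
  have := norm_integral_le_of_norm_le_const (μ := torusMeasure d)
    (Filter.Eventually.of_forall fun θ => hB (torusRep θ))
  simpa [torusMean] using this

theorem norm_fcoeff_le {f : EuclideanSpace ℝ (Fin d) → ℂ} {B : ℝ} (hB : ∀ y, ‖f y‖ ≤ B)
    (ζ : Fin d → ℤ) : ‖fcoeff f ζ‖ ≤ B :=
  norm_torusMean_le fun y => by rw [norm_mul, norm_wave, one_mul]; exact hB y

theorem IsPeriodic.mul {f g : EuclideanSpace ℝ (Fin d) → ℂ} (hf : IsPeriodic f)
    (hg : IsPeriodic g) : IsPeriodic fun y => f y * g y := fun y z => by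
  simp only [hf y z, hg y z]

theorem torusMean_add {F : Type*} [NormedAddCommGroup F] [NormedSpace ℝ F]
    {f g : EuclideanSpace ℝ (Fin d) → F} (hf : IsPeriodic f)
    (hfc : Continuous f) (hg : IsPeriodic g) (hgc : Continuous g) :
    torusMean (fun y => f y + g y) = torusMean f + torusMean g :=
  integral_add (hf.integrable hfc) (hg.integrable hgc)

theorem torusMean_const_mul (c : ℂ) (f : EuclideanSpace ℝ (Fin d) → ℂ) :
    torusMean (fun y => c * f y) = c * torusMean f := integral_const_mul _ _

theorem torusMean_finset_sum {ι F : Type*} [NormedAddCommGroup F] [NormedSpace ℝ F]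
    (s : Finset ι) {f : ι → EuclideanSpace ℝ (Fin d) → F}
    (hf : ∀ i ∈ s, IsPeriodic (f i)) (hc : ∀ i ∈ s, Continuous (f i)) :
    torusMean (fun y => ∑ i ∈ s, f i y) = ∑ i ∈ s, torusMean (f i) :=
  integral_finsetSum s fun i hi => (hf i hi).integrable (hc i hi)

/-- Integration by parts: the derivative of the periodic function `wave (-ζ) * f` has mean zero. -/
theorem fcoeff_fderiv {f : EuclideanSpace ℝ (Fin d) → ℂ} (hf : IsPeriodic f) (hc : ContDiff ℝ 1 f)
    (w : EuclideanSpace ℝ (Fin d)) (ζ : Fin d → ℤ) :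
    fcoeff (fun y => fderiv ℝ f y w) ζ =
      2 * Real.pi * Complex.I * (∑ i, (ζ i : ℂ) * (w i : ℂ)) * fcoeff f ζ := by
  have hw : ContDiff ℝ 1 (wave (-ζ)) := (contDiff_wave (-ζ)).of_le (by simp)
  have h0 := torusMean_fderiv ((isPeriodic_wave (-ζ)).mul hf) (hw.mul hc) w
  have h1 : (fun y => fderiv ℝ (fun y => wave (-ζ) y * f y) y w) = fun y =>
      wave (-ζ) y * fderiv ℝ f y w +
        -(2 * Real.pi * Complex.I * (∑ i, (ζ i : ℂ) * (w i : ℂ))) * (wave (-ζ) y * f y) := by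
    funext y
    rw [fderiv_fun_mul (hw.differentiable (by simp) y) (hc.differentiable (by simp) y)]
    simp only [add_apply, smul_apply, smul_eq_mul,
      fderiv_wave]
    simp only [Pi.neg_apply, Int.cast_neg, neg_mul, Finset.sum_neg_distrib]
    ring
  have hcf : Continuous fun y => fderiv ℝ f y w :=
    (hc.continuous_fderiv (by simp)).clm_apply continuous_const
  have hwf := (isPeriodic_wave (-ζ)).mul hf
  set c : ℂ := -(2 * Real.pi * Complex.I * (∑ i, (ζ i : ℂ) * (w i : ℂ))) with hcdef
  rw [h1, torusMean_add (f := fun y => wave (-ζ) y * fderiv ℝ f y w)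
    (g := fun y => c * (wave (-ζ) y * f y))
    ((isPeriodic_wave (-ζ)).mul (hf.fderiv_apply w)) (hw.continuous.mul hcf)
    (fun y z => congrArg (c * ·) (hwf y z))
    (continuous_const.mul (hw.continuous.mul hc.continuous)), torusMean_const_mul] at h0
  unfold fcoeff
  linear_combination h0 - hcdef * torusMean fun y => wave (-ζ) y * f y

theorem iteratedFDeriv_succ_apply_const {F : Type*} [NormedAddCommGroup F] [NormedSpace ℝ F]
    {f : EuclideanSpace ℝ (Fin d) → F} (hc : ContDiff ℝ ∞ f) (w y : EuclideanSpace ℝ (Fin d))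
    (k : ℕ) : fderiv ℝ (fun y => iteratedFDeriv ℝ k f y fun _ => w) y w =
      iteratedFDeriv ℝ (k + 1) f y fun _ => w := by
  have hd : DifferentiableAt ℝ (iteratedFDeriv ℝ k f) y :=
    (hc.differentiable_iteratedFDeriv (by exact_mod_cast ENat.natCast_lt_top k)) y
  have h := (ContinuousMultilinearMap.apply ℝ (fun _ : Fin k => EuclideanSpace ℝ (Fin d)) F
    (fun _ => w)).hasFDerivAt.comp y hd.hasFDerivAt
  rw [iteratedFDeriv_succ_apply_left]
  have h2 : fderiv ℝ (fun y => iteratedFDeriv ℝ k f y fun _ => w) y = _ := h.fderiv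
  rw [h2]
  rfl

theorem fcoeff_iteratedFDeriv {f : EuclideanSpace ℝ (Fin d) → ℂ} (hf : IsPeriodic f)
    (hc : ContDiff ℝ ∞ f) (w : EuclideanSpace ℝ (Fin d)) (ζ : Fin d → ℤ) (k : ℕ) :
    IsPeriodic (fun y => iteratedFDeriv ℝ k f y fun _ => w) ∧
    fcoeff (fun y => iteratedFDeriv ℝ k f y fun _ => w) ζ =
      (2 * Real.pi * Complex.I * (∑ i, (ζ i : ℂ) * (w i : ℂ))) ^ k * fcoeff f ζ := by
  induction k with
  | zero => simpa using hf
  | succ k ih =>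
    have h1 : (fun y => iteratedFDeriv ℝ (k + 1) f y fun _ => w) =
        fun y => fderiv ℝ (fun y => iteratedFDeriv ℝ k f y fun _ => w) y w :=
      funext fun y => (iteratedFDeriv_succ_apply_const hc w y k).symm
    have hcd : ContDiff ℝ 1 (fun y => iteratedFDeriv ℝ k f y fun _ => w) := by
      have := hc.iteratedFDeriv_right (i := k) (m := 1) (by
        rw [← WithTop.coe_one, ← WithTop.coe_natCast, ← WithTop.coe_add]; exact WithTop.coe_le_coe.2 le_top)
      exact (ContinuousMultilinearMap.apply ℝ (fun _ : Fin k => EuclideanSpace ℝ (Fin d)) ℂ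
        (fun _ => w)).contDiff.comp this
    rw [h1]
    refine ⟨ih.1.fderiv_apply w, ?_⟩
    rw [fcoeff_fderiv ih.1 hcd, ih.2]
    ring

/-- Fourier coefficients of a smooth function decay. -/
theorem norm_fcoeff_mul_weight_le {f : EuclideanSpace ℝ (Fin d) → ℂ} (hf : IsPeriodic f)
    (hc : ContDiff ℝ ∞ f) {p : ℕ} {K : ℝ} (hK : CkNormLE p f K) (ζ : Fin d → ℤ) :
    ‖fcoeff f ζ‖ * (1 + ‖ζ‖) ^ p ≤ 2 ^ p * K := by
  have hK0 : 0 ≤ K := (norm_nonneg _).trans (hK 0 (Nat.zero_le _) 0)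
  have h0 : ‖fcoeff f ζ‖ ≤ K := norm_fcoeff_le (fun y => by
    simpa using hK 0 (Nat.zero_le _) y) ζ
  have hp : ‖fcoeff f ζ‖ * ‖ζ‖ ^ p ≤ K := by
    rcases Nat.eq_zero_or_pos d with rfl | hd
    · rcases Nat.eq_zero_or_pos p with rfl | hp
      · simpa using h0
      · have : ζ = 0 := Subsingleton.elim _ _
        rw [this, norm_zero, zero_pow hp.ne', mul_zero]; exact hK0
    · have : Nonempty (Fin d) := ⟨⟨0, hd⟩⟩
      -- Along the coordinate that realizes the sup norm, `p` derivatives multiply the coefficient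
      -- by `(2π‖ζ‖)^p` in modulus.
      obtain ⟨i, hi⟩ : ∃ i, ‖ζ i‖ = ‖ζ‖ := by
        obtain ⟨i, hi⟩ := Finite.exists_max fun i => ‖ζ i‖
        exact ⟨i, le_antisymm (norm_le_pi_norm ζ i)
          ((pi_norm_le_iff_of_nonneg (norm_nonneg _)).2 hi)⟩
      have h1 := (fcoeff_iteratedFDeriv hf hc (EuclideanSpace.single i 1) ζ p).2
      have h2 : ‖fcoeff (fun y => iteratedFDeriv ℝ p f y fun _ => EuclideanSpace.single i (1 : ℝ)) ζ‖
          ≤ K := norm_fcoeff_le (fun y => by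
            refine (ContinuousMultilinearMap.le_opNorm _ _).trans ?_
            simpa using hK p le_rfl y) ζ
      have h3 : ∑ j, (ζ j : ℂ) * (((EuclideanSpace.single i (1 : ℝ) : EuclideanSpace ℝ (Fin d)) j : ℝ) : ℂ)
          = ζ i := by
        rw [Finset.sum_eq_single i] <;> simp +contextual
      rw [h1, h3, norm_mul, norm_pow] at h2
      have h4 : ‖ζ‖ ≤ ‖(2 * Real.pi * Complex.I * (ζ i : ℂ) : ℂ)‖ := by
        rw [← hi]
        simp only [norm_mul, Complex.norm_I, Complex.norm_real, Complex.norm_ofNat, mul_one]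
        rw [Complex.norm_intCast, ← Int.norm_eq_abs, Real.norm_of_nonneg Real.pi_pos.le]
        nlinarith [norm_nonneg (ζ i), Real.pi_gt_three]
      calc ‖fcoeff f ζ‖ * ‖ζ‖ ^ p ≤ ‖fcoeff f ζ‖ * ‖(2 * Real.pi * Complex.I * (ζ i : ℂ) : ℂ)‖ ^ p := by
            gcongr
        _ ≤ K := by rw [mul_comm]; exact h2
  rcases Nat.eq_zero_or_pos p with rfl | hp0
  · simpa using h0
  have h5 := add_pow_le (zero_le_one (α := ℝ)) (norm_nonneg ζ) p
  rw [one_pow] at h5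
  calc ‖fcoeff f ζ‖ * (1 + ‖ζ‖) ^ p ≤ ‖fcoeff f ζ‖ * (2 ^ (p - 1) * (1 + ‖ζ‖ ^ p)) := by gcongr
    _ = 2 ^ (p - 1) * (‖fcoeff f ζ‖ + ‖fcoeff f ζ‖ * ‖ζ‖ ^ p) := by ring
    _ ≤ 2 ^ (p - 1) * (K + K) := by gcongr
    _ = 2 ^ p * K := by
      obtain ⟨q, rfl⟩ : ∃ q, p = q + 1 := ⟨p - 1, by omega⟩
      simp [pow_succ]; ring

theorem wave_eq_mFourier (ζ : Fin d → ℤ) (y : EuclideanSpace ℝ (Fin d)) :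
    wave ζ y = UnitAddTorus.mFourier ζ (toTorus y) := by
  simp only [UnitAddTorus.mFourier, ContinuousMap.coe_mk, toTorus, wave]
  rw [Finset.mul_sum, Complex.exp_sum]
  refine Finset.prod_congr rfl fun i _ => ?_
  rw [fourier_coe_apply]
  congr 1
  push_cast; ring

theorem hasSum_fcoeff {f : EuclideanSpace ℝ (Fin d) → ℂ} (hf : IsPeriodic f) (hc : Continuous f)
    (hs : Summable (fcoeff f)) (x : EuclideanSpace ℝ (Fin d)) :
    HasSum (fun ζ => fcoeff f ζ * wave ζ x) (f x) := by
  let f' : C(UnitAddTorus (Fin d), ℂ) := ⟨fun θ => f (torusRep θ), hf.continuous_torusRep hc⟩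
  have h1 : ∀ ζ, UnitAddTorus.mFourierCoeff f' ζ = fcoeff f ζ := by
    intro ζ
    unfold UnitAddTorus.mFourierCoeff fcoeff torusMean
    refine integral_congr_ae (Filter.Eventually.of_forall fun θ => ?_)
    simp only [wave_eq_mFourier, toTorus_torusRep, smul_eq_mul]
    rfl
  have h2 := UnitAddTorus.hasSum_mFourier_series_apply_of_summable (f := f')
    (by simpa only [funext h1] using hs) (toTorus x)
  simp only [h1, smul_eq_mul, ← wave_eq_mFourier] at h2
  have h3 : f' (toTorus x) = f x := hf.apply_torusRep rfl
  rwa [h3] at h2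

end

/-! ### Weighted `ℓ¹` norms of Fourier coefficients, and ellipticity in Fourier variables -/

section
open MeasureTheory

variable {d m : ℕ}

/-- The weighted `ℓ¹` norm `∑ (1 + |ζ|)^s |f ζ|` is finite and at most `B`. -/
def MomentLE {V : Type*} [Norm V] (s : ℕ) (f : (Fin d → ℤ) → V) (B : ℝ) : Prop :=
  Summable (fun ζ => (1 + ‖ζ‖) ^ s * ‖f ζ‖) ∧ ∑' ζ, (1 + ‖ζ‖) ^ s * ‖f ζ‖ ≤ B

/-- `∑_{ζ ∈ ℤ^d} (1 + |ζ|)^{-2d}`. -/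
def weightSum (d : ℕ) : ℝ := ∑' ζ : Fin d → ℤ, (((1 : ℝ) + ‖ζ‖) ^ (2 * d))⁻¹

theorem weightSum_nonneg (d : ℕ) : 0 ≤ weightSum d := tsum_nonneg fun ζ => by positivity

/-- Of the `s + 2 * d` powers of decay, `2 * d` pay for the summation over `ℤ^d`. This is where a
loss of `2 * d` derivatives of `A` and `g` comes from. -/
theorem momentLE_of_decay {V : Type*} [SeminormedAddCommGroup V] {s : ℕ} {f : (Fin d → ℤ) → V}
    {B : ℝ} (h : ∀ ζ, ‖f ζ‖ * (1 + ‖ζ‖) ^ (s + 2 * d) ≤ B) : MomentLE s f (B * weightSum d) := by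
  have hle : ∀ ζ : Fin d → ℤ, (1 + ‖ζ‖) ^ s * ‖f ζ‖ ≤ B * (((1 : ℝ) + ‖ζ‖) ^ (2 * d))⁻¹ := by
    intro ζ
    rw [← div_eq_mul_inv, le_div_iff₀ (by positivity)]
    refine le_trans (le_of_eq ?_) (h ζ)
    rw [pow_add]; ring
  have hs := (summable_weight d).mul_left B
  refine ⟨Summable.of_nonneg_of_le (fun ζ => by positivity) hle hs, ?_⟩
  rw [weightSum, ← tsum_mul_left]
  exact Summable.tsum_le_tsum hle (Summable.of_nonneg_of_le (fun ζ => by positivity) hle hs) hs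

theorem MomentLE.mono {V : Type*} [SeminormedAddCommGroup V] {s s' : ℕ} (hs : s ≤ s')
    {f : (Fin d → ℤ) → V} {B : ℝ} (h : MomentLE s' f B) : MomentLE s f B := by
  have hle : ∀ ζ : Fin d → ℤ, (1 + ‖ζ‖) ^ s * ‖f ζ‖ ≤ (1 + ‖ζ‖) ^ s' * ‖f ζ‖ := fun ζ => by
    gcongr; linarith [norm_nonneg ζ]
  have h1 := Summable.of_nonneg_of_le (fun ζ => by positivity) hle h.1
  exact ⟨h1, (Summable.tsum_le_tsum hle h1 h.1).trans h.2⟩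

theorem MomentLE.nonneg {V : Type*} [SeminormedAddCommGroup V] {s : ℕ}
    {f : (Fin d → ℤ) → V} {B : ℝ} (h : MomentLE s f B) : 0 ≤ B :=
  (tsum_nonneg fun ζ => by positivity).trans h.2

theorem CkNormLE.clm_comp {F G : Type*} [NormedAddCommGroup F] [NormedSpace ℝ F]
    [NormedAddCommGroup G] [NormedSpace ℝ G] {k : ℕ} {f : EuclideanSpace ℝ (Fin d) → F} {K : ℝ}
    (h : CkNormLE k f K) (hf : ContDiff ℝ ∞ f) (L : F →L[ℝ] G) (hL : ∀ x, ‖L x‖ ≤ ‖x‖) :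
    CkNormLE k (fun y => L (f y)) K := by
  intro j hj y
  have hL1 : ‖L‖ ≤ 1 := L.opNorm_le_bound zero_le_one fun x => by rw [one_mul]; exact hL x
  refine (ContinuousLinearMap.norm_iteratedFDeriv_comp_left L (N := ∞) hf.contDiffAt
    (by exact_mod_cast le_top)).trans ?_
  calc ‖L‖ * ‖iteratedFDeriv ℝ j f y‖ ≤ 1 * ‖iteratedFDeriv ℝ j f y‖ := by gcongr
    _ ≤ K := by rw [one_mul]; exact h j hj y

/-- The map that reads off an entry of a coefficient tensor. -/
def entryCLM (i j : Fin d) (α β : Fin m) : Coeff d m →L[ℝ] ℂ :=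
  Complex.ofRealCLM.comp
    ((ContinuousLinearMap.proj (R := ℝ) (φ := fun _ : Fin m => ℝ) β).comp
      ((ContinuousLinearMap.proj (R := ℝ) (φ := fun _ : Fin m => Fin m → ℝ) α).comp
        ((ContinuousLinearMap.proj (R := ℝ) (φ := fun _ : Fin d => Fin m → Fin m → ℝ) j).comp
          (ContinuousLinearMap.proj (R := ℝ)
            (φ := fun _ : Fin d => Fin d → Fin m → Fin m → ℝ) i))))

theorem entryCLM_apply (i j : Fin d) (α β : Fin m) (a : Coeff d m) :
    entryCLM i j α β a = (a i j α β : ℂ) := rfl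

theorem norm_entryCLM_apply_le (i j : Fin d) (α β : Fin m) (a : Coeff d m) :
    ‖entryCLM i j α β a‖ ≤ ‖a‖ := by
  rw [entryCLM_apply, Complex.norm_real]
  exact (norm_le_pi_norm (a i j α) β).trans <| (norm_le_pi_norm (a i j) α).trans <|
    (norm_le_pi_norm (a i) j).trans (norm_le_pi_norm a i)

/-- The Fourier coefficients of a coefficient field. -/
def tensorCoeff (A : EuclideanSpace ℝ (Fin d) → Coeff d m) (ζ : Fin d → ℤ) :
    Fin d → Fin d → Fin m → Fin m → ℂ :=
  fun i j α β => fcoeff (fun y => (A y i j α β : ℂ)) ζ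

/-- The map that reads off a component of a vector. -/
def compCLM (α : Fin m) : EuclideanSpace ℝ (Fin m) →L[ℝ] ℂ :=
  Complex.ofRealCLM.comp (EuclideanSpace.proj α)

/-- The Fourier coefficients of a vector field. -/
def vectorCoeff (g : EuclideanSpace ℝ (Fin d) → EuclideanSpace ℝ (Fin m)) (ζ : Fin d → ℤ) :
    Fin m → ℂ :=
  fun α => fcoeff (fun y => (g y α : ℂ)) ζ

theorem IsPeriodic.map {F G : Type*} {f : EuclideanSpace ℝ (Fin d) → F} (hf : IsPeriodic f)
    (L : F → G) : IsPeriodic fun y => L (f y) := fun y z => congrArg L (hf y z)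

theorem momentLE_tensorCoeff {A : EuclideanSpace ℝ (Fin d) → Coeff d m} (hA : ContDiff ℝ ∞ A)
    (hp : IsPeriodic A) {s : ℕ} {K : ℝ} (hK : CkNormLE (s + 2 * d) A K) :
    MomentLE s (tensorCoeff A) (2 ^ (s + 2 * d) * K * weightSum d) := by
  have hK0 : 0 ≤ K := (norm_nonneg _).trans (hK 0 (Nat.zero_le _) 0)
  refine momentLE_of_decay fun ζ => ?_
  rw [← le_div_iff₀ (by positivity)]
  have h0 : 0 ≤ 2 ^ (s + 2 * d) * K / (1 + ‖ζ‖) ^ (s + 2 * d) := by positivity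
  refine (pi_norm_le_iff_of_nonneg h0).2 fun i => (pi_norm_le_iff_of_nonneg h0).2 fun j =>
    (pi_norm_le_iff_of_nonneg h0).2 fun α => (pi_norm_le_iff_of_nonneg h0).2 fun β => ?_
  rw [le_div_iff₀ (by positivity)]
  exact norm_fcoeff_mul_weight_le (hp.map (entryCLM i j α β))
    ((entryCLM i j α β).contDiff.comp hA)
    (hK.clm_comp hA (entryCLM i j α β) (norm_entryCLM_apply_le i j α β)) ζ

theorem norm_compCLM_apply_le (α : Fin m) (x : EuclideanSpace ℝ (Fin m)) :
    ‖compCLM α x‖ ≤ ‖x‖ := by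
  change ‖((x α : ℝ) : ℂ)‖ ≤ _
  rw [Complex.norm_real]
  exact PiLp.norm_apply_le x α

theorem momentLE_vectorCoeff {g : EuclideanSpace ℝ (Fin d) → EuclideanSpace ℝ (Fin m)}
    (hg : ContDiff ℝ ∞ g) (hp : IsPeriodic g) {s : ℕ} {K : ℝ} (hK : CkNormLE (s + 2 * d) g K) :
    MomentLE s (vectorCoeff g) (2 ^ (s + 2 * d) * K * weightSum d) := by
  have hK0 : 0 ≤ K := (norm_nonneg _).trans (hK 0 (Nat.zero_le _) 0)
  refine momentLE_of_decay fun ζ => ?_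
  rw [← le_div_iff₀ (by positivity)]
  have h0 : 0 ≤ 2 ^ (s + 2 * d) * K / (1 + ‖ζ‖) ^ (s + 2 * d) := by positivity
  refine (pi_norm_le_iff_of_nonneg h0).2 fun α => ?_
  rw [le_div_iff₀ (by positivity)]
  exact norm_fcoeff_mul_weight_le (hp.map (compCLM α)) ((compCLM α).contDiff.comp hg)
    (hK.clm_comp hg (compCLM α) (norm_compCLM_apply_le α)) ζ

/-- A smooth periodic function has bounded derivatives. -/
theorem exists_ckNormLE {F : Type*} [NormedAddCommGroup F] [NormedSpace ℝ F]
    {f : EuclideanSpace ℝ (Fin d) → F} (hf : ContDiff ℝ ∞ f) (hp : IsPeriodic f) (k : ℕ) :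
    ∃ K, CkNormLE k f K := by
  have h1 : ∀ j : ℕ, ∃ K, ∀ y, ‖iteratedFDeriv ℝ j f y‖ ≤ K := by
    intro j
    have hper : IsPeriodic (iteratedFDeriv ℝ j f) := fun y z => by
      rw [← iteratedFDeriv_comp_add_right, funext fun y => hp y z]
    have hcont : Continuous (iteratedFDeriv ℝ j f) :=
      hf.continuous_iteratedFDeriv (by exact_mod_cast le_top)
    obtain ⟨B, hB⟩ := isCompact_univ.exists_bound_of_continuousOn
      (hper.continuous_torusRep hcont).continuousOn
    exact ⟨B, fun y => by simpa [hper.apply_torusRep rfl] using hB (toTorus y) trivial⟩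
  choose K hK using h1
  refine ⟨∑ j ∈ Finset.range (k + 1), K j, fun j hj y => (hK j y).trans ?_⟩
  exact Finset.single_le_sum (f := K) (fun i _ => (norm_nonneg _).trans (hK i 0))
    (Finset.mem_range.2 (by omega))

theorem fcoeff_one (ζ : Fin d → ℤ) : fcoeff (fun _ => 1) ζ = if ζ = 0 then 1 else 0 := by
  split_ifs with h
  · subst h
    simp [fcoeff, wave_zero, torusMean]
  · obtain ⟨i, hi⟩ := Function.ne_iff.1 h
    have h1 := fcoeff_fderiv (f := fun _ => (1 : ℂ)) (fun _ _ => rfl) contDiff_const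
      (EuclideanSpace.single i (1 : ℝ)) ζ
    have h3 : ∑ j, (ζ j : ℂ) * (((EuclideanSpace.single i (1 : ℝ) : EuclideanSpace ℝ (Fin d)) j : ℝ) : ℂ)
        = ζ i := by
      rw [Finset.sum_eq_single i] <;> simp +contextual
    rw [h3] at h1
    have h4 : fcoeff (fun y : EuclideanSpace ℝ (Fin d) =>
        fderiv ℝ (fun _ => (1 : ℂ)) y (EuclideanSpace.single i (1 : ℝ))) ζ = 0 := by
      simp [fcoeff, torusMean]
    rw [h4] at h1
    have hi' : (ζ i : ℂ) ≠ 0 := by exact_mod_cast hi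
    simpa [hi', Real.pi_ne_zero] using h1.symm

/-- The trigonometric polynomial with coefficients `F`. -/
def trigPoly {S : Finset (Fin d → ℤ)} {P : Type*} (F : S × P → ℂ) (p : P)
    (y : EuclideanSpace ℝ (Fin d)) : ℂ := ∑ a : S, F (a, p) * wave a.1 y

/-- Expanding the two trigonometric polynomials, the mean of `conj (wave ζ) * a * wave η` is the
Fourier coefficient of `a` at `ζ - η`. Multiplication by `a`, cut off to the frequencies in `S`, is
thus a convolution kernel, and pointwise positivity of `a` passes to that kernel. -/
theorem torusMean_quadratic {S : Finset (Fin d → ℤ)} {P : Type*} [Fintype P]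
    (F : S × P → ℂ) (a : EuclideanSpace ℝ (Fin d) → P → P → ℝ)
    (hper : IsPeriodic a) (hc : ∀ p q, Continuous fun y => a y p q) :
    torusMean (fun y => ∑ p, ∑ q, (starRingEnd ℂ) (trigPoly F p y) * a y p q * trigPoly F q y) =
      ∑ x : S × P, (starRingEnd ℂ) (F x) *
        ∑ z : S × P, fcoeff (fun y => (a y x.2 z.2 : ℂ)) (x.1.1 - z.1.1) * F z := by
  have hw : ∀ ζ : Fin d → ℤ, Continuous (wave ζ) := fun ζ => (contDiff_wave ζ).continuous
  have h1 : (fun y => ∑ p, ∑ q, (starRingEnd ℂ) (trigPoly F p y) * a y p q * trigPoly F q y) =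
      fun y => ∑ x : S × P, ∑ z : S × P, ((starRingEnd ℂ) (F x) * F z) *
        (wave (-(x.1.1 - z.1.1)) y * (a y x.2 z.2 : ℂ)) := by
    funext y
    rw [Fintype.sum_prod_type_right]
    refine Finset.sum_congr rfl fun p _ => ?_
    simp_rw [Fintype.sum_prod_type_right (γ := ℂ)]
    rw [Finset.sum_comm]
    refine Finset.sum_congr rfl fun q _ => ?_
    simp only [trigPoly, map_sum, map_mul, conj_wave]
    rw [Finset.sum_mul, Finset.sum_mul_sum]
    refine Finset.sum_congr rfl fun b _ => Finset.sum_congr rfl fun c _ => ?_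
    rw [show -(b.1 - c.1) = -b.1 + c.1 by abel, wave_add]
    ring
  rw [h1, torusMean_finset_sum]
  · refine Finset.sum_congr rfl fun x _ => ?_
    rw [torusMean_finset_sum, Finset.mul_sum]
    · refine Finset.sum_congr rfl fun z _ => ?_
      rw [torusMean_const_mul, fcoeff]
      ring
    · exact fun z _ => fun y w => by
        simp only [hper y w, isPeriodic_wave _ y w]
    · exact fun z _ => continuous_const.mul ((hw _).mul (Complex.continuous_ofReal.comp (hc _ _)))
  · exact fun x _ => fun y w => by
      simp only [hper y w, isPeriodic_wave _ y w]
  · exact fun x _ => continuous_finsetSum _ fun z _ =>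
      continuous_const.mul ((hw _).mul (Complex.continuous_ofReal.comp (hc _ _)))

/-- For real `a` the form splits termwise into its values on the real and the imaginary part of `Φ`,
so no symmetry of `a` is involved. -/
theorem re_quadratic {P : Type*} [Fintype P] (a : P → P → ℝ) (Φ : P → ℂ) :
    (∑ p, ∑ q, (starRingEnd ℂ) (Φ p) * a p q * Φ q).re =
      ∑ p, ∑ q, a p q * (Φ p).re * (Φ q).re + ∑ p, ∑ q, a p q * (Φ p).im * (Φ q).im := by
  simp only [Complex.re_sum, ← Finset.sum_add_distrib]
  refine Finset.sum_congr rfl fun p _ => Finset.sum_congr rfl fun q _ => ?_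
  simp [Complex.mul_re, Complex.mul_im]
  ring

theorem IsElliptic.pair {μ : ℝ} {A : EuclideanSpace ℝ (Fin d) → Coeff d m} (h : IsElliptic μ A)
    (y : EuclideanSpace ℝ (Fin d)) (ξ : Fin d × Fin m → ℝ) :
    μ * ∑ p, ξ p ^ 2 ≤ ∑ p, ∑ q, A y p.1 q.1 p.2 q.2 * ξ p * ξ q := by
  have := (h y fun i α => ξ (i, α)).1
  simp only [Fintype.sum_prod_type]
  refine this.trans (le_of_eq ?_)
  refine Finset.sum_congr rfl fun i _ => ?_
  rw [Finset.sum_comm]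

/-- Ellipticity in Fourier variables, for trigonometric polynomials. -/
theorem IsElliptic.fourier {μ : ℝ} {A : EuclideanSpace ℝ (Fin d) → Coeff d m}
    (h : IsElliptic μ A) (hA : Continuous A) (hp : IsPeriodic A) {S : Finset (Fin d → ℤ)}
    (F : S × Fin d × Fin m → ℂ) :
    μ * ∑ x, ‖F x‖ ^ 2 ≤ (∑ x, (starRingEnd ℂ) (F x) *
      ∑ z, tensorCoeff A (x.1.1 - z.1.1) x.2.1 z.2.1 x.2.2 z.2.2 * F z).re := by
  classical
  have hcA : ∀ p q : Fin d × Fin m, Continuous fun y => A y p.1 q.1 p.2 q.2 := fun p q => by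
    fun_prop
  have h1 := torusMean_quadratic F (fun y p q => A y p.1 q.1 p.2 q.2)
    (fun y z => by simp only [hp y z]) hcA
  -- The same identity for the unit matrix is Parseval's formula. Both sides of the claim are then
  -- means over the torus and can be compared pointwise.
  have h2 := torusMean_quadratic F (fun _ p q => if p = q then 1 else 0)
    (fun y z => rfl) (fun _ _ => continuous_const)
  have hw : ∀ ζ : Fin d → ℤ, Continuous (wave ζ) := fun ζ => (contDiff_wave ζ).continuous
  have hΦc : ∀ p, Continuous (trigPoly F p) := fun p =>
    continuous_finsetSum _ fun a _ => continuous_const.mul (hw _)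
  have hΦp : ∀ p, IsPeriodic (trigPoly F p) := fun p y z => by
    simp only [trigPoly, isPeriodic_wave _ y z]
  have h3 : ∑ x : S × Fin d × Fin m, (starRingEnd ℂ) (F x) * ∑ z : S × Fin d × Fin m,
      fcoeff (fun _ => (((if x.2 = z.2 then 1 else 0 : ℝ)) : ℂ)) (x.1.1 - z.1.1) * F z =
      ((∑ x, ‖F x‖ ^ 2 : ℝ) : ℂ) := by
    push_cast
    refine Finset.sum_congr rfl fun x _ => ?_
    rw [Finset.sum_eq_single x]
    · simp [fcoeff_one, Complex.conj_mul']
    · intro z _ hz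
      by_cases h2 : x.2 = z.2
      · have h1 : x.1.1 - z.1.1 ≠ 0 := fun h0 => hz (Prod.ext (Subtype.ext (sub_eq_zero.1 h0).symm) h2.symm)
        simp [h2, fcoeff_one, h1]
      · simp [h2, fcoeff, torusMean]
    · simp
  rw [h3] at h2
  have key : μ * (torusMean fun y => ∑ p, ∑ q, (starRingEnd ℂ) (trigPoly F p y) *
      ((if p = q then 1 else 0 : ℝ) : ℂ) * trigPoly F q y).re ≤
      (torusMean fun y => ∑ p, ∑ q, (starRingEnd ℂ) (trigPoly F p y) *
        (A y p.1 q.1 p.2 q.2 : ℂ) * trigPoly F q y).re := by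
    have cont : ∀ a : EuclideanSpace ℝ (Fin d) → (Fin d × Fin m) → (Fin d × Fin m) → ℝ,
        IsPeriodic a → (∀ p q, Continuous fun y => a y p q) →
        Integrable (fun θ => ∑ p, ∑ q, (starRingEnd ℂ) (trigPoly F p (torusRep θ)) *
        (a (torusRep θ) p q : ℂ) * trigPoly F q (torusRep θ)) (torusMeasure d) := by
      intro a ha hac
      refine IsPeriodic.integrable (f := fun y => ∑ p, ∑ q, (starRingEnd ℂ) (trigPoly F p y) *
        (a y p q : ℂ) * trigPoly F q y) (fun y z => ?_) ?_
      · simp only [hΦp _ y z, ha y z]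
      · exact continuous_finsetSum _ fun p _ => continuous_finsetSum _ fun q _ =>
          ((Complex.continuous_conj.comp (hΦc p)).mul
            (Complex.continuous_ofReal.comp (hac p q))).mul (hΦc q)
    have i1 := cont (fun _ p q => if p = q then 1 else 0) (fun y z => rfl)
      (fun _ _ => continuous_const)
    have i2 := cont (fun y p q => A y p.1 q.1 p.2 q.2) (fun y z => by simp only [hp y z]) hcA
    have e1 := integral_re i1
    have e2 := integral_re i2
    unfold torusMean
    simp only [RCLike.re_to_complex] at e1 e2
    rw [← e1, ← e2, ← integral_const_mul]
    refine integral_mono (i1.re.const_mul μ) i2.re fun θ => ?_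
    simp only
    rw [re_quadratic, re_quadratic]
    have a1 := h.pair (torusRep θ) fun p => (trigPoly F p (torusRep θ)).re
    have a2 := h.pair (torusRep θ) fun p => (trigPoly F p (torusRep θ)).im
    simp only [ite_mul, one_mul, zero_mul, Finset.sum_ite_eq, Finset.mem_univ, if_true, ← pow_two]
    linarith
  rw [h1, h2, Complex.ofReal_re] at key
  exact key

end

/-! ### The abstract Galerkin system: normal derivatives and the energy identity -/

section

open scoped RealInnerProductSpace

/-- A Galerkin approximation of the lifted half-space problem, in abstract form. `X` and `Y` are
spaces of scalar and gradient fields, `G` is the gradient, `N` multiplication by the normal, `A` the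
coefficient operator, `W s` and `V s` are the Sobolev weights of order `s`, `E` is the projection to
the mean value and `h` the Neumann datum. The estimates hold up to order `p`. -/
structure GalerkinSystem (X Y : Type) [NormedAddCommGroup X] [InnerProductSpace ℝ X]
    [NormedAddCommGroup Y] [InnerProductSpace ℝ Y] (p : ℕ) (c B D H κ : ℝ) where
  G : X →L[ℝ] Y
  N : X →L[ℝ] Y
  Nt : Y →L[ℝ] X
  Dv : Y →L[ℝ] X
  dn : Y →L[ℝ] Y
  A : Y →L[ℝ] Y
  W : ℕ → X →L[ℝ] X
  V : ℕ → Y →L[ℝ] Y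
  E : X →L[ℝ] X
  h : X
  inner_N : ∀ F w, ⟪F, N w⟫ = ⟪Nt F, w⟫
  Nt_N : ∀ w, Nt (N w) = w
  inner_G : ∀ F w, ⟪F, G w⟫ = -⟪Dv F, w⟫
  skew : ∀ w, ⟪Nt (G w), w⟫ = 0
  dn_G : ∀ v, dn (G v) = G (Nt (G v))
  dn_N : ∀ v, dn (N v) = N (Nt (G v))
  W_symm : ∀ s x y, ⟪W s x, y⟫ = ⟪x, W s y⟫
  V_symm : ∀ s x y, ⟪V s x, y⟫ = ⟪x, V s y⟫
  V_G : ∀ s x, V s (G x) = G (W s x)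
  V_N : ∀ s x, V s (N x) = N (W s x)
  W_Nt : ∀ s F, W s (Nt F) = Nt (V s F)
  norm_V_mono : ∀ s F, ‖V s F‖ ≤ ‖V (s + 1) F‖
  norm_V_G : ∀ s x, ‖V s (G x)‖ ≤ D * ‖W (s + 1) x‖
  norm_V_dn : ∀ s F, ‖V s (dn F)‖ ≤ D * ‖V (s + 1) F‖
  norm_W_Dv : ∀ s F, ‖W s (Dv F)‖ ≤ D * ‖V (s + 1) F‖
  V_zero : ∀ F, V 0 F = F
  E_symm : ∀ x y, ⟪E x, y⟫ = ⟪x, E y⟫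
  norm_E : ∀ x, ‖E x‖ ≤ ‖x‖
  W_E : ∀ s x, W s (E x) = E x
  G_E : ∀ x, G (E x) = 0
  E_Nt_G : ∀ x, E (Nt (G x)) = 0
  E_h : E h = 0
  coercive : ∀ s ≤ p, ∀ F, c * ‖V s F‖ ^ 2 ≤ ⟪V s (A F), V s F⟫
  bounded : ∀ s ≤ p, ∀ F, ‖V s (A F)‖ ≤ B * ‖V s F‖
  diophantine : ∀ s v q, ‖W s (v - E v)‖ ≤ D / κ * ‖V (s + 2) (G v - N q)‖
  datum_left : ∀ s ≤ p, ∀ v q, |⟪W s h, W s v⟫| ≤ H * ‖V s (G v - N q)‖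
  datum_right : ∀ s ≤ p, ∀ v q, |⟪W s h, W s q⟫| ≤ H * ‖V s (G v - N q)‖
  c_pos : 0 < c
  B_nonneg : 0 ≤ B
  D_nonneg : 0 ≤ D
  H_nonneg : 0 ≤ H
  κ_pos : 0 < κ
  κ_le_one : κ ≤ 1

namespace GalerkinSystem

variable {X Y : Type} [NormedAddCommGroup X] [InnerProductSpace ℝ X]
    [NormedAddCommGroup Y] [InnerProductSpace ℝ Y] {p : ℕ} {c B D H κ : ℝ}
    (sys : GalerkinSystem X Y p c B D H κ)

theorem norm_N (w : X) : ‖sys.N w‖ = ‖w‖ := by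
  have : ‖sys.N w‖ ^ 2 = ‖w‖ ^ 2 := by
    rw [← real_inner_self_eq_norm_sq, ← real_inner_self_eq_norm_sq, sys.inner_N, sys.Nt_N]
  exact (sq_eq_sq₀ (norm_nonneg _) (norm_nonneg _)).1 this

theorem norm_Nt_le (F : Y) : ‖sys.Nt F‖ ≤ ‖F‖ := by
  have h1 : ‖sys.Nt F‖ * ‖sys.Nt F‖ ≤ ‖F‖ * ‖sys.Nt F‖ := by
    rw [← real_inner_self_eq_norm_mul_norm, ← sys.inner_N]
    refine (real_inner_le_norm _ _).trans ?_
    rw [sys.norm_N]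
  rcases (norm_nonneg (sys.Nt F)).eq_or_lt with h0 | h0
  · rw [← h0]; exact norm_nonneg _
  · exact le_of_mul_le_mul_right h1 h0

theorem norm_V_mono_le {s s' : ℕ} (h : s ≤ s') (F : Y) : ‖sys.V s F‖ ≤ ‖sys.V s' F‖ := by
  induction h with
  | refl => exact le_rfl
  | step _ ih => exact ih.trans (sys.norm_V_mono _ _)

/-- The normal derivative of the gradient is controlled by its tangential derivatives. -/
theorem norm_deriv_flux_le {s : ℕ} (hs : s + 1 ≤ p) {v q z : X}
    (heq : ∀ w, ⟪sys.A (sys.G q - sys.N z), sys.N w⟫ = -⟪sys.A (sys.G v - sys.N q), sys.G w⟫) :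
    ‖sys.V s (sys.G q - sys.N z)‖ ≤ (4 * D + 5 * D * B / c) * ‖sys.V (s + 1) (sys.G v - sys.N q)‖ := by
  have hc := sys.c_pos
  have hB := sys.B_nonneg
  have hD := sys.D_nonneg
  set F := sys.G v - sys.N q with hF
  set π := sys.Nt F with hπ
  set r := sys.Nt (sys.G q) - z with hr
  set Z := sys.G q - sys.N (sys.Nt (sys.G q)) with hZ
  have hπ' : π = sys.Nt (sys.G v) - q := by rw [hπ, hF, map_sub, sys.Nt_N]
  have hF' : sys.G q - sys.N z = Z + sys.N r := by rw [hZ, hr, map_sub]; abel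
  -- `Z` is the tangential gradient of `q`. Only the combination `π = Nt (G v) - q` is a component
  -- of `F`, so `q` is replaced by `Nt (G v) - π`. By `dn_G` and `dn_N`, the tangential gradient of
  -- `Nt (G v)` is the `n`-derivative of the tangential gradient of `v`, which equals `F - N π`. The
  -- variable `q` has disappeared.
  have hZ' : Z = sys.dn (F - sys.N π) - (sys.G π - sys.N (sys.Nt (sys.G π))) := by
    simp only [hZ, hF, hπ', map_sub, sys.dn_G, sys.dn_N]
    abel
  set n1 := ‖sys.V (s + 1) F‖ with hn1
  have hn0 : 0 ≤ n1 := norm_nonneg _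
  have hWπ : ‖sys.W (s + 1) π‖ ≤ n1 := by
    rw [hπ, sys.W_Nt]; exact sys.norm_Nt_le _
  have hVN : ‖sys.V (s + 1) (sys.N π)‖ ≤ n1 := by rw [sys.V_N, sys.norm_N]; exact hWπ
  have hGπ : ‖sys.V s (sys.G π)‖ ≤ D * n1 :=
    (sys.norm_V_G s π).trans (mul_le_mul_of_nonneg_left hWπ hD)
  have hZn : ‖sys.V s Z‖ ≤ 4 * D * n1 := by
    rw [hZ', map_sub, map_sub (sys.V s) (sys.G π)]
    have e1 : ‖sys.V s (sys.dn (F - sys.N π))‖ ≤ D * (n1 + n1) := by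
      refine (sys.norm_V_dn s _).trans (mul_le_mul_of_nonneg_left ?_ hD)
      rw [map_sub]
      exact (norm_sub_le _ _).trans (add_le_add le_rfl hVN)
    have e2 : ‖sys.V s (sys.N (sys.Nt (sys.G π)))‖ ≤ D * n1 := by
      rw [sys.V_N, sys.norm_N, sys.W_Nt]
      exact (sys.norm_Nt_le _).trans hGπ
    calc _ ≤ ‖sys.V s (sys.dn (F - sys.N π))‖ +
          (‖sys.V s (sys.G π)‖ + ‖sys.V s (sys.N (sys.Nt (sys.G π)))‖) :=
          (norm_sub_le _ _).trans (add_le_add le_rfl (norm_sub_le _ _))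
      _ ≤ D * (n1 + n1) + (D * n1 + D * n1) := add_le_add e1 (add_le_add hGπ e2)
      _ = 4 * D * n1 := by ring
  have hVNr : ‖sys.V s (sys.N r)‖ = ‖sys.W s r‖ := by rw [sys.V_N, sys.norm_N]
  -- The remaining normal part `N r` is found from the equation: the normal component of `A (G q - N
  -- z)` equals `Dv (A F)`, and coercivity on the range of `N` solves for `r`.
  have hr1 : c * ‖sys.W s r‖ ^ 2 ≤ 5 * D * B * n1 * ‖sys.W s r‖ := by
    have h1 := sys.coercive s (by omega) (sys.N r)
    rw [hVNr] at h1
    have h2 : sys.A (sys.N r) = sys.A (sys.G q - sys.N z) - sys.A Z := by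
      rw [hF', map_add]; abel
    have h3 : ⟪sys.V s (sys.A (sys.G q - sys.N z)), sys.V s (sys.N r)⟫ =
        ⟪sys.W s (sys.Dv (sys.A F)), sys.W s r⟫ := by
      rw [sys.V_symm, sys.V_N, sys.V_N, heq, sys.inner_G, neg_neg, sys.W_symm]
    rw [h2, map_sub (sys.V s), inner_sub_left, h3] at h1
    have h4 : ⟪sys.W s (sys.Dv (sys.A F)), sys.W s r⟫ ≤ D * (B * n1) * ‖sys.W s r‖ := by
      refine (real_inner_le_norm _ _).trans (mul_le_mul_of_nonneg_right ?_ (norm_nonneg _))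
      exact (sys.norm_W_Dv s _).trans (mul_le_mul_of_nonneg_left (sys.bounded _ hs F) hD)
    have h5 : -⟪sys.V s (sys.A Z), sys.V s (sys.N r)⟫ ≤ B * (4 * D * n1) * ‖sys.W s r‖ := by
      rw [← inner_neg_left, ← hVNr]
      refine (real_inner_le_norm _ _).trans (mul_le_mul_of_nonneg_right ?_ (norm_nonneg _))
      rw [norm_neg]
      exact (sys.bounded s (by omega) Z).trans (mul_le_mul_of_nonneg_left hZn hB)
    linarith
  have hr2 : ‖sys.W s r‖ ≤ 5 * D * B / c * n1 := by
    rcases (norm_nonneg (sys.W s r)).eq_or_lt with h0 | h0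
    · rw [← h0]; positivity
    · have : c * ‖sys.W s r‖ ≤ 5 * D * B * n1 := by
        refine le_of_mul_le_mul_right ?_ h0
        linarith [hr1]
      rw [div_mul_eq_mul_div, le_div_iff₀ hc]
      linarith
  rw [hF', map_add]
  calc _ ≤ ‖sys.V s Z‖ + ‖sys.V s (sys.N r)‖ := norm_add_le _ _
    _ ≤ 4 * D * n1 + 5 * D * B / c * n1 := add_le_add hZn (hVNr.le.trans hr2)
    _ = _ := by ring

/-- The lifted gradient of a curve `v`. -/
def flux (v : ℝ → X) (t : ℝ) : Y := sys.G (v t) - sys.N (deriv v t)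

/-- Smooth solutions of the Galerkin equations. -/
structure IsSol (v : ℝ → X) : Prop where
  smooth : ContDiff ℝ ∞ v
  weak : ∀ t w, ⟪sys.A (sys.flux (deriv v) t), sys.N w⟫ = -⟪sys.A (sys.flux v t), sys.G w⟫

variable {sys}

theorem contDiff_deriv {F : Type*} [NormedAddCommGroup F] [NormedSpace ℝ F] {v : ℝ → F}
    (hv : ContDiff ℝ ∞ v) : ContDiff ℝ ∞ (deriv v) :=
  (contDiff_infty_iff_deriv.1 hv).2

theorem hasDerivAt_flux {v : ℝ → X} (hv : ContDiff ℝ ∞ v) (t : ℝ) :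
    HasDerivAt (sys.flux v) (sys.flux (deriv v) t) t := by
  have h1 : HasDerivAt v (deriv v t) t := (hv.differentiable (by simp) t).hasDerivAt
  have h2 : HasDerivAt (deriv v) (deriv (deriv v) t) t :=
    ((contDiff_deriv hv).differentiable (by simp) t).hasDerivAt
  exact (sys.G.hasFDerivAt.comp_hasDerivAt t h1).sub (sys.N.hasFDerivAt.comp_hasDerivAt t h2)

/-- The coefficients do not depend on `t`, so differentiation in `t` preserves the equation. This is
what allows the estimate of one normal derivative to be iterated. -/
theorem IsSol.deriv {v : ℝ → X} (hv : sys.IsSol v) : sys.IsSol (deriv v) := by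
  refine ⟨contDiff_deriv hv.smooth, fun t w => ?_⟩
  have h1 : HasDerivAt (fun t => ⟪sys.A (sys.flux (_root_.deriv v) t), sys.N w⟫)
      ⟪sys.A (sys.flux (_root_.deriv (_root_.deriv v)) t), sys.N w⟫ t := by
    have := (sys.A.hasFDerivAt.comp_hasDerivAt t
      (hasDerivAt_flux (sys := sys) (contDiff_deriv hv.smooth) t)).inner ℝ
      (hasDerivAt_const t (sys.N w))
    simpa using this
  have h2 : HasDerivAt (fun t => -⟪sys.A (sys.flux v t), sys.G w⟫)
      (-⟪sys.A (sys.flux (_root_.deriv v) t), sys.G w⟫) t := by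
    have := (sys.A.hasFDerivAt.comp_hasDerivAt t
      (hasDerivAt_flux (sys := sys) hv.smooth t)).inner ℝ (hasDerivAt_const t (sys.G w))
    simpa using this.fun_neg
  rw [funext fun t => hv.weak t w] at h1
  exact h1.unique h2

theorem IsSol.iterate_deriv {v : ℝ → X} (hv : sys.IsSol v) (k : ℕ) :
    sys.IsSol (_root_.deriv^[k] v) := by
  induction k with
  | zero => exact hv
  | succ k ih => rw [Function.iterate_succ_apply']; exact ih.deriv

theorem IsSol.norm_flux_deriv_le {v : ℝ → X} (hv : sys.IsSol v) {s : ℕ} (hs : s + 1 ≤ p) (t : ℝ) :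
    ‖sys.V s (sys.flux (_root_.deriv v) t)‖ ≤
      (4 * D + 5 * D * B / c) * ‖sys.V (s + 1) (sys.flux v t)‖ :=
  sys.norm_deriv_flux_le hs fun w => hv.weak t w

theorem IsSol.norm_flux_iterate_le {v : ℝ → X} (hv : sys.IsSol v) (k : ℕ) {s : ℕ}
    (hs : s + k ≤ p) (t : ℝ) :
    ‖sys.V s (sys.flux (_root_.deriv^[k] v) t)‖ ≤
      (4 * D + 5 * D * B / c) ^ k * ‖sys.V (s + k) (sys.flux v t)‖ := by
  have hC : 0 ≤ 4 * D + 5 * D * B / c := by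
    have := sys.c_pos; have := sys.B_nonneg; have := sys.D_nonneg; positivity
  induction k generalizing s with
  | zero => simp
  | succ k ih =>
    rw [Function.iterate_succ_apply']
    refine ((hv.iterate_deriv k).norm_flux_deriv_le (by omega) t).trans ?_
    have := ih (s := s + 1) (by omega)
    rw [show s + 1 + k = s + (k + 1) by ring] at this
    calc _ ≤ (4 * D + 5 * D * B / c) * ((4 * D + 5 * D * B / c) ^ k * _) :=
          mul_le_mul_of_nonneg_left this hC
      _ = _ := by ring

/-- The energy of order `s`. -/
def energy (sys : GalerkinSystem X Y p c B D H κ) (s : ℕ) (v : ℝ → X) (t : ℝ) : ℝ :=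
  ⟪sys.A (sys.flux v t), sys.N (sys.W s (sys.W s (v t)))⟫

/-- In the product rule the weak equation turns the term with the derivative of the flux into `-⟨A
F, G W² v⟩`. The other term is `⟨A F, N W² v'⟩`, and the two recombine to `F = G v - N v'` because
the weights commute with `G` and `N`. -/
theorem IsSol.hasDerivAt_energy {v : ℝ → X} (hv : sys.IsSol v) (s : ℕ) (t : ℝ) :
    HasDerivAt (sys.energy s v) (-⟪sys.V s (sys.A (sys.flux v t)), sys.V s (sys.flux v t)⟫) t := by
  have h1 : HasDerivAt v (_root_.deriv v t) t := (hv.smooth.differentiable (by simp) t).hasDerivAt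
  have h2 := sys.A.hasFDerivAt.comp_hasDerivAt t (hasDerivAt_flux (sys := sys) hv.smooth t)
  have h3 := (sys.N.comp ((sys.W s).comp (sys.W s))).hasFDerivAt.comp_hasDerivAt t h1
  refine (h2.inner ℝ h3).congr_deriv ?_
  simp only [ContinuousLinearMap.comp_apply, Function.comp]
  have e1 : ⟪sys.A (sys.flux v t), sys.N (sys.W s (sys.W s (_root_.deriv v t)))⟫ =
      ⟪sys.V s (sys.A (sys.flux v t)), sys.V s (sys.N (_root_.deriv v t))⟫ := by
    rw [sys.V_symm, sys.V_N, sys.V_N]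
  have e2 : ⟪sys.A (sys.flux v t), sys.G (sys.W s (sys.W s (v t)))⟫ =
      ⟪sys.V s (sys.A (sys.flux v t)), sys.V s (sys.G (v t))⟫ := by
    rw [sys.V_symm, sys.V_G, sys.V_G]
  rw [hv.weak, e1, e2]
  have e : sys.V s (sys.flux v t) = sys.V s (sys.G (v t)) - sys.V s (sys.N (_root_.deriv v t)) :=
    map_sub _ _ _
  rw [e, inner_sub_right]
  ring

end GalerkinSystem

end

/-! ### A priori decay estimates for the Galerkin system, uniform in the width `R` -/

section

open scoped RealInnerProductSpace

namespace GalerkinSystem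

variable {X Y : Type} [NormedAddCommGroup X] [InnerProductSpace ℝ X]
    [NormedAddCommGroup Y] [InnerProductSpace ℝ Y] {p : ℕ} {c B D H κ : ℝ}
    {sys : GalerkinSystem X Y p c B D H κ}

/-- Solutions on `[0, R]` with Neumann datum `h` at `0` and zero Dirichlet datum at `R`. -/
structure IsBoundarySol (sys : GalerkinSystem X Y p c B D H κ) (R : ℝ) (v : ℝ → X) : Prop
    extends sys.IsSol v where
  one_le : 1 ≤ R
  neumann : ∀ w, ⟪sys.A (sys.flux v 0), sys.N w⟫ = ⟪sys.h, w⟫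
  dirichlet : v R = 0

variable {R : ℝ} {v : ℝ → X}

theorem antitone_of_hasDerivAt_nonpos {f f' : ℝ → ℝ} {a b : ℝ}
    (hf : ∀ t, HasDerivAt f (f' t) t) (h : ∀ t, a ≤ t → t ≤ b → f' t ≤ 0) :
    AntitoneOn f (Set.Icc a b) := by
  refine antitoneOn_of_deriv_nonpos (convex_Icc a b)
    (fun t _ => (hf t).continuousAt.continuousWithinAt)
    (fun t _ => (hf t).differentiableAt.differentiableWithinAt) fun t ht => ?_
  rw [interior_Icc] at ht
  rw [(hf t).deriv]
  exact h t ht.1.le ht.2.le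

theorem IsSol.deriv_energy_le (_hv : sys.IsSol v) {s : ℕ} (hs : s ≤ p) (t : ℝ) :
    -⟪sys.V s (sys.A (sys.flux v t)), sys.V s (sys.flux v t)⟫ ≤ -(c * ‖sys.V s (sys.flux v t)‖ ^ 2) :=
  neg_le_neg (sys.coercive s hs _)

theorem IsSol.energy_antitone (hv : sys.IsSol v) {s : ℕ} (hs : s ≤ p) : Antitone (sys.energy s v) := by
  refine antitone_of_deriv_nonpos (fun t => (hv.hasDerivAt_energy s t).differentiableAt) fun t => ?_
  rw [(hv.hasDerivAt_energy s t).deriv]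
  have := sys.c_pos
  exact (hv.deriv_energy_le hs t).trans (neg_nonpos.2 (by positivity))

/-- The energy decreases to its value at `R`, which is zero by the Dirichlet condition. This sign is
the reason for that condition. -/
theorem IsBoundarySol.energy_nonneg (hv : sys.IsBoundarySol R v) {s : ℕ} (hs : s ≤ p) {t : ℝ}
    (ht : t ≤ R) : 0 ≤ sys.energy s v t := by
  have h := hv.energy_antitone hs ht
  have h0 : sys.energy s v R = 0 := by simp [energy, hv.dirichlet]
  rwa [h0] at h

/-- The flux through the hyperplanes `t = const` has mean zero. -/
theorem IsBoundarySol.mean_flux (hv : sys.IsBoundarySol R v) (t : ℝ) (w : X) :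
    ⟪sys.A (sys.flux v t), sys.N (sys.E w)⟫ = 0 := by
  -- Test the equation with a constant function: its gradient vanishes, so the total flux is
  -- conserved. At `t = 0` it is the mean of the datum.
  have h1 : ∀ t, HasDerivAt (fun t => ⟪sys.A (sys.flux v t), sys.N (sys.E w)⟫) 0 t := by
    intro t
    have := (sys.A.hasFDerivAt.comp_hasDerivAt t
      (hasDerivAt_flux (sys := sys) hv.smooth t)).inner ℝ (hasDerivAt_const t (sys.N (sys.E w)))
    refine this.congr_deriv ?_
    rw [hv.weak, sys.G_E]
    simp
  have h2 := is_const_of_deriv_eq_zero (fun t => (h1 t).differentiableAt)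
    (fun t => (h1 t).deriv) t 0
  rw [h2, hv.neumann, ← sys.E_symm, sys.E_h, inner_zero_left]

/-- The energy of order `s` is controlled by the gradient, with a loss of two derivatives. -/
theorem IsBoundarySol.energy_le (hv : sys.IsBoundarySol R v) {s : ℕ} (hs : s + 2 ≤ p) (t : ℝ) :
    sys.energy s v t ≤ B * D / κ * ‖sys.V (s + 2) (sys.flux v t)‖ ^ 2 := by
  have hκ := sys.κ_pos
  have hB := sys.B_nonneg
  have hD := sys.D_nonneg
  -- As the flux has mean zero, `v` may be replaced by `v - E v`, to which the Diophantine estimate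
  -- applies.
  have h1 : sys.energy s v t =
      ⟪sys.V s (sys.A (sys.flux v t)), sys.N (sys.W s (v t - sys.E (v t)))⟫ := by
    have e : sys.W s (sys.W s (v t)) =
        sys.W s (sys.W s (v t - sys.E (v t))) + sys.E (v t) := by
      rw [map_sub, map_sub, sys.W_E, sys.W_E]; abel
    rw [energy, e, map_add, inner_add_right, hv.mean_flux, add_zero, ← sys.V_N, ← sys.V_symm]
  rw [h1]
  calc _ ≤ ‖sys.V s (sys.A (sys.flux v t))‖ * ‖sys.N (sys.W s (v t - sys.E (v t)))‖ :=
        real_inner_le_norm _ _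
    _ ≤ (B * ‖sys.V (s + 2) (sys.flux v t)‖) * (D / κ * ‖sys.V (s + 2) (sys.flux v t)‖) := by
        rw [sys.norm_N]
        refine mul_le_mul ?_ (sys.diophantine s (v t) _) (norm_nonneg _) (by positivity)
        exact (sys.bounded s (by omega) _).trans
          (mul_le_mul_of_nonneg_left (sys.norm_V_mono_le (by omega) _) hB)
    _ = _ := by ring

/-- Bound of the energy by the Neumann datum, uniformly in the Diophantine constant. -/
theorem IsBoundarySol.energy_zero_le (hv : sys.IsBoundarySol R v) {s : ℕ} (hs : s ≤ p) :
    sys.energy s v 0 ≤ 4 * H ^ 2 / c := by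
  have hc := sys.c_pos
  have hH := sys.H_nonneg
  -- The Neumann condition gives `e_s(0) = ⟨W h, W v(0)⟩ = ψ 0`, and the cut-off `1 - t` makes `ψ 1
  -- = 0`. Thus `e_s(0)` is minus the integral of `ψ'` over `[0, 1]`. There `v` and `v'` occur only
  -- paired with `h`, so the datum estimates bound them by the flux without `κ`.
  set ψ : ℝ → ℝ := fun t => (1 - t) * ⟪sys.W s sys.h, sys.W s (v t)⟫ with hψ
  set ψ' : ℝ → ℝ := fun t => -⟪sys.W s sys.h, sys.W s (v t)⟫ +
    (1 - t) * ⟪sys.W s sys.h, sys.W s (deriv v t)⟫ with hψ'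
  have hd : ∀ t, HasDerivAt ψ (ψ' t) t := by
    intro t
    have h1 : HasDerivAt v (deriv v t) t := (hv.smooth.differentiable (by simp) t).hasDerivAt
    have h2 := (hasDerivAt_const t (sys.W s sys.h)).inner ℝ
      ((sys.W s).hasFDerivAt.comp_hasDerivAt t h1)
    have h3 := ((hasDerivAt_id t).const_sub 1).mul h2
    refine h3.congr_deriv ?_
    simp [hψ']
  have h0 : ψ 0 = sys.energy s v 0 := by
    simp only [hψ, energy, hv.neumann, sub_zero, one_mul]
    rw [sys.W_symm]
  have hbound : ∀ t, 0 ≤ t → t ≤ 1 → -ψ' t ≤ 2 * H ^ 2 / c +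
      1 / 2 * (c * ‖sys.V s (sys.flux v t)‖ ^ 2) := by
    intro t h0 h1
    have a1 := sys.datum_left s hs (v t) (deriv v t)
    have a2 := sys.datum_right s hs (v t) (deriv v t)
    set x := ‖sys.V s (sys.flux v t)‖ with hx
    have a1' : |⟪sys.W s sys.h, sys.W s (v t)⟫| ≤ H * x := a1
    have a2' : |⟪sys.W s sys.h, sys.W s (deriv v t)⟫| ≤ H * x := a2
    have b1 := (abs_le.1 a1').2
    have b2 := (abs_le.1 a2').1
    have hx0 : 0 ≤ H * x := mul_nonneg hH (norm_nonneg _)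
    have b3 : -((1 - t) * ⟪sys.W s sys.h, sys.W s (deriv v t)⟫) ≤ H * x := by nlinarith
    have b4 : 2 * (H * x) ≤ 2 * H ^ 2 / c + 1 / 2 * (c * x ^ 2) := by
      rw [div_add' _ _ _ hc.ne', le_div_iff₀ hc]
      nlinarith [sq_nonneg (2 * H - c * x)]
    simp only [hψ']
    linarith
  -- Half of the dissipation `-e_s'` absorbs the quadratic term in `hbound`. Monotonicity of the
  -- combined function replaces the integration over `[0, 1]`.
  have hmono := antitone_of_hasDerivAt_nonpos (a := 0) (b := 1)
    (f := fun t => -ψ t + 1 / 2 * sys.energy s v t - 2 * H ^ 2 / c * t)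
    (fun t => (((hd t).neg).add ((hv.hasDerivAt_energy s t).const_mul (1 / 2))).sub
      ((hasDerivAt_id t).const_mul (2 * H ^ 2 / c))) (fun t ht0 ht1 => by
      have := hbound t ht0 ht1
      have := hv.deriv_energy_le hs t
      linarith)
  have h2 := hmono (Set.left_mem_Icc.2 zero_le_one) (Set.right_mem_Icc.2 zero_le_one) zero_le_one
  have h3 : ψ 1 = 0 := by simp [hψ]
  have h4 := hv.energy_nonneg hs hv.one_le
  simp only [h3, h0] at h2
  have : 4 * H ^ 2 / c = 2 * (2 * H ^ 2 / c) := by ring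
  linarith

/-- One step of the decay iteration. -/
theorem IsBoundarySol.energy_half_le (hv : sys.IsBoundarySol R v) {s : ℕ} (hs : s + 2 ≤ p) {t : ℝ}
    (ht0 : 0 ≤ t) (ht : t ≤ R) :
    κ * t * sys.energy s v t ≤ 2 * (B * D / c) * sys.energy (s + 2) v (t / 2) := by
  have hc := sys.c_pos
  have hκ := sys.κ_pos
  have hB := sys.B_nonneg
  have hD := sys.D_nonneg
  -- For `τ` in `[t/2, t]` one has `κ e_s(t) ≤ κ e_s(τ) ≤ B D ‖V_{s+2} F(τ)‖² ≤ -(B D / c)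
  -- e_{s+2}'(τ)`. So the function below decreases, and its endpoint values give the claim.
  have hmono := antitone_of_hasDerivAt_nonpos (a := t / 2) (b := t)
    (f := fun τ => B * D / c * sys.energy (s + 2) v τ + κ * sys.energy s v t * τ)
    (fun τ => ((hv.hasDerivAt_energy (s + 2) τ).const_mul (B * D / c)).add
      ((hasDerivAt_id τ).const_mul (κ * sys.energy s v t))) (fun τ h1 h2 => by
      have e1 := hv.energy_antitone (s := s) (by omega) h2
      have e2 := hv.energy_le hs τ
      have e3 := hv.deriv_energy_le hs τ
      have e4 : κ * sys.energy s v t ≤ B * D * ‖sys.V (s + 2) (sys.flux v τ)‖ ^ 2 := by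
        have := mul_le_mul_of_nonneg_left (e1.trans e2) hκ.le
        refine this.trans (le_of_eq ?_)
        field_simp
      have e5 := mul_le_mul_of_nonneg_left e3 (show 0 ≤ B * D / c by positivity)
      have e6 : B * D / c * -(c * ‖sys.V (s + 2) (sys.flux v τ)‖ ^ 2) =
        -(B * D * ‖sys.V (s + 2) (sys.flux v τ)‖ ^ 2) := by field_simp
      rw [e6] at e5
      linarith)
  have h1 := hmono (Set.left_mem_Icc.2 (by linarith)) (Set.right_mem_Icc.2 (by linarith))
    (by linarith : t / 2 ≤ t)
  simp only at h1
  have h2 := mul_nonneg (show 0 ≤ B * D / c by positivity) (hv.energy_nonneg hs ht)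
  linarith

/-- The constants of the energy decay. -/
def decayConst (b : ℝ) : ℕ → ℝ
  | 0 => 1
  | l + 1 => 2 ^ (l + 1) + 2 ^ (l + 2) * b * decayConst b l

theorem decayConst_nonneg {b : ℝ} (hb : 0 ≤ b) (l : ℕ) : 0 ≤ decayConst b l := by
  induction l with
  | zero => simp [decayConst]
  | succ l ih => simp only [decayConst]; positivity

/-- Induction on `l` by `energy_half_le`: each power of `1 + κ t` costs two orders of regularity and
a halving of `t`. Where `κ t ≤ 1` the bound by the initial energy already suffices. -/
theorem IsBoundarySol.energy_decay (hv : sys.IsBoundarySol R v) (l : ℕ) {s : ℕ}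
    (hs : s + 2 * l ≤ p) {t : ℝ} (ht0 : 0 ≤ t) (ht : t ≤ R) :
    sys.energy s v t * (1 + κ * t) ^ l ≤ decayConst (B * D / c) l * (4 * H ^ 2 / c) := by
  have hc := sys.c_pos
  have hκ := sys.κ_pos
  have hB := sys.B_nonneg
  have hD := sys.D_nonneg
  have hH := sys.H_nonneg
  set b := B * D / c with hb
  have hb0 : 0 ≤ b := by positivity
  set M := 4 * H ^ 2 / c with hM
  have hM0 : 0 ≤ M := by positivity
  induction l generalizing s t with
  | zero =>
    simp only [decayConst, pow_zero, mul_one, one_mul]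
    exact (hv.energy_antitone (s := s) (by omega) ht0).trans (hv.energy_zero_le (by omega))
  | succ l ih =>
    have hE := hv.energy_nonneg (s := s) (by omega) ht
    have hC := decayConst_nonneg hb0 l
    rcases le_total (κ * t) 1 with h1 | h1
    · have e1 : sys.energy s v t ≤ M :=
        (hv.energy_antitone (s := s) (by omega) ht0).trans (hv.energy_zero_le (by omega))
      have e2 : (1 + κ * t) ^ (l + 1) ≤ 2 ^ (l + 1) := by
        gcongr; linarith
      calc _ ≤ M * 2 ^ (l + 1) := by gcongr
        _ ≤ decayConst b (l + 1) * M := by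
          simp only [decayConst]
          have : 0 ≤ 2 ^ (l + 2) * b * decayConst b l * M := by positivity
          linarith
    · have e1 := hv.energy_half_le (s := s) (by omega) ht0 ht
      have e2 := ih (s := s + 2) (by omega) (t := t / 2) (by linarith) (by linarith)
      have hE2 := hv.energy_nonneg (s := s + 2) (by omega) (t := t / 2) (by linarith)
      have e3 : (1 + κ * t) ^ l ≤ 2 ^ l * (1 + κ * (t / 2)) ^ l := by
        rw [← mul_pow]; gcongr; linarith
      calc sys.energy s v t * (1 + κ * t) ^ (l + 1)
          = (1 + κ * t) * sys.energy s v t * (1 + κ * t) ^ l := by ring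
        _ ≤ (2 * (κ * t)) * sys.energy s v t * (2 ^ l * (1 + κ * (t / 2)) ^ l) := by
            gcongr; linarith
        _ = 2 ^ (l + 1) * (κ * t * sys.energy s v t) * (1 + κ * (t / 2)) ^ l := by ring
        _ ≤ 2 ^ (l + 1) * (2 * b * sys.energy (s + 2) v (t / 2)) * (1 + κ * (t / 2)) ^ l := by
            gcongr
        _ = 2 ^ (l + 2) * b * (sys.energy (s + 2) v (t / 2) * (1 + κ * (t / 2)) ^ l) := by ring
        _ ≤ 2 ^ (l + 2) * b * (decayConst b l * M) := by gcongr
        _ ≤ decayConst b (l + 1) * M := by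
            simp only [decayConst]
            have : 0 ≤ 2 ^ (l + 1) * M := by positivity
            linarith

/-- Trace estimate: the gradient at time `t` is controlled by the energy. -/
theorem IsBoundarySol.norm_flux_sq_le (hv : sys.IsBoundarySol R v) {s : ℕ} (hs : s + 1 ≤ p)
    {t : ℝ} (ht0 : 0 ≤ t) (ht : t ≤ R) :
    c * ‖sys.V s (sys.flux v t)‖ ^ 2 ≤ sys.energy s v (max (t - 1) 0) +
      2 * (4 * D + 5 * D * B / c) * sys.energy (s + 1) v (max (t - 1) 0) := by
  have hc := sys.c_pos
  have hB := sys.B_nonneg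
  have hD := sys.D_nonneg
  -- The unit interval `[a, a + 1]` contains `t` and lies in `[0, R]`, because `1 ≤ R`.
  set a := max (t - 1) 0 with ha
  have ha0 : 0 ≤ a := le_max_right _ _
  have hat : a ≤ t := max_le (by linarith) ht0
  have hta : t ≤ a + 1 := by linarith [le_max_left (t - 1) 0]
  have haR : a + 1 ≤ R := by
    have : a ≤ R - 1 := max_le (by linarith) (by linarith [hv.one_le])
    linarith
  set C := 4 * D + 5 * D * B / c with hC
  have hC0 : 0 ≤ C := by positivity
  set f : ℝ → ℝ := fun t => ‖sys.V s (sys.flux v t)‖ ^ 2 with hf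
  have hfd : ∀ t, HasDerivAt f
      (2 * ⟪sys.V s (sys.flux v t), sys.V s (sys.flux (deriv v) t)⟫) t := fun t =>
    ((sys.V s).hasFDerivAt.comp_hasDerivAt t (hasDerivAt_flux (sys := sys) hv.smooth t)).norm_sq
  have hfb : ∀ t, c * |2 * ⟪sys.V s (sys.flux v t), sys.V s (sys.flux (deriv v) t)⟫| ≤
      2 * C * (c * ‖sys.V (s + 1) (sys.flux v t)‖ ^ 2) := by
    intro t
    have h1 := abs_real_inner_le_norm (sys.V s (sys.flux v t)) (sys.V s (sys.flux (deriv v) t))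
    have h2 := hv.toIsSol.norm_flux_deriv_le hs t
    have h3 := sys.norm_V_mono s (sys.flux v t)
    rw [abs_mul, abs_two]
    calc _ ≤ c * (2 * (‖sys.V (s + 1) (sys.flux v t)‖ * (C * ‖sys.V (s + 1) (sys.flux v t)‖))) := by
          gcongr
          exact h1.trans (mul_le_mul h3 h2 (norm_nonneg _) (norm_nonneg _))
      _ = _ := by ring
  -- At some `τ` in the interval the dissipation equals its average, which is at most `energy s v
  -- a`. On the way from `τ` to `t` the variation of `‖V s F‖²` is dominated by the dissipation of
  -- order `s + 1`.
  obtain ⟨τ, hτ, hτe⟩ := exists_hasDerivAt_eq_slope (sys.energy s v)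
    (fun t => -⟪sys.V s (sys.A (sys.flux v t)), sys.V s (sys.flux v t)⟫) (by linarith : a < a + 1)
    (fun t _ => (hv.hasDerivAt_energy s t).continuousAt.continuousWithinAt)
    fun t _ => hv.hasDerivAt_energy s t
  have h1 : c * f τ ≤ sys.energy s v a := by
    have e1 := hv.deriv_energy_le (s := s) (by omega) τ
    have e2 := hv.energy_nonneg (s := s) (by omega) haR
    rw [hτe] at e1
    simp only [add_sub_cancel_left, div_one] at e1
    linarith
  have hE1 : ∀ r, a ≤ r → sys.energy (s + 1) v r ≤ sys.energy (s + 1) v a := fun r hr =>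
    hv.energy_antitone hs hr
  have hE0 : ∀ r, r ≤ a + 1 → 0 ≤ sys.energy (s + 1) v r := fun r hr =>
    hv.energy_nonneg hs (hr.trans haR)
  rcases le_total t τ with h | h
  · have hmono := antitone_of_hasDerivAt_nonpos (a := t) (b := τ)
      (f := fun r => -(c * f r) + 2 * C * sys.energy (s + 1) v r)
      (fun r => (((hfd r).const_mul c).neg).add ((hv.hasDerivAt_energy (s + 1) r).const_mul (2 * C)))
      (fun r _ _ => by
        have e1 := hfb r
        have e2 := mul_le_mul_of_nonneg_left (hv.deriv_energy_le hs r)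
          (show 0 ≤ 2 * C by positivity)
        have e3 := mul_le_mul_of_nonneg_left
          (neg_abs_le (2 * ⟪sys.V s (sys.flux v r), sys.V s (sys.flux (deriv v) r)⟫)) hc.le
        linarith)
    have h2 := hmono (Set.left_mem_Icc.2 h) (Set.right_mem_Icc.2 h) h
    simp only at h2
    have e1 := mul_le_mul_of_nonneg_left (hE1 t hat) (show 0 ≤ 2 * C by positivity)
    have e2 := mul_nonneg (show 0 ≤ 2 * C by positivity) (hE0 τ hτ.2.le)
    change c * f t ≤ _
    linarith
  · have hmono := antitone_of_hasDerivAt_nonpos (a := τ) (b := t)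
      (f := fun r => c * f r + 2 * C * sys.energy (s + 1) v r)
      (fun r => ((hfd r).const_mul c).add ((hv.hasDerivAt_energy (s + 1) r).const_mul (2 * C)))
      (fun r _ _ => by
        have e1 := hfb r
        have e2 := mul_le_mul_of_nonneg_left (hv.deriv_energy_le hs r)
          (show 0 ≤ 2 * C by positivity)
        have e3 := mul_le_mul_of_nonneg_left
          (le_abs_self (2 * ⟪sys.V s (sys.flux v r), sys.V s (sys.flux (deriv v) r)⟫)) hc.le
        linarith)
    have h2 := hmono (Set.left_mem_Icc.2 h) (Set.right_mem_Icc.2 h) h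
    simp only at h2
    have e1 := mul_le_mul_of_nonneg_left (hE1 τ hτ.1.le) (show 0 ≤ 2 * C by positivity)
    have e2 := mul_nonneg (show 0 ≤ 2 * C by positivity) (hE0 t hta)
    change c * f t ≤ _
    linarith

/-- The constant in the decay of the gradient. -/
def fluxConst (c B D H : ℝ) (l : ℕ) : ℝ :=
  (1 + 2 * (4 * D + 5 * D * B / c)) / c * (decayConst (B * D / c) l * (4 * H ^ 2 / c)) * 2 ^ l

theorem IsBoundarySol.norm_flux_sq_decay (hv : sys.IsBoundarySol R v) {s l : ℕ}
    (hs : s + 1 + 2 * l ≤ p) {t : ℝ} (ht0 : 0 ≤ t) (ht : t ≤ R) :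
    ‖sys.V s (sys.flux v t)‖ ^ 2 * (1 + κ * t) ^ l ≤ fluxConst c B D H l := by
  have hc := sys.c_pos
  have hκ := sys.κ_pos
  have hκ1 := sys.κ_le_one
  have hB := sys.B_nonneg
  have hD := sys.D_nonneg
  have h1 := hv.norm_flux_sq_le (s := s) (by omega) ht0 ht
  set a := max (t - 1) 0 with ha
  have ha0 : 0 ≤ a := le_max_right _ _
  have hat : a ≤ t := max_le (by linarith) ht0
  have hta : t ≤ a + 1 := by linarith [le_max_left (t - 1) 0]
  have h2 := hv.energy_decay l (s := s) (by omega) ha0 (hat.trans ht)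
  have h3 := hv.energy_decay l (s := s + 1) (by omega) ha0 (hat.trans ht)
  set C := 4 * D + 5 * D * B / c with hC
  have hC0 : 0 ≤ C := by positivity
  set M := decayConst (B * D / c) l * (4 * H ^ 2 / c) with hM
  -- Since `κ ≤ 1` and `t ≤ a + 1`, passing from time `a` to time `t` costs at most a factor `2` per
  -- power.
  have h4 : (1 + κ * t) ^ l ≤ 2 ^ l * (1 + κ * a) ^ l := by
    rw [← mul_pow]
    gcongr
    nlinarith [mul_le_mul_of_nonneg_left hta hκ.le, mul_nonneg hκ.le ha0]
  have h5 : c * ‖sys.V s (sys.flux v t)‖ ^ 2 * (1 + κ * a) ^ l ≤ (1 + 2 * C) * M := by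
    calc _ ≤ (sys.energy s v a + 2 * C * sys.energy (s + 1) v a) * (1 + κ * a) ^ l := by gcongr
      _ = sys.energy s v a * (1 + κ * a) ^ l +
          2 * C * (sys.energy (s + 1) v a * (1 + κ * a) ^ l) := by ring
      _ ≤ M + 2 * C * M := by gcongr
      _ = _ := by ring
  calc _ ≤ ‖sys.V s (sys.flux v t)‖ ^ 2 * (2 ^ l * (1 + κ * a) ^ l) := by gcongr
    _ = (c * ‖sys.V s (sys.flux v t)‖ ^ 2 * (1 + κ * a) ^ l) / c * 2 ^ l := by
        field_simp
    _ ≤ ((1 + 2 * C) * M) / c * 2 ^ l := by gcongr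
    _ = _ := by rw [fluxConst]; ring

/-- Decay of the gradient and of its normal derivatives, of any order. -/
theorem IsBoundarySol.norm_flux_decay (hv : sys.IsBoundarySol R v) {s k l : ℕ}
    (hs : s + k + 1 + 4 * l ≤ p) {t : ℝ} (ht0 : 0 ≤ t) (ht : t ≤ R) :
    ‖sys.V s (sys.flux (deriv^[k] v) t)‖ ≤
      (4 * D + 5 * D * B / c) ^ k * √(fluxConst c B D H (2 * l)) / (1 + κ * t) ^ l := by
  have hc := sys.c_pos
  have hκ := sys.κ_pos
  have hB := sys.B_nonneg
  have hD := sys.D_nonneg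
  have h1 := hv.toIsSol.norm_flux_iterate_le k (s := s) (by omega) t
  have h2 := hv.norm_flux_sq_decay (s := s + k) (l := 2 * l) (by omega) ht0 ht
  have hpos : 0 < (1 + κ * t) ^ l := by positivity
  have h3 : ‖sys.V (s + k) (sys.flux v t)‖ * (1 + κ * t) ^ l ≤ √(fluxConst c B D H (2 * l)) := by
    refine Real.le_sqrt_of_sq_le ?_
    rw [mul_pow, ← pow_mul, mul_comm l 2]
    exact h2
  rw [le_div_iff₀ hpos]
  calc _ ≤ (4 * D + 5 * D * B / c) ^ k * ‖sys.V (s + k) (sys.flux v t)‖ * (1 + κ * t) ^ l := by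
        gcongr
    _ = (4 * D + 5 * D * B / c) ^ k * (‖sys.V (s + k) (sys.flux v t)‖ * (1 + κ * t) ^ l) := by ring
    _ ≤ _ := by gcongr

/-- Decay of the mean value. -/
theorem IsBoundarySol.norm_mean_decay (hv : sys.IsBoundarySol R v) {l : ℕ} (hl : 1 ≤ l)
    (hs : 1 + 4 * (l + 1) ≤ p) {t : ℝ} (ht0 : 0 ≤ t) (ht : t ≤ R) :
    ‖sys.E (v t)‖ ≤ √(fluxConst c B D H (2 * (l + 1))) / (κ * (1 + κ * t) ^ l) := by
  have hκ := sys.κ_pos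
  set K := √(fluxConst c B D H (2 * (l + 1))) with hK
  have hK0 : 0 ≤ K := Real.sqrt_nonneg _
  have hd : ∀ τ, 0 ≤ τ → τ ≤ R → ‖sys.E (deriv v τ)‖ ≤ K / (1 + κ * τ) ^ (l + 1) := by
    intro τ h0 h1
    have e1 := hv.norm_flux_decay (s := 0) (k := 0) (l := l + 1) (by omega) h0 h1
    rw [pow_zero, one_mul, sys.V_zero, Function.iterate_zero, id] at e1
    -- The mean of the normal component of the flux is minus the mean of `v'`, because tangential
    -- and normal derivatives in `y` have mean zero.
    have e2 : sys.E (deriv v τ) = -sys.E (sys.Nt (sys.flux v τ)) := by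
      rw [flux, map_sub, map_sub, sys.E_Nt_G, sys.Nt_N, zero_sub, neg_neg]
    rw [e2, norm_neg]
    exact (sys.norm_E _).trans ((sys.norm_Nt_le _).trans e1)
  have hw : ∀ σ, HasDerivAt (fun σ => sys.E (v (R - σ))) (-sys.E (deriv v (R - σ))) σ := by
    intro σ
    have h1 : HasDerivAt v (deriv v (R - σ)) (R - σ) :=
      (hv.smooth.differentiable (by simp) _).hasDerivAt
    have h2 := h1.scomp σ ((hasDerivAt_id σ).const_sub R)
    have h3 := sys.E.hasFDerivAt.comp_hasDerivAt σ h2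
    refine h3.congr_deriv ?_
    simp
  -- Comparison function for the reversed time `σ = R - t`, which starts at the Dirichlet end.
  -- Integrating `(1 + κ τ)^{-(l+1)}` costs one power of decay and a factor `1/κ`. The factor `l ≥
  -- 1` in its derivative only helps.
  have hbd : ∀ σ, σ ≤ R → HasDerivAt (fun σ => K / (κ * (1 + κ * (R - σ)) ^ l))
      (K * l / (1 + κ * (R - σ)) ^ (l + 1)) σ := by
    intro σ hσ
    have hpos : 0 < 1 + κ * (R - σ) := by
      have := mul_nonneg hκ.le (sub_nonneg.2 hσ); linarith
    have h1 : HasDerivAt (fun σ => 1 + κ * (R - σ)) (-κ) σ := by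
      simpa using (((hasDerivAt_id σ).const_sub R).const_mul κ).const_add 1
    have h2 := ((h1.fun_pow l).const_mul κ).fun_inv (by positivity)
    have h3 := h2.const_mul K
    refine (h3.congr_deriv ?_)
    obtain ⟨j, rfl⟩ : ∃ j, l = j + 1 := ⟨l - 1, by omega⟩
    simp only [Nat.add_sub_cancel]
    field_simp
    ring
  have key := image_norm_le_of_norm_deriv_right_le_deriv_boundary'
    (f := fun σ => sys.E (v (R - σ))) (f' := fun σ => -sys.E (deriv v (R - σ))) (a := 0) (b := R)
    (B := fun σ => K / (κ * (1 + κ * (R - σ)) ^ l))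
    (B' := fun σ => K * l / (1 + κ * (R - σ)) ^ (l + 1))
    (fun σ _ => (hw σ).continuousAt.continuousWithinAt)
    (fun σ _ => (hw σ).hasDerivWithinAt) ?_ ?_ ?_ ?_ (x := R - t) ⟨by linarith, by linarith⟩
  · simpa using key
  · simp only [sub_zero, hv.dirichlet, map_zero, norm_zero]
    have := hv.one_le
    positivity
  · exact fun σ hσ => (hbd σ hσ.2).continuousAt.continuousWithinAt
  · exact fun σ hσ => (hbd σ hσ.2.le).hasDerivWithinAt
  · intro σ hσ
    rw [norm_neg]
    refine (hd (R - σ) (by linarith [hσ.2]) (by linarith [hσ.1])).trans ?_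
    have hpos : 0 < 1 + κ * (R - σ) := by
      have := mul_nonneg hκ.le (sub_nonneg.2 hσ.2.le); linarith
    gcongr
    have : (1 : ℝ) ≤ l := by exact_mod_cast hl
    nlinarith

end GalerkinSystem

end

/-! ### Solvability of the Galerkin system -/

section

open scoped RealInnerProductSpace

/-- Solutions of a linear autonomous equation are smooth. -/
theorem contDiff_of_hasDerivAt_clm {Z : Type*} [NormedAddCommGroup Z] [NormedSpace ℝ Z]
    (L : Z →L[ℝ] Z) {γ : ℝ → Z} (h : ∀ t, HasDerivAt γ (L (γ t)) t) : ContDiff ℝ ∞ γ := by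
  rw [contDiff_infty]
  intro n
  induction n with
  | zero =>
    exact contDiff_zero.2 (continuous_iff_continuousAt.2 fun t => (h t).continuousAt)
  | succ n ih =>
    refine (contDiff_succ_iff_deriv (n := n)).2 ⟨fun t => (h t).differentiableAt, by simp, ?_⟩
    rw [funext fun t => (h t).deriv]
    exact L.contDiff.comp ih

/-- The flow of a linear autonomous equation. -/
theorem exists_flow {Z : Type*} [NormedAddCommGroup Z] [NormedSpace ℝ Z] [CompleteSpace Z]
    (L : Z →L[ℝ] Z) : ∃ Φ : ℝ → Z →L[ℝ] Z, (∀ z, Φ 0 z = z) ∧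
      ∀ z t, HasDerivAt (fun t => Φ t z) (L (Φ t z)) t := by
  refine ⟨fun t => NormedSpace.exp (t • L), fun z => by simp [NormedSpace.exp_zero], fun z t => ?_⟩
  have h1 := hasDerivAt_exp_smul_const' (𝕂 := ℝ) L t
  exact ((ContinuousLinearMap.apply ℝ Z z).hasFDerivAt).comp_hasDerivAt t h1

namespace GalerkinSystem

variable {X Y : Type} [NormedAddCommGroup X] [InnerProductSpace ℝ X]
    [NormedAddCommGroup Y] [InnerProductSpace ℝ Y] {p : ℕ} {c B D H κ : ℝ}
    (sys : GalerkinSystem X Y p c B D H κ)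

/-- A solution with zero data vanishes. -/
theorem IsSol.eq_zero {sys : GalerkinSystem X Y p c B D H κ} {v : ℝ → X} (hv : sys.IsSol v) {R : ℝ}
    (hR : 0 < R) (h0 : sys.Nt (sys.A (sys.flux v 0)) = 0) (h1 : v R = 0) :
    v 0 = 0 ∧ _root_.deriv v 0 = 0 := by
  have hc := sys.c_pos
  have e0 : sys.energy 0 v 0 = 0 := by simp [energy, sys.inner_N, h0]
  have e1 : sys.energy 0 v R = 0 := by simp [energy, h1]
  have hanti := hv.energy_antitone (Nat.zero_le p)
  have hzero : ∀ t ∈ Set.Icc 0 R, sys.energy 0 v t = 0 := fun t ht =>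
    le_antisymm ((hanti ht.1).trans e0.le) (e1.symm.le.trans (hanti ht.2))
  have hF : ∀ t ∈ Set.Icc 0 R, sys.flux v t = 0 := by
    intro t ht
    have d1 := (hv.hasDerivAt_energy 0 t).hasDerivWithinAt (s := Set.Icc 0 R)
    have d2 : HasDerivWithinAt (sys.energy 0 v) 0 (Set.Icc 0 R) t :=
      (hasDerivWithinAt_const t _ 0).congr hzero (hzero t ht)
    have d3 := (uniqueDiffOn_Icc hR t ht).eq_deriv _ d1 d2
    have d4 := hv.deriv_energy_le (Nat.zero_le p) t
    rw [d3, sys.V_zero] at d4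
    have d5 : ‖sys.flux v t‖ ^ 2 = 0 := by
      have : 0 ≤ ‖sys.flux v t‖ ^ 2 := by positivity
      nlinarith
    simpa using d5
  have hv' : ∀ t ∈ Set.Icc 0 R, _root_.deriv v t = sys.Nt (sys.G (v t)) := by
    intro t ht
    have := congrArg sys.Nt (hF t ht)
    rw [flux, map_sub, sys.Nt_N, map_zero, sub_eq_zero] at this
    exact this.symm
  -- A vanishing flux does not yet mean `v = 0`, as the problem is degenerate. What remains is `v' =
  -- Nt (G v)` with a skew operator, so `‖v‖` is constant, and it vanishes at `R`.
  have hmono := antitone_of_hasDerivAt_nonpos (a := 0) (b := R) (f := fun t => -‖v t‖ ^ 2)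
    (fun t => ((hv.smooth.differentiable (by simp) t).hasDerivAt.norm_sq).neg) (fun t h0 h1 => by
      rw [hv' t ⟨h0, h1⟩, real_inner_comm, sys.skew]; simp)
  have h2 := hmono (Set.left_mem_Icc.2 hR.le) (Set.right_mem_Icc.2 hR.le) hR.le
  simp only [h1, norm_zero] at h2
  have h3 : v 0 = 0 := by
    have : ‖v 0‖ ^ 2 = 0 := by have := sq_nonneg ‖v 0‖; linarith
    simpa using this
  exact ⟨h3, by rw [hv' 0 (Set.left_mem_Icc.2 hR.le), h3]; simp⟩

/-- Isolates the second derivative `z`, to be found by inverting `Nt A N`. -/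
theorem weak_iff (v q z : X) :
    (∀ w, ⟪sys.A (sys.G q - sys.N z), sys.N w⟫ = -⟪sys.A (sys.G v - sys.N q), sys.G w⟫) ↔
      sys.Nt (sys.A (sys.N z)) =
        sys.Nt (sys.A (sys.G q)) - sys.Dv (sys.A (sys.G v - sys.N q)) := by
  have h : (∀ w, ⟪sys.A (sys.G q - sys.N z), sys.N w⟫ = -⟪sys.A (sys.G v - sys.N q), sys.G w⟫) ↔
      sys.Nt (sys.A (sys.G q - sys.N z)) = sys.Dv (sys.A (sys.G v - sys.N q)) := by
    simp only [sys.inner_N, sys.inner_G, neg_neg]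
    exact ⟨fun h => ext_inner_right ℝ h, fun h w => by rw [h]⟩
  rw [h, map_sub sys.A, map_sub sys.Nt]
  constructor
  · intro h; rw [← h]; abel
  · intro h; rw [h]; abel

/-- Coercivity on the range of `N` makes `Nt A N` injective, hence invertible in finite dimension.
The weak equation therefore is a linear first-order autonomous system for the pair `(v, v')`. -/
theorem exists_generator [FiniteDimensional ℝ X] : ∃ L : X × X →L[ℝ] X × X,
    (∀ z, (L z).1 = z.2) ∧ ∀ z w, ⟪sys.A (sys.G z.2 - sys.N (L z).2), sys.N w⟫ =
      -⟪sys.A (sys.G z.1 - sys.N z.2), sys.G w⟫ := by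
  let a : X →ₗ[ℝ] X := (sys.Nt.comp (sys.A.comp sys.N)).toLinearMap
  have ha : ∀ z, a z = sys.Nt (sys.A (sys.N z)) := fun z => rfl
  have hinj : Function.Injective a := by
    rw [← LinearMap.ker_eq_bot, LinearMap.ker_eq_bot']
    intro z hz
    have h1 := sys.coercive 0 (Nat.zero_le p) (sys.N z)
    rw [sys.V_zero, sys.V_zero, sys.inner_N, ← ha, hz, inner_zero_left, sys.norm_N] at h1
    have hc := sys.c_pos
    have : ‖z‖ ^ 2 = 0 := by
      have : 0 ≤ ‖z‖ ^ 2 := by positivity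
      nlinarith
    simpa using this
  let e := LinearEquiv.ofInjectiveEndo a hinj
  let r : X × X →ₗ[ℝ] X := ((sys.Nt.comp (sys.A.comp sys.G)).toLinearMap.comp (LinearMap.snd ℝ X X)) -
    (sys.Dv.comp sys.A).toLinearMap.comp (sys.G.toLinearMap.comp (LinearMap.fst ℝ X X) -
      sys.N.toLinearMap.comp (LinearMap.snd ℝ X X))
  have hr : ∀ z, r z = sys.Nt (sys.A (sys.G z.2)) - sys.Dv (sys.A (sys.G z.1 - sys.N z.2)) :=
    fun z => rfl
  let L : X × X →ₗ[ℝ] X × X := (LinearMap.snd ℝ X X).prod (e.symm.toLinearMap.comp r)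
  refine ⟨LinearMap.toContinuousLinearMap L, fun z => rfl, fun z => ?_⟩
  rw [sys.weak_iff, ← ha, ← hr]
  exact LinearEquiv.apply_symm_apply e (r z)

/-- The map from the initial values `(v 0, v' 0)` to the pair (Neumann datum at `0`, value at `R`)
is a linear endomorphism of the finite-dimensional space `X × X`. By `IsSol.eq_zero` it is
injective, hence surjective. -/
theorem exists_isBoundarySol [FiniteDimensional ℝ X] {R : ℝ} (hR : 1 ≤ R) :
    ∃ v, sys.IsBoundarySol R v := by
  obtain ⟨L, hL1, hL2⟩ := sys.exists_generator
  have hcomp : CompleteSpace X := FiniteDimensional.complete ℝ X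
  obtain ⟨Ψ, hΨ0, hΨd⟩ := exists_flow L
  set γ : X × X → ℝ → X × X := fun z t => Ψ t z with hγ
  have hγd : ∀ z t, HasDerivAt (γ z) (L (γ z t)) t := hΨd
  have hγ0 : ∀ z, γ z 0 = z := hΨ0
  have hsm : ∀ z, ContDiff ℝ ∞ (γ z) := fun z => contDiff_of_hasDerivAt_clm L (hγd z)
  have hd1 : ∀ z, deriv (fun t => (γ z t).1) = fun t => (γ z t).2 := by
    intro z; funext t
    have := (ContinuousLinearMap.fst ℝ X X).hasFDerivAt.comp_hasDerivAt t (hγd z t)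
    refine HasDerivAt.deriv (this.congr_deriv ?_)
    exact hL1 _
  have hd2 : ∀ z, deriv (fun t => (γ z t).2) = fun t => (L (γ z t)).2 := by
    intro z; funext t
    exact ((ContinuousLinearMap.snd ℝ X X).hasFDerivAt.comp_hasDerivAt t (hγd z t)).deriv
  have hsol : ∀ z, sys.IsSol fun t => (γ z t).1 := by
    intro z
    refine ⟨contDiff_fst.comp (hsm z), fun t w => ?_⟩
    simp only [flux, hd1, hd2]
    exact hL2 (γ z t) w
  have hflux : ∀ z, sys.flux (fun t => (γ z t).1) 0 = sys.G z.1 - sys.N z.2 := by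
    intro z; simp only [flux, hd1, hγ0]
  let Φ : X × X →ₗ[ℝ] X × X :=
    ((sys.Nt.comp sys.A).toLinearMap.comp (sys.G.toLinearMap.comp (LinearMap.fst ℝ X X) -
      sys.N.toLinearMap.comp (LinearMap.snd ℝ X X))).prod
    ((LinearMap.fst ℝ X X).comp (Ψ R).toLinearMap)
  have hΦ : ∀ z, Φ z = (sys.Nt (sys.A (sys.G z.1 - sys.N z.2)), (γ z R).1) := fun z => rfl
  have hinj : Function.Injective Φ := by
    rw [← LinearMap.ker_eq_bot, LinearMap.ker_eq_bot']
    intro z hz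
    rw [hΦ, Prod.mk_eq_zero] at hz
    obtain ⟨h1, h2⟩ := (hsol z).eq_zero (by linarith) (by rw [hflux]; exact hz.1) hz.2
    rw [hd1] at h2
    simp only [hγ0] at h1 h2
    exact Prod.ext h1 h2
  obtain ⟨z, hz⟩ := LinearMap.injective_iff_surjective.1 hinj (sys.h, 0)
  rw [hΦ, Prod.mk.injEq] at hz
  refine ⟨fun t => (γ z t).1, hsol z, hR, fun w => ?_, hz.2⟩
  rw [hflux, sys.inner_N, hz.1]

end GalerkinSystem

end

/-! ### Operators on finite spaces of Fourier coefficients -/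

section

open scoped RealInnerProductSpace

section Operators

variable {J : Type} [Fintype J]

/-- Multiplication by the function `c`. -/
def diagOp (c : J → ℂ) : EuclideanSpace ℂ J →L[ℝ] EuclideanSpace ℂ J :=
  LinearMap.toContinuousLinearMap
    { toFun := fun v => WithLp.toLp 2 fun x => c x * v x
      map_add' := fun v w => by ext x; simp [mul_add]
      map_smul' := fun r v => by ext x; simp; ring }

@[simp] theorem diagOp_apply (c : J → ℂ) (v : EuclideanSpace ℂ J) (x : J) :
    diagOp c v x = c x * v x := rfl

/-- The operator with kernel `K`. -/
def kernelOp (K : J → J → ℂ) : EuclideanSpace ℂ J →L[ℝ] EuclideanSpace ℂ J :=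
  LinearMap.toContinuousLinearMap
    { toFun := fun v => WithLp.toLp 2 fun x => ∑ z, K x z * v z
      map_add' := fun v w => by ext x; simp [mul_add, Finset.sum_add_distrib]
      map_smul' := fun r v => by
        ext x; simp [Finset.mul_sum]; exact Finset.sum_congr rfl fun z _ => by ring }

theorem kernelOp_apply (K : J → J → ℂ) (v : EuclideanSpace ℂ J) (x : J) :
    kernelOp K v x = ∑ z, K x z * v z := rfl

theorem real_inner_eq_sum (v w : EuclideanSpace ℂ J) :
    ⟪v, w⟫ = ∑ x, (w x * (starRingEnd ℂ) (v x)).re := by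
  rw [PiLp.inner_apply]
  exact Finset.sum_congr rfl fun x _ => Complex.inner _ _

/-- Schur's test. -/
theorem norm_kernelOp_le {K : J → J → ℂ} {C : ℝ} (hC : 0 ≤ C) (hrow : ∀ x, ∑ z, ‖K x z‖ ≤ C)
    (hcol : ∀ z, ∑ x, ‖K x z‖ ≤ C) (v : EuclideanSpace ℂ J) : ‖kernelOp K v‖ ≤ C * ‖v‖ := by
  refine (sq_le_sq₀ (norm_nonneg _) (by positivity)).1 ?_
  rw [mul_pow, EuclideanSpace.norm_sq_eq, EuclideanSpace.norm_sq_eq]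
  have h1 : ∀ x, ‖kernelOp K v x‖ ^ 2 ≤ C * ∑ z, ‖K x z‖ * ‖v z‖ ^ 2 := by
    intro x
    rw [kernelOp_apply]
    calc ‖∑ z, K x z * v z‖ ^ 2 ≤ (∑ z, √‖K x z‖ * (√‖K x z‖ * ‖v z‖)) ^ 2 := by
          gcongr
          refine (norm_sum_le _ _).trans (le_of_eq (Finset.sum_congr rfl fun z _ => ?_))
          rw [norm_mul, ← mul_assoc, Real.mul_self_sqrt (norm_nonneg _)]
      _ ≤ (∑ z, √‖K x z‖ ^ 2) * ∑ z, (√‖K x z‖ * ‖v z‖) ^ 2 := Finset.sum_mul_sq_le_sq_mul_sq _ _ _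
      _ = (∑ z, ‖K x z‖) * ∑ z, ‖K x z‖ * ‖v z‖ ^ 2 := by
          simp only [mul_pow, Real.sq_sqrt (norm_nonneg _)]
      _ ≤ C * ∑ z, ‖K x z‖ * ‖v z‖ ^ 2 := by
          gcongr
          exact hrow x
  calc ∑ x, ‖kernelOp K v x‖ ^ 2 ≤ ∑ x, C * ∑ z, ‖K x z‖ * ‖v z‖ ^ 2 :=
        Finset.sum_le_sum fun x _ => h1 x
    _ = C * ∑ z, (∑ x, ‖K x z‖) * ‖v z‖ ^ 2 := by
        rw [← Finset.mul_sum, Finset.sum_comm]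
        simp only [Finset.sum_mul]
    _ ≤ C * ∑ z, C * ‖v z‖ ^ 2 := by
        gcongr with z
        exact hcol z
    _ = C ^ 2 * ∑ z, ‖v z‖ ^ 2 := by rw [← Finset.mul_sum]; ring

theorem norm_le_of_forall_norm_le {J' : Type} [Fintype J'] {v : EuclideanSpace ℂ J}
    {w : EuclideanSpace ℂ J'} {C : ℝ} (hC : 0 ≤ C)
    (h : ∑ x, ‖v x‖ ^ 2 ≤ C ^ 2 * ∑ x, ‖w x‖ ^ 2) : ‖v‖ ≤ C * ‖w‖ := by
  refine (sq_le_sq₀ (norm_nonneg _) (by positivity)).1 ?_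
  rw [mul_pow, EuclideanSpace.norm_sq_eq, EuclideanSpace.norm_sq_eq]
  exact h

end Operators

section ModeOperators

variable {I P : Type} [Fintype I] [Fintype P] {d : ℕ}

/-- `v ↦ (c_i v)_i`, with coefficients depending on the mode. -/
def spreadOp (P : Type) [Fintype P] (c : I → Fin d → ℂ) :
    EuclideanSpace ℂ (I × P) →L[ℝ] EuclideanSpace ℂ (I × Fin d × P) :=
  LinearMap.toContinuousLinearMap
    { toFun := fun v => WithLp.toLp 2 fun x => c x.1 x.2.1 * v (x.1, x.2.2)
      map_add' := fun v w => by ext x; simp [mul_add]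
      map_smul' := fun r v => by ext x; simp; ring }

theorem spreadOp_apply (c : I → Fin d → ℂ) (v : EuclideanSpace ℂ (I × P)) (x : I × Fin d × P) :
    spreadOp P c v x = c x.1 x.2.1 * v (x.1, x.2.2) := rfl

/-- `F ↦ ∑ i, c_i F_i`, with coefficients depending on the mode. -/
def contractOp (P : Type) [Fintype P] (c : I → Fin d → ℂ) :
    EuclideanSpace ℂ (I × Fin d × P) →L[ℝ] EuclideanSpace ℂ (I × P) :=
  LinearMap.toContinuousLinearMap
    { toFun := fun F => WithLp.toLp 2 fun x => ∑ i, c x.1 i * F (x.1, i, x.2)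
      map_add' := fun v w => by ext x; simp [mul_add, Finset.sum_add_distrib]
      map_smul' := fun r v => by
        ext x; simp [Finset.mul_sum]; exact Finset.sum_congr rfl fun z _ => by ring }

theorem contractOp_apply (c : I → Fin d → ℂ) (F : EuclideanSpace ℂ (I × Fin d × P)) (x : I × P) :
    contractOp P c F x = ∑ i, c x.1 i * F (x.1, i, x.2) := rfl

theorem sum_triple {M : Type*} [AddCommMonoid M] (f : I × Fin d × P → M) :
    ∑ x, f x = ∑ x : I × P, ∑ i, f (x.1, i, x.2) := by
  simp only [Fintype.sum_prod_type]
  exact Finset.sum_congr rfl fun a _ => Finset.sum_comm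

theorem inner_spreadOp (c : I → Fin d → ℂ) (F : EuclideanSpace ℂ (I × Fin d × P))
    (v : EuclideanSpace ℂ (I × P)) :
    ⟪F, spreadOp P c v⟫ = ⟪contractOp P (fun a i => (starRingEnd ℂ) (c a i)) F, v⟫ := by
  rw [real_inner_eq_sum, real_inner_eq_sum, sum_triple]
  refine Finset.sum_congr rfl fun x _ => ?_
  rw [contractOp_apply, map_sum, Finset.mul_sum, Complex.re_sum]
  refine Finset.sum_congr rfl fun i _ => ?_
  rw [spreadOp_apply]
  simp only [map_mul, Complex.conj_conj]
  congr 1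
  ring

theorem norm_spreadOp_le {c : I → Fin d → ℂ} {r : I → ℂ} {C : ℝ} (hC : 0 ≤ C)
    (h : ∀ a i, ‖c a i‖ ≤ C * ‖r a‖) (v : EuclideanSpace ℂ (I × P)) :
    ‖spreadOp P c v‖ ≤ C * √d * ‖diagOp (fun x : I × P => r x.1) v‖ := by
  refine norm_le_of_forall_norm_le (by positivity) ?_
  rw [sum_triple, Finset.mul_sum]
  refine Finset.sum_le_sum fun x _ => ?_
  simp only [spreadOp_apply, diagOp_apply, norm_mul]
  calc ∑ i, (‖c x.1 i‖ * ‖v (x.1, x.2)‖) ^ 2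
      ≤ ∑ _i : Fin d, (C * ‖r x.1‖ * ‖v (x.1, x.2)‖) ^ 2 := by
        gcongr with i; exact h _ _
    _ = (C * √d) ^ 2 * (‖r x.1‖ * ‖v x‖) ^ 2 := by
        rw [Finset.sum_const, Finset.card_univ, Fintype.card_fin, nsmul_eq_mul, mul_pow C (√d),
          Real.sq_sqrt (Nat.cast_nonneg d)]
        ring

theorem norm_contractOp_le {c : I → Fin d → ℂ} {r : I → ℂ} {C : ℝ} (hC : 0 ≤ C)
    (h : ∀ a i, ‖c a i‖ ≤ C * ‖r a‖) (F : EuclideanSpace ℂ (I × Fin d × P)) :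
    ‖contractOp P c F‖ ≤ C * √d * ‖diagOp (fun x : I × Fin d × P => r x.1) F‖ := by
  refine norm_le_of_forall_norm_le (by positivity) ?_
  rw [sum_triple, Finset.mul_sum]
  refine Finset.sum_le_sum fun x _ => ?_
  simp only [contractOp_apply, diagOp_apply, norm_mul]
  calc ‖∑ i, c x.1 i * F (x.1, i, x.2)‖ ^ 2
      ≤ (∑ i, C * ‖r x.1‖ * ‖F (x.1, i, x.2)‖) ^ 2 := by
        gcongr
        refine (norm_sum_le _ _).trans (Finset.sum_le_sum fun i _ => ?_)
        rw [norm_mul]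
        gcongr
        exact h _ _
    _ = C ^ 2 * (∑ i : Fin d, 1 * (‖r x.1‖ * ‖F (x.1, i, x.2)‖)) ^ 2 := by
        rw [← mul_pow, Finset.mul_sum]
        congr 1
        exact Finset.sum_congr rfl fun i _ => by ring
    _ ≤ C ^ 2 * ((∑ _i : Fin d, 1 ^ 2) * ∑ i, (‖r x.1‖ * ‖F (x.1, i, x.2)‖) ^ 2) := by
        gcongr
        exact Finset.sum_mul_sq_le_sq_mul_sq _ _ _
    _ = (C * √d) ^ 2 * ∑ i, (‖r x.1‖ * ‖F (x.1, i, x.2)‖) ^ 2 := by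
        rw [mul_pow C (√d), Real.sq_sqrt (Nat.cast_nonneg d)]
        simp
        ring

end ModeOperators

end

/-! ### Sobolev weights, and estimates of single modes -/

section

open scoped RealInnerProductSpace

variable {d m : ℕ}

/-- The Sobolev weight `(1 + ε|ζ|)^s`. -/
def weight (ε : ℝ) (s : ℕ) (ζ : Fin d → ℤ) : ℝ := (1 + ε * ‖ζ‖) ^ s

theorem one_le_weight {ε : ℝ} (hε : 0 ≤ ε) (s : ℕ) (ζ : Fin d → ℤ) : 1 ≤ weight ε s ζ :=
  one_le_pow₀ (by have := mul_nonneg hε (norm_nonneg ζ); linarith)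

theorem weight_pos {ε : ℝ} (hε : 0 ≤ ε) (s : ℕ) (ζ : Fin d → ℤ) : 0 < weight ε s ζ :=
  zero_lt_one.trans_le (one_le_weight hε s ζ)

theorem weight_le_weight_mul {ε : ℝ} (hε : 0 ≤ ε) (s : ℕ) (ζ η : Fin d → ℤ) :
    weight ε s ζ ≤ weight ε s (ζ - η) * weight ε s η := by
  rw [weight, weight, weight, ← mul_pow]
  have h1 : ‖ζ‖ ≤ ‖ζ - η‖ + ‖η‖ := by simpa using norm_add_le (ζ - η) η
  have h2 := mul_nonneg (mul_nonneg hε (norm_nonneg (ζ - η))) (mul_nonneg hε (norm_nonneg η))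
  have h3 := mul_le_mul_of_nonneg_left h1 hε
  gcongr
  nlinarith

/-- Convexity in `ε` between `0` and `1`. The factor `ε` gained here is what makes the commutator of
`A` with the weights small. -/
theorem weight_sub_one_le {ε : ℝ} (hε : 0 ≤ ε) (hε1 : ε ≤ 1) (s : ℕ) (ζ : Fin d → ℤ) :
    weight ε s ζ - 1 ≤ ε * ((1 + ‖ζ‖) ^ s - 1) := by
  have hn := norm_nonneg ζ
  induction s with
  | zero => simp [weight]
  | succ s ih =>
    have h1 : (1 + ε * ‖ζ‖) ^ s ≤ (1 + ‖ζ‖) ^ s := by gcongr; nlinarith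
    have h2 := mul_le_mul_of_nonneg_left h1 (mul_nonneg hε hn)
    simp only [weight] at ih ⊢
    rw [pow_succ, pow_succ]
    nlinarith

theorem norm_mul_weight_le {ε : ℝ} (hε : 0 < ε) (s : ℕ) (ζ : Fin d → ℤ) :
    ‖ζ‖ * weight ε s ζ ≤ 1 / ε * weight ε (s + 1) ζ := by
  have h0 := weight_pos hε.le s ζ
  have h1 : weight ε (s + 1) ζ = weight ε s ζ * (1 + ε * ‖ζ‖) := pow_succ _ _
  rw [h1, div_mul_eq_mul_div, le_div_iff₀ hε]
  nlinarith

theorem weight_le {ε : ℝ} (hε : 0 ≤ ε) (hε1 : ε ≤ 1) {s p : ℕ} (hs : s ≤ p) (ζ : Fin d → ℤ) :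
    weight ε s ζ ≤ (1 + ‖ζ‖) ^ p := by
  have hn := norm_nonneg ζ
  calc weight ε s ζ ≤ (1 + ‖ζ‖) ^ s := by
        unfold weight; gcongr; nlinarith
    _ ≤ _ := by gcongr; linarith

/-- The ratio of two weights is close to one if `ε` is small. -/
theorem abs_weight_div_sub_one_le {ε : ℝ} (hε : 0 ≤ ε) (hε1 : ε ≤ 1) {s p : ℕ} (hs : s ≤ p)
    (ζ η : Fin d → ℤ) :
    |weight ε s ζ / weight ε s η - 1| ≤ ε * (1 + ‖ζ - η‖) ^ p := by
  have hζ := weight_pos hε s ζ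
  have hη := weight_pos hε s η
  have h1 := weight_le_weight_mul hε s ζ η
  have h2 := weight_le_weight_mul hε s η ζ
  have h3 : weight ε s (η - ζ) = weight ε s (ζ - η) := by
    rw [weight, weight, norm_sub_rev]
  rw [h3] at h2
  have h4 := weight_sub_one_le hε hε1 s (ζ - η)
  have h6 : (1 + ‖ζ - η‖) ^ s ≤ (1 + ‖ζ - η‖) ^ p := by
    gcongr; linarith [norm_nonneg (ζ - η)]
  have h7 := one_le_weight hε s (ζ - η)
  have h5 : weight ε s (ζ - η) - 1 ≤ ε * (1 + ‖ζ - η‖) ^ p := by nlinarith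
  set w := weight ε s (ζ - η) with hw
  rw [abs_le]
  constructor
  · have : 1 - (w - 1) ≤ weight ε s ζ / weight ε s η := by
      rw [le_div_iff₀ hη]
      have : weight ε s η ≤ w * weight ε s ζ := h2
      nlinarith [mul_nonneg (sub_nonneg.2 h7) (sub_nonneg.2 h7)]
    linarith
  · have : weight ε s ζ / weight ε s η ≤ w := by
      rw [div_le_iff₀ hη]; exact h1
    linarith

/-- Row and column sums of a convolution kernel. -/
theorem sum_convolution_le {S : Finset (Fin d → ℤ)} {P : Type} [Fintype P]
    {b : (Fin d → ℤ) → ℝ} (hb : ∀ ζ, 0 ≤ b ζ) (hs : Summable b) (ζ : Fin d → ℤ) :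
    ∑ z : S × P, b (ζ - z.1.1) ≤ Fintype.card P * ∑' ζ, b ζ ∧
      ∑ z : S × P, b (z.1.1 - ζ) ≤ Fintype.card P * ∑' ζ, b ζ := by
  have aux : ∀ e : (Fin d → ℤ) → Fin d → ℤ, Function.Injective e →
      ∑ z : S × P, b (e z.1.1) ≤ Fintype.card P * ∑' ζ, b ζ := by
    intro e he
    rw [Fintype.sum_prod_type]
    simp only [Finset.sum_const, Finset.card_univ, nsmul_eq_mul]
    rw [← Finset.mul_sum]
    gcongr
    rw [Finset.sum_coe_sort S fun a => b (e a)]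
    calc ∑ a ∈ S, b (e a) = ∑ ζ ∈ S.map ⟨e, he⟩, b ζ := by rw [Finset.sum_map]; rfl
      _ ≤ ∑' ζ, b ζ := hs.sum_le_tsum _ fun ζ _ => hb ζ
  exact ⟨aux _ (sub_right_injective), aux _ (sub_left_injective)⟩

section Pointwise

variable (n T : EuclideanSpace ℝ (Fin d)) (a : Fin d → ℤ) (v q : ℂ)

/-- `2πi a_j v - n_j q`: the `j`-th component of the lifted gradient at the mode `a`. -/
def modeFlux (j : Fin d) : ℂ := 2 * Real.pi * Complex.I * (a j : ℂ) * v - (n j : ℂ) * q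

variable {n T}

theorem norm_sum_mul_le (hT : ‖T‖ ≤ 1) (f : Fin d → ℂ) :
    ‖∑ i, (T i : ℂ) * f i‖ ≤ √(∑ i, ‖f i‖ ^ 2) := by
  have h1 : ∑ i, |T i| ^ 2 ≤ 1 := by
    have := EuclideanSpace.real_norm_sq_eq T
    simp only [sq_abs]
    rw [← this]
    nlinarith [norm_nonneg T]
  refine Real.le_sqrt_of_sq_le ?_
  calc ‖∑ i, (T i : ℂ) * f i‖ ^ 2 ≤ (∑ i, |T i| * ‖f i‖) ^ 2 := by
        gcongr
        refine (norm_sum_le _ _).trans (le_of_eq (Finset.sum_congr rfl fun i _ => ?_))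
        rw [norm_mul, Complex.norm_real, Real.norm_eq_abs]
    _ ≤ (∑ i, |T i| ^ 2) * ∑ i, ‖f i‖ ^ 2 := Finset.sum_mul_sq_le_sq_mul_sq _ _ _
    _ ≤ 1 * ∑ i, ‖f i‖ ^ 2 := by gcongr
    _ = _ := one_mul _

theorem sum_mul_modeFlux (c : EuclideanSpace ℝ (Fin d)) :
    ∑ j, (c j : ℂ) * modeFlux n a v q j =
      2 * Real.pi * Complex.I * (∑ j, (c j : ℂ) * (a j : ℂ)) * v -
        ((∑ j, c j * n j : ℝ) : ℂ) * q := by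
  push_cast
  rw [Finset.mul_sum, Finset.sum_mul, Finset.sum_mul, ← Finset.sum_sub_distrib]
  exact Finset.sum_congr rfl fun j _ => by rw [modeFlux]; ring

theorem sum_mul_eq_inner (x y : EuclideanSpace ℝ (Fin d)) : ∑ j, x j * y j = ⟪x, y⟫ := by
  rw [PiLp.inner_apply]
  exact Finset.sum_congr rfl fun j _ => by simp [mul_comm]

/-- Contracting the mode of `F` with `T` removes the term with `q`, since `T·n = 0`. -/
theorem norm_tangential_left_le (hT : ‖T‖ ≤ 1) (hTn : ⟪T, n⟫ = 0) :
    ‖2 * Real.pi * Complex.I * (∑ j, (T j : ℂ) * (a j : ℂ)) * v‖ ≤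
      √(∑ j, ‖modeFlux n a v q j‖ ^ 2) := by
  have h := norm_sum_mul_le hT (modeFlux n a v q)
  rwa [sum_mul_modeFlux, sum_mul_eq_inner, hTn, Complex.ofReal_zero, zero_mul, sub_zero] at h

theorem norm_sum_intCast_le (hT : ‖T‖ ≤ 1) : ‖∑ j, (T j : ℂ) * (a j : ℂ)‖ ≤ d * ‖a‖ := by
  calc _ ≤ ∑ j, ‖(T j : ℂ) * (a j : ℂ)‖ := norm_sum_le _ _
    _ ≤ ∑ _j : Fin d, 1 * ‖a‖ := by
        refine Finset.sum_le_sum fun j _ => ?_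
        rw [norm_mul, Complex.norm_real]
        refine mul_le_mul ((PiLp.norm_apply_le T j).trans hT) ?_ (norm_nonneg _) zero_le_one
        rw [Complex.norm_intCast, ← Int.norm_eq_abs]
        exact norm_le_pi_norm a j
    _ = d * ‖a‖ := by simp

/-- Eliminate `v` between the two contractions `T·F = 2πi (T·a) v` and `n·F = 2πi (n·a) v - q`. What
is left is `(T·a) q`, bounded by `F` at the cost of one factor `‖a‖`. The constant is `14 = 2 * 7`
with `7 > 2π`. -/
theorem norm_tangential_right_le (hn : ‖n‖ = 1) (hT : ‖T‖ ≤ 1) (hTn : ⟪T, n⟫ = 0) :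
    ‖2 * Real.pi * Complex.I * (∑ j, (T j : ℂ) * (a j : ℂ)) * q‖ ≤
      14 * d * ‖a‖ * √(∑ j, ‖modeFlux n a v q j‖ ^ 2) := by
  set f := √(∑ j, ‖modeFlux n a v q j‖ ^ 2) with hf
  have hf0 : 0 ≤ f := Real.sqrt_nonneg _
  have h1 := norm_sum_mul_le hT (modeFlux n a v q)
  have h2 := norm_sum_mul_le hn.le (modeFlux n a v q)
  have h3 := sum_mul_modeFlux (n := n) a v q T
  have h4 := sum_mul_modeFlux (n := n) a v q n
  rw [sum_mul_eq_inner, hTn, Complex.ofReal_zero, zero_mul, sub_zero] at h3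
  rw [sum_mul_eq_inner, real_inner_self_eq_norm_sq, hn, one_pow, Complex.ofReal_one, one_mul] at h4
  set ta := ∑ j, (T j : ℂ) * (a j : ℂ) with hta
  set na := ∑ j, (n j : ℂ) * (a j : ℂ) with hna
  have h5 : 2 * Real.pi * Complex.I * ta * q =
      2 * Real.pi * Complex.I * na * (∑ j, (T j : ℂ) * modeFlux n a v q j) -
        2 * Real.pi * Complex.I * ta * ∑ j, (n j : ℂ) * modeFlux n a v q j := by
    rw [h3, h4]; ring
  have hta1 : ‖ta‖ ≤ d * ‖a‖ := norm_sum_intCast_le a hT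
  have hna1 : ‖na‖ ≤ d * ‖a‖ := norm_sum_intCast_le a hn.le
  have hpi : ∀ z w : ℂ, ‖2 * Real.pi * Complex.I * z * w‖ ≤ 7 * (‖z‖ * ‖w‖) := by
    intro z w
    simp only [norm_mul, Complex.norm_I, Complex.norm_real, Complex.norm_ofNat, mul_one]
    rw [Real.norm_of_nonneg Real.pi_pos.le, mul_assoc]
    have := Real.pi_lt_d2
    gcongr
    linarith
  rw [h5]
  calc _ ≤ 7 * (‖na‖ * ‖∑ j, (T j : ℂ) * modeFlux n a v q j‖) +
        7 * (‖ta‖ * ‖∑ j, (n j : ℂ) * modeFlux n a v q j‖) :=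
        (norm_sub_le _ _).trans (add_le_add (hpi _ _) (hpi _ _))
    _ ≤ 7 * (d * ‖a‖ * f) + 7 * (d * ‖a‖ * f) := by gcongr
    _ = _ := by ring

theorem norm_intVec_sq_le : ‖intVec a‖ ^ 2 ≤ d * ‖a‖ ^ 2 := by
  rw [EuclideanSpace.real_norm_sq_eq]
  calc ∑ i, (intVec a) i ^ 2 ≤ ∑ _i : Fin d, ‖a‖ ^ 2 := by
        refine Finset.sum_le_sum fun i _ => ?_
        have := norm_le_pi_norm a i
        rw [Int.norm_eq_abs] at this
        rw [← sq_abs]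
        simp only [intVec]
        gcongr
    _ = d * ‖a‖ ^ 2 := by simp

/-- The Diophantine condition controls nonzero modes by the tangential gradient. -/
theorem IsDiophantine.norm_le {κ : ℝ} (hκ : 0 < κ) (hn : ‖n‖ = 1) (h : IsDiophantine n κ)
    (ha : a ≠ 0) : ‖v‖ ≤ d * ‖a‖ ^ 2 / κ * √(∑ j, ‖modeFlux n a v q j‖ ^ 2) := by
  set f := √(∑ j, ‖modeFlux n a v q j‖ ^ 2) with hf
  have hf0 : 0 ≤ f := Real.sqrt_nonneg _
  set x := intVec a with hx
  have hx0 : 0 < ‖x‖ := by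
    rw [norm_pos_iff]
    intro h0
    apply ha
    funext i
    have := congrFun (congrArg WithLp.ofLp h0) i
    simpa [hx, intVec] using this
  set Px := x - inner ℝ n x • n with hPx
  have hP := h a ha
  have hPpos : 0 < ‖Px‖ := lt_of_lt_of_le (by positivity) hP
  have hPn : ⟪Px, n⟫ = 0 := by
    rw [hPx, inner_sub_left, inner_smul_left, real_inner_self_eq_norm_sq, hn, real_inner_comm]
    simp
  have hPP : ⟪Px, x⟫ = ‖Px‖ ^ 2 := by
    have : x = Px + inner ℝ n x • n := by rw [hPx]; abel
    conv_lhs => rw [this]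
    rw [inner_add_right, inner_smul_right, hPn, real_inner_self_eq_norm_sq]; simp
  -- The tangential unit vector along the projection `Px` is the best direction: its product with
  -- `a` is `‖Px‖`, which the Diophantine condition bounds from below.
  have h1 := norm_tangential_left_le (n := n) (T := ‖Px‖⁻¹ • Px) a v q
    (by rw [norm_smul, norm_inv, norm_norm, inv_mul_cancel₀ hPpos.ne'])
    (by rw [inner_smul_left, hPn, mul_zero])
  have h2 : ∑ j, (((‖Px‖⁻¹ • Px) j : ℝ) : ℂ) * (a j : ℂ) = (‖Px‖ : ℂ) := by
    have e : ∑ j, (‖Px‖⁻¹ • Px) j * x j = ‖Px‖ := by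
      rw [sum_mul_eq_inner, inner_smul_left, hPP]
      simp only [conj_trivial]
      field_simp
    refine Eq.trans ?_ (congrArg Complex.ofReal e)
    push_cast
    rfl
  rw [h2] at h1
  simp only [norm_mul, Complex.norm_I, Complex.norm_real, Complex.norm_ofNat, mul_one,
    Real.norm_of_nonneg Real.pi_pos.le, norm_norm] at h1
  have h3 : ‖Px‖ * ‖v‖ ≤ f := by
    refine le_trans ?_ h1
    have : 0 ≤ ‖Px‖ * ‖v‖ := by positivity
    nlinarith [Real.pi_gt_three]
  have h4 : κ * ‖v‖ ≤ d * ‖a‖ ^ 2 * f := by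
    have e1 : κ ≤ ‖Px‖ * ‖x‖ ^ 2 := by
      have := mul_le_mul_of_nonneg_right hP (sq_nonneg ‖x‖)
      rwa [mul_assoc, inv_mul_cancel₀ (by positivity), mul_one] at this
    calc κ * ‖v‖ ≤ ‖Px‖ * ‖x‖ ^ 2 * ‖v‖ := by gcongr
      _ = ‖x‖ ^ 2 * (‖Px‖ * ‖v‖) := by ring
      _ ≤ (d * ‖a‖ ^ 2) * f := mul_le_mul (norm_intVec_sq_le a) h3 (by positivity) (by positivity)
  rw [div_mul_eq_mul_div, le_div_iff₀ hκ]
  linarith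

end Pointwise

/-- Test the condition with a coordinate vector, whose projection has length at most one. -/
theorem IsDiophantine.le_one {n : EuclideanSpace ℝ (Fin d)} {κ : ℝ} (hd : 2 ≤ d) (hn : ‖n‖ = 1)
    (h : IsDiophantine n κ) : κ ≤ 1 := by
  let i : Fin d := ⟨0, by omega⟩
  have hx : intVec (Pi.single i 1) = EuclideanSpace.single i (1 : ℝ) := by
    ext j
    by_cases hj : j = i
    · subst hj; simp [intVec]
    · simp [intVec, hj]
  have h1 := h (Pi.single i 1) (by simp)
  rw [hx, PiLp.norm_single, norm_one, one_pow, inv_one, mul_one] at h1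
  refine h1.trans ?_
  set x : EuclideanSpace ℝ (Fin d) := EuclideanSpace.single i (1 : ℝ) with hxdef
  have hx1 : ‖x‖ = 1 := by simp [hxdef]
  have h2 : ‖x - inner ℝ n x • n‖ ^ 2 ≤ 1 := by
    rw [norm_sub_sq_real, norm_smul, hn, hx1, inner_smul_right, real_inner_comm, mul_one,
      Real.norm_eq_abs, sq_abs]
    nlinarith [sq_nonneg ⟪x, n⟫]
  nlinarith [norm_nonneg (x - inner ℝ n x • n)]

end

/-! ### Boundedness and coercivity of `A` in weighted norms -/

section

open scoped RealInnerProductSpace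

variable {d m : ℕ}

/-- The data of the half-space Neumann problem, apart from the position of the half-space. -/
structure NeumannData (d m : ℕ) where
  A : EuclideanSpace ℝ (Fin d) → Coeff d m
  n : EuclideanSpace ℝ (Fin d)
  T : EuclideanSpace ℝ (Fin d)
  κ : ℝ
  μ : ℝ
  g : EuclideanSpace ℝ (Fin d) → EuclideanSpace ℝ (Fin m)
  two_le : 2 ≤ d
  μ_pos : 0 < μ
  contDiff_A : ContDiff ℝ ∞ A
  periodic_A : IsPeriodic A
  elliptic : IsElliptic μ A
  contDiff_g : ContDiff ℝ ∞ g
  periodic_g : IsPeriodic g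
  norm_n : ‖n‖ = 1
  norm_T : ‖T‖ ≤ 1
  inner_T_n : ⟪T, n⟫ = 0
  κ_pos : 0 < κ
  diophantine : IsDiophantine n κ

theorem norm_diagOp_le {J : Type} [Fintype J] {c c' : J → ℂ} {C : ℝ} (hC : 0 ≤ C)
    (h : ∀ x, ‖c x‖ ≤ C * ‖c' x‖) (v : EuclideanSpace ℂ J) :
    ‖diagOp c v‖ ≤ C * ‖diagOp c' v‖ := by
  refine norm_le_of_forall_norm_le hC ?_
  rw [Finset.mul_sum]
  refine Finset.sum_le_sum fun x _ => ?_
  simp only [diagOp_apply, norm_mul, ← mul_pow, ← mul_assoc]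
  gcongr
  exact h x

theorem inner_diagOp {J : Type} [Fintype J] (c : J → ℝ) (v w : EuclideanSpace ℂ J) :
    ⟪diagOp (fun x => (c x : ℂ)) v, w⟫ = ⟪v, diagOp (fun x => (c x : ℂ)) w⟫ := by
  rw [real_inner_eq_sum, real_inner_eq_sum]
  refine Finset.sum_congr rfl fun x _ => ?_
  simp only [diagOp_apply, map_mul, Complex.conj_ofReal]
  congr 1; ring

/-- `2πi ζ_j`, the symbol of the derivative in direction `j`. -/
def gradSymbol (ζ : Fin d → ℤ) (j : Fin d) : ℂ := 2 * Real.pi * Complex.I * (ζ j : ℂ)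

theorem conj_gradSymbol (ζ : Fin d → ℤ) (j : Fin d) :
    (starRingEnd ℂ) (gradSymbol ζ j) = -gradSymbol ζ j := by
  simp [gradSymbol, Complex.conj_ofReal, Complex.conj_ofNat]

theorem norm_gradSymbol_le (ζ : Fin d → ℤ) (j : Fin d) : ‖gradSymbol ζ j‖ ≤ 7 * ‖ζ‖ := by
  simp only [gradSymbol, norm_mul, Complex.norm_I, Complex.norm_real, Complex.norm_ofNat, mul_one]
  rw [Real.norm_of_nonneg Real.pi_pos.le, Complex.norm_intCast, ← Int.norm_eq_abs]
  have := Real.pi_lt_d2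
  have h2 := norm_le_pi_norm ζ j
  gcongr
  linarith

/-- The small parameter of the Sobolev weights. -/
def smallParam (d m : ℕ) (μ SA : ℝ) : ℝ := min 1 (μ / (2 * (d * m * SA + 1)))

namespace NeumannData

variable (pb : NeumannData d m)

theorem eps_pos {SA : ℝ} (h : 0 ≤ SA) : 0 < smallParam d m pb.μ SA := by
  have := pb.μ_pos
  exact lt_min one_pos (by positivity)

theorem eps_le_one (SA : ℝ) : smallParam d m pb.μ SA ≤ 1 := min_le_left _ _

/-- The choice of `ε` is made for this: the Schur bound of the commutator consumes at most half of
the ellipticity. -/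
theorem eps_mul_le {SA : ℝ} (h : 0 ≤ SA) : smallParam d m pb.μ SA * (d * m * SA) ≤ pb.μ / 2 := by
  have hμ := pb.μ_pos
  have hB : 0 ≤ (d * m * SA : ℝ) := by positivity
  calc smallParam d m pb.μ SA * (d * m * SA) ≤ pb.μ / (2 * (d * m * SA + 1)) * (d * m * SA) := by
        gcongr; exact min_le_right _ _
    _ ≤ pb.μ / 2 := by
        rw [div_mul_eq_mul_div, div_le_div_iff₀ (by positivity) two_pos]
        nlinarith

variable (S : Finset (Fin d → ℤ))

/-- The kernel of multiplication by `A` in Fourier variables. -/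
def kernel (x z : S × Fin d × Fin m) : ℂ :=
  tensorCoeff pb.A (x.1.1 - z.1.1) x.2.1 z.2.1 x.2.2 z.2.2

theorem norm_kernel_le (x z : S × Fin d × Fin m) :
    ‖pb.kernel S x z‖ ≤ ‖tensorCoeff pb.A (x.1.1 - z.1.1)‖ := by
  set a := tensorCoeff pb.A (x.1.1 - z.1.1) with ha
  exact (norm_le_pi_norm (a x.2.1 z.2.1 x.2.2) z.2.2).trans <|
    (norm_le_pi_norm (a x.2.1 z.2.1) x.2.2).trans <|
    (norm_le_pi_norm (a x.2.1) z.2.1).trans (norm_le_pi_norm a x.2.1)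

/-- Schur's test for kernels dominated by the kernel of `A` with a polynomial weight. -/
theorem norm_kernelOp_weight_le {p : ℕ} {SA : ℝ} (hA : MomentLE p (tensorCoeff pb.A) SA)
    {r : S × Fin d × Fin m → S × Fin d × Fin m → ℂ} {C : ℝ} (hC : 0 ≤ C)
    (hr : ∀ x z, ‖r x z‖ ≤ C * (1 + ‖x.1.1 - z.1.1‖) ^ p) (F : EuclideanSpace ℂ (S × Fin d × Fin m)) :
    ‖kernelOp (fun x z => r x z * pb.kernel S x z) F‖ ≤ C * (d * m * SA) * ‖F‖ := by
  set b : (Fin d → ℤ) → ℝ := fun ζ => (1 + ‖ζ‖) ^ p * ‖tensorCoeff pb.A ζ‖ with hb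
  have hb0 : ∀ ζ, 0 ≤ b ζ := fun ζ => by positivity
  have hle : ∀ x z, ‖r x z * pb.kernel S x z‖ ≤ C * b (x.1.1 - z.1.1) := by
    intro x z
    rw [norm_mul, hb, ← mul_assoc]
    exact mul_le_mul (hr x z) (pb.norm_kernel_le S x z) (norm_nonneg _) (by positivity)
  have hcard : (Fintype.card (Fin d × Fin m) : ℝ) = d * m := by simp
  have hsum := hA.2
  have hSA := hA.nonneg
  refine norm_kernelOp_le (by positivity) (fun x => ?_) (fun z => ?_) F
  · refine (Finset.sum_le_sum fun z _ => hle x z).trans ?_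
    rw [← Finset.mul_sum]
    have := (sum_convolution_le (S := S) (P := Fin d × Fin m) hb0 hA.1 x.1.1).1
    rw [hcard] at this
    gcongr
    exact this.trans (by gcongr)
  · refine (Finset.sum_le_sum fun x _ => hle x z).trans ?_
    rw [← Finset.mul_sum]
    have := (sum_convolution_le (S := S) (P := Fin d × Fin m) hb0 hA.1 z.1.1).2
    rw [hcard] at this
    gcongr
    exact this.trans (by gcongr)

/-- The weight as an operator on a space of Fourier coefficients. -/
def weightOp (S : Finset (Fin d → ℤ)) (P : Type) [Fintype P] (ε : ℝ) (s : ℕ) :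
    EuclideanSpace ℂ (S × P) →L[ℝ] EuclideanSpace ℂ (S × P) :=
  diagOp fun x => ((weight ε s x.1.1 : ℝ) : ℂ)

theorem weightOp_apply (P : Type) [Fintype P] (ε : ℝ) (s : ℕ) (v : EuclideanSpace ℂ (S × P))
    (x : S × P) : weightOp S P ε s v x = (weight ε s x.1.1 : ℂ) * v x := rfl

/-- Moving the weight past `A` multiplies the kernel by a ratio of weights. Submultiplicativity
bounds this ratio by a power of `1 + ‖ζ - η‖`, which the moments of `A` absorb in Schur's test,
uniformly in `S`. -/
theorem norm_weightOp_kernelOp_le {p : ℕ} {SA : ℝ} (hA : MomentLE p (tensorCoeff pb.A) SA) {s : ℕ} (hs : s ≤ p)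
    {ε : ℝ} (hε : 0 ≤ ε) (hε1 : ε ≤ 1) (F : EuclideanSpace ℂ (S × Fin d × Fin m)) :
    ‖weightOp S (Fin d × Fin m) ε s (kernelOp (pb.kernel S) F)‖ ≤
      d * m * SA * ‖weightOp S (Fin d × Fin m) ε s F‖ := by
  have h1 : weightOp S (Fin d × Fin m) ε s (kernelOp (pb.kernel S) F) =
      kernelOp (fun x z => ((weight ε s x.1.1 / weight ε s z.1.1 : ℝ) : ℂ) * pb.kernel S x z)
        (weightOp S (Fin d × Fin m) ε s F) := by
    ext x
    rw [weightOp_apply, kernelOp_apply, kernelOp_apply, Finset.mul_sum]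
    refine Finset.sum_congr rfl fun z _ => ?_
    rw [weightOp_apply]
    have : (weight ε s z.1.1 : ℂ) ≠ 0 := by exact_mod_cast (weight_pos hε s z.1.1).ne'
    push_cast
    field_simp
  rw [h1]
  refine (pb.norm_kernelOp_weight_le S hA (C := 1) zero_le_one (fun x z => ?_) _).trans ?_
  · have hz := weight_pos hε s z.1.1
    rw [Complex.norm_real, Real.norm_of_nonneg (div_nonneg (weight_pos hε s x.1.1).le hz.le),
      one_mul, div_le_iff₀ hz]
    refine (weight_le_weight_mul hε s x.1.1 z.1.1).trans ?_
    gcongr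
    exact weight_le hε hε1 hs _
  · rw [one_mul]

/-- After moving the weight past `A`, the kernel is that of `A` plus that of `A` times (ratio of
weights minus one). The first is coercive with constant `μ`. The second has norm at most `μ / 2` by
the choice of `ε`. -/
theorem coercive_weightOp_kernelOp {p : ℕ} {SA : ℝ} (hA : MomentLE p (tensorCoeff pb.A) SA) {s : ℕ} (hs : s ≤ p)
    (F : EuclideanSpace ℂ (S × Fin d × Fin m)) :
    pb.μ / 2 * ‖weightOp S (Fin d × Fin m) (smallParam d m pb.μ SA) s F‖ ^ 2 ≤
      ⟪weightOp S (Fin d × Fin m) (smallParam d m pb.μ SA) s (kernelOp (pb.kernel S) F),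
        weightOp S (Fin d × Fin m) (smallParam d m pb.μ SA) s F⟫ := by
  set ε := smallParam d m pb.μ SA with hεdef
  have hε : 0 ≤ ε := (pb.eps_pos hA.nonneg).le
  have hε1 : ε ≤ 1 := pb.eps_le_one SA
  set F' := weightOp S (Fin d × Fin m) ε s F with hF'
  have h1 : weightOp S (Fin d × Fin m) ε s (kernelOp (pb.kernel S) F) =
      kernelOp (pb.kernel S) F' +
      kernelOp (fun x z => ((weight ε s x.1.1 / weight ε s z.1.1 - 1 : ℝ) : ℂ) * pb.kernel S x z)
        F' := by
    ext x
    rw [PiLp.add_apply, weightOp_apply, kernelOp_apply, kernelOp_apply, kernelOp_apply,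
      Finset.mul_sum, ← Finset.sum_add_distrib]
    refine Finset.sum_congr rfl fun z _ => ?_
    rw [hF', weightOp_apply]
    have : (weight ε s z.1.1 : ℂ) ≠ 0 := by exact_mod_cast (weight_pos hε s z.1.1).ne'
    push_cast
    field_simp
    ring
  have h2 := pb.norm_kernelOp_weight_le S hA (C := ε) hε
    (r := fun x z => ((weight ε s x.1.1 / weight ε s z.1.1 - 1 : ℝ) : ℂ)) (fun x z => by
      rw [Complex.norm_real]
      exact abs_weight_div_sub_one_le hε hε1 hs _ _) F'
  have h3 : pb.μ * ‖F'‖ ^ 2 ≤ ⟪kernelOp (pb.kernel S) F', F'⟫ := by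
    have := pb.elliptic.fourier pb.contDiff_A.continuous pb.periodic_A (S := S) F'
    rw [EuclideanSpace.norm_sq_eq]
    refine this.trans (le_of_eq ?_)
    rw [real_inner_comm, real_inner_eq_sum, Complex.re_sum]
    refine Finset.sum_congr rfl fun x _ => ?_
    rw [kernelOp_apply, mul_comm]
    rfl
  have h4 := pb.eps_mul_le hA.nonneg
  rw [h1, inner_add_left]
  have h5 := neg_le_of_abs_le (abs_real_inner_le_norm (kernelOp (fun x z =>
    ((weight ε s x.1.1 / weight ε s z.1.1 - 1 : ℝ) : ℂ) * pb.kernel S x z) F') F')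
  have h6 : ε * (d * m * SA) * ‖F'‖ * ‖F'‖ ≤ pb.μ / 2 * ‖F'‖ * ‖F'‖ := by gcongr
  have h7 := mul_le_mul_of_nonneg_right h2 (norm_nonneg F')
  nlinarith

end NeumannData

end

/-! ### The Galerkin system of the half-space problem -/

section

open scoped RealInnerProductSpace

variable {d m : ℕ}

namespace NeumannData

variable (pb : NeumannData d m) (S : Finset (Fin d → ℤ))

/-- The gradient in Fourier variables. -/
def gradOp : EuclideanSpace ℂ (S × Fin m) →L[ℝ] EuclideanSpace ℂ (S × Fin d × Fin m) :=
  spreadOp (Fin m) fun a : S => gradSymbol a.1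

/-- Multiplication by the normal. -/
def normalOp : EuclideanSpace ℂ (S × Fin m) →L[ℝ] EuclideanSpace ℂ (S × Fin d × Fin m) :=
  spreadOp (Fin m) fun (_ : S) i => (pb.n i : ℂ)

/-- The normal component. -/
def normalCompOp : EuclideanSpace ℂ (S × Fin d × Fin m) →L[ℝ] EuclideanSpace ℂ (S × Fin m) :=
  contractOp (Fin m) fun (_ : S) i => (pb.n i : ℂ)

/-- The divergence in Fourier variables. -/
def divOp : EuclideanSpace ℂ (S × Fin d × Fin m) →L[ℝ] EuclideanSpace ℂ (S × Fin m) :=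
  contractOp (Fin m) fun a : S => gradSymbol a.1

/-- The symbol of the derivative in direction `n`. -/
def normalSymbol (ζ : Fin d → ℤ) : ℂ := ∑ i, (pb.n i : ℂ) * gradSymbol ζ i

/-- The projection to the mean value. -/
def meanOp (S : Finset (Fin d → ℤ)) :
    EuclideanSpace ℂ (S × Fin m) →L[ℝ] EuclideanSpace ℂ (S × Fin m) :=
  diagOp fun x => (((if x.1.1 = 0 then 1 else 0 : ℝ)) : ℂ)

/-- The Fourier coefficients of the Neumann datum `T · ∇g`. -/
def datum : EuclideanSpace ℂ (S × Fin m) :=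
  WithLp.toLp 2 fun x => 2 * Real.pi * Complex.I * (∑ j, (pb.T j : ℂ) * (x.1.1 j : ℂ)) *
    vectorCoeff pb.g x.1.1 x.2

theorem datum_apply (x : S × Fin m) : pb.datum S x =
    2 * Real.pi * Complex.I * (∑ j, (pb.T j : ℂ) * (x.1.1 j : ℂ)) * vectorCoeff pb.g x.1.1 x.2 := rfl

variable {S}

theorem gradOp_sub_normalOp (v q : EuclideanSpace ℂ (S × Fin m)) (x : S × Fin m) (i : Fin d) :
    (gradOp S v - pb.normalOp S q) (x.1, i, x.2) = modeFlux pb.n x.1.1 (v x) (q x) i := rfl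

theorem normalSymbol_eq (ζ : Fin d → ℤ) :
    pb.normalSymbol ζ = 2 * Real.pi * Complex.I * ∑ i, (pb.n i : ℂ) * (ζ i : ℂ) := by
  rw [normalSymbol, Finset.mul_sum]
  exact Finset.sum_congr rfl fun i _ => by rw [gradSymbol]; ring

theorem normalCompOp_gradOp_apply (v : EuclideanSpace ℂ (S × Fin m)) (x : S × Fin m) :
    pb.normalCompOp S (gradOp S v) x = pb.normalSymbol x.1.1 * v x := by
  rw [normalCompOp, contractOp_apply, normalSymbol, Finset.sum_mul]
  refine Finset.sum_congr rfl fun i _ => ?_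
  rw [gradOp, spreadOp_apply]
  ring

theorem norm_normalSymbol_le (ζ : Fin d → ℤ) : ‖pb.normalSymbol ζ‖ ≤ 7 * d * ‖ζ‖ := by
  rw [normalSymbol_eq, norm_mul]
  simp only [norm_mul, Complex.norm_I, Complex.norm_real, Complex.norm_ofNat, mul_one]
  rw [Real.norm_of_nonneg Real.pi_pos.le, mul_assoc 7]
  have h1 := norm_sum_intCast_le ζ pb.norm_n.le
  have h2 := Real.pi_lt_d2
  gcongr
  linarith

theorem sum_n_sq : ∑ i, (pb.n i : ℂ) * (pb.n i : ℂ) = 1 := by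
  have := sum_mul_eq_inner pb.n pb.n
  rw [real_inner_self_eq_norm_sq, pb.norm_n, one_pow] at this
  exact_mod_cast this

/-- A single tangential slice of a weighted gradient is bounded by the whole. -/
theorem weight_mul_sqrt_le {ε : ℝ} (hε : 0 ≤ ε) (s : ℕ) (F : EuclideanSpace ℂ (S × Fin d × Fin m))
    (x : S × Fin m) : weight ε s x.1.1 * √(∑ i, ‖F (x.1, i, x.2)‖ ^ 2) ≤
      ‖weightOp S (Fin d × Fin m) ε s F‖ := by
  have hw := (weight_pos hε s x.1.1).le
  refine (sq_le_sq₀ (by positivity) (norm_nonneg _)).1 ?_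
  rw [mul_pow, Real.sq_sqrt (by positivity), EuclideanSpace.norm_sq_eq, sum_triple, Finset.mul_sum]
  refine le_trans (le_of_eq ?_) (Finset.single_le_sum (f := fun x : S × Fin m =>
    ∑ i, ‖weightOp S (Fin d × Fin m) ε s F (x.1, i, x.2)‖ ^ 2)
    (fun x _ => by positivity) (Finset.mem_univ x))
  refine Finset.sum_congr rfl fun i _ => ?_
  rw [weightOp_apply, norm_mul, Complex.norm_real, Real.norm_of_nonneg hw, mul_pow]

theorem abs_inner_weightOp_le {ε : ℝ} (hε : 0 ≤ ε) (s : ℕ) (h v : EuclideanSpace ℂ (S × Fin m)) :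
    |⟪weightOp S (Fin m) ε s h, weightOp S (Fin m) ε s v⟫| ≤
      ∑ x, weight ε s x.1.1 * (weight ε s x.1.1 * (‖h x‖ * ‖v x‖)) := by
  rw [real_inner_eq_sum]
  refine (Finset.abs_sum_le_sum_abs _ _).trans (Finset.sum_le_sum fun x _ => ?_)
  refine (Complex.abs_re_le_norm _).trans (le_of_eq ?_)
  have hw := (weight_pos hε s x.1.1).le
  rw [weightOp_apply, weightOp_apply, norm_mul, RCLike.norm_conj, norm_mul, norm_mul,
    Complex.norm_real, Real.norm_of_nonneg hw]
  ring

theorem sum_weight_vectorCoeff_le {p : ℕ} {Sg : ℝ} (hg : MomentLE p (vectorCoeff pb.g) Sg) :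
    ∑ x : S × Fin m, (1 + ‖x.1.1‖) ^ p * ‖vectorCoeff pb.g x.1.1 x.2‖ ≤ m * Sg := by
  calc _ ≤ ∑ x : S × Fin m, (1 + ‖x.1.1‖) ^ p * ‖vectorCoeff pb.g x.1.1‖ := by
        gcongr with x; exact norm_le_pi_norm _ x.2
    _ = m * ∑ a ∈ S, (1 + ‖a‖) ^ p * ‖vectorCoeff pb.g a‖ := by
        rw [Fintype.sum_prod_type]
        simp only [Finset.sum_const, Finset.card_univ, Fintype.card_fin, nsmul_eq_mul]
        rw [← Finset.mul_sum, Finset.sum_coe_sort S fun a => (1 + ‖a‖) ^ p * ‖vectorCoeff pb.g a‖]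
    _ ≤ m * Sg := by
        gcongr
        exact (hg.1.sum_le_tsum _ fun ζ _ => by positivity).trans hg.2

/-- The factor `T·ζ` of the datum is moved onto `w`, where the tangential estimates apply. Of the
two weights one stays with `F` and the other goes to the coefficients of `g`. So does the frequency
lost in `norm_tangential_right_le`, whence the exponent `p + 1`. -/
theorem abs_inner_datum_le {p : ℕ} {Sg : ℝ} (hg : MomentLE (p + 1) (vectorCoeff pb.g) Sg) {s : ℕ}
    (hs : s ≤ p) {ε : ℝ} (hε : 0 ≤ ε) (hε1 : ε ≤ 1) (w : EuclideanSpace ℂ (S × Fin m))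
    (F : EuclideanSpace ℂ (S × Fin d × Fin m))
    (h : ∀ x : S × Fin m, ‖2 * Real.pi * Complex.I * (∑ j, (pb.T j : ℂ) * (x.1.1 j : ℂ)) * w x‖ ≤
      14 * (d + 1) * (1 + ‖x.1.1‖) * √(∑ i, ‖F (x.1, i, x.2)‖ ^ 2)) :
    |⟪weightOp S (Fin m) ε s (pb.datum S), weightOp S (Fin m) ε s w⟫| ≤
      14 * (d + 1) * m * Sg * ‖weightOp S (Fin d × Fin m) ε s F‖ := by
  refine (abs_inner_weightOp_le hε s _ _).trans ?_
  calc _ ≤ ∑ x : S × Fin m, 14 * (d + 1) * ‖weightOp S (Fin d × Fin m) ε s F‖ *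
          ((1 + ‖x.1.1‖) ^ (p + 1) * ‖vectorCoeff pb.g x.1.1 x.2‖) := by
        refine Finset.sum_le_sum fun x _ => ?_
        have hw := (weight_pos hε s x.1.1).le
        have e1 : ‖pb.datum S x‖ * ‖w x‖ = ‖vectorCoeff pb.g x.1.1 x.2‖ *
            ‖2 * Real.pi * Complex.I * (∑ j, (pb.T j : ℂ) * (x.1.1 j : ℂ)) * w x‖ := by
          rw [datum_apply, ← norm_mul, ← norm_mul]; congr 1; ring
        rw [e1]
        calc _ ≤ (1 + ‖x.1.1‖) ^ p * (weight ε s x.1.1 * (‖vectorCoeff pb.g x.1.1 x.2‖ *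
              (14 * (d + 1) * (1 + ‖x.1.1‖) * √(∑ i, ‖F (x.1, i, x.2)‖ ^ 2)))) := by
              gcongr
              · exact weight_le hε hε1 hs _
              · exact h x
          _ = 14 * (d + 1) * (weight ε s x.1.1 * √(∑ i, ‖F (x.1, i, x.2)‖ ^ 2)) *
              ((1 + ‖x.1.1‖) ^ (p + 1) * ‖vectorCoeff pb.g x.1.1 x.2‖) := by ring
          _ ≤ _ := by
              gcongr
              exact weight_mul_sqrt_le hε s F x
    _ = 14 * (d + 1) * ‖weightOp S (Fin d × Fin m) ε s F‖ *
        ∑ x : S × Fin m, ((1 + ‖x.1.1‖) ^ (p + 1) * ‖vectorCoeff pb.g x.1.1 x.2‖) := by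
        rw [Finset.mul_sum]
    _ ≤ 14 * (d + 1) * ‖weightOp S (Fin d × Fin m) ε s F‖ * (m * Sg) := by
        gcongr; exact pb.sum_weight_vectorCoeff_le hg
    _ = _ := by ring

/-- Apply the Diophantine bound to each nonzero mode. Its factor `‖ζ‖²` raises the order of the
weight by two and costs `1 / ε²`. The constant is generous so that one `D` serves all the bounds of
the system. -/
theorem norm_weightOp_sub_meanOp_le {ε : ℝ} (hε : 0 < ε) (s : ℕ) (v q : EuclideanSpace ℂ (S × Fin m)) :
    ‖weightOp S (Fin m) ε s (v - meanOp S v)‖ ≤ 7 * (d + 1) / ε ^ 2 / pb.κ *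
      ‖weightOp S (Fin d × Fin m) ε (s + 2) (gradOp S v - pb.normalOp S q)‖ := by
  have hκ := pb.κ_pos
  refine norm_le_of_forall_norm_le (by positivity) ?_
  rw [sum_triple, Finset.mul_sum]
  refine Finset.sum_le_sum fun x _ => ?_
  have hw := (weight_pos hε.le s x.1.1).le
  have e1 : (v - meanOp S v) x = if x.1.1 = 0 then 0 else v x := by
    simp only [PiLp.sub_apply, meanOp, diagOp_apply]
    split_ifs <;> simp
  rw [weightOp_apply, e1]
  split_ifs with h0
  · rw [mul_zero, norm_zero, zero_pow two_ne_zero]; positivity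
  · have h1 := pb.diophantine.norm_le x.1.1 (v x) (q x) hκ pb.norm_n h0
    have h2 : ‖x.1.1‖ ^ 2 * weight ε s x.1.1 ≤ 1 / ε ^ 2 * weight ε (s + 2) x.1.1 := by
      have a1 := norm_mul_weight_le hε s x.1.1
      have a2 := norm_mul_weight_le hε (s + 1) x.1.1
      calc _ = ‖x.1.1‖ * (‖x.1.1‖ * weight ε s x.1.1) := by ring
        _ ≤ ‖x.1.1‖ * (1 / ε * weight ε (s + 1) x.1.1) := by gcongr
        _ = 1 / ε * (‖x.1.1‖ * weight ε (s + 1) x.1.1) := by ring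
        _ ≤ 1 / ε * (1 / ε * weight ε (s + 1 + 1) x.1.1) := by gcongr
        _ = _ := by rw [add_assoc]; field_simp
    set f := √(∑ j, ‖modeFlux pb.n x.1.1 (v x) (q x) j‖ ^ 2) with hf
    have hf0 : 0 ≤ f := Real.sqrt_nonneg _
    have h3 : weight ε s x.1.1 * ‖v x‖ ≤
        7 * (d + 1) / ε ^ 2 / pb.κ * (weight ε (s + 2) x.1.1 * f) := by
      calc _ ≤ weight ε s x.1.1 * (d * ‖x.1.1‖ ^ 2 / pb.κ * f) := by gcongr
        _ = d / pb.κ * f * (‖x.1.1‖ ^ 2 * weight ε s x.1.1) := by ring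
        _ ≤ (7 * (d + 1)) / pb.κ * f * (1 / ε ^ 2 * weight ε (s + 2) x.1.1) := by
            gcongr; linarith [Nat.cast_nonneg (α := ℝ) d]
        _ = _ := by ring
    rw [norm_mul, Complex.norm_real, Real.norm_of_nonneg hw]
    calc _ ≤ (7 * (d + 1) / ε ^ 2 / pb.κ * (weight ε (s + 2) x.1.1 * f)) ^ 2 := by gcongr
      _ = (7 * (d + 1) / ε ^ 2 / pb.κ) ^ 2 * (weight ε (s + 2) x.1.1 ^ 2 *
          ∑ j, ‖modeFlux pb.n x.1.1 (v x) (q x) j‖ ^ 2) := by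
          rw [mul_pow, mul_pow, hf, Real.sq_sqrt (by positivity)]
      _ = _ := by
          congr 1
          rw [Finset.mul_sum]
          refine Finset.sum_congr rfl fun i _ => ?_
          rw [weightOp_apply, gradOp_sub_normalOp, norm_mul, Complex.norm_real,
            Real.norm_of_nonneg (weight_pos hε.le _ _).le, mul_pow]

theorem norm_weight_mul_le {ε : ℝ} (hε : 0 < ε) (s : ℕ) {ζ : Fin d → ℤ} {z : ℂ} {C : ℝ}
    (hC : 0 ≤ C) (hz : ‖z‖ ≤ C * ‖ζ‖) :
    ‖(weight ε s ζ : ℂ) * z‖ ≤ C / ε * ‖((weight ε (s + 1) ζ : ℝ) : ℂ)‖ := by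
  have hw := (weight_pos hε.le s ζ).le
  rw [norm_mul, Complex.norm_real, Complex.norm_real, Real.norm_of_nonneg hw,
    Real.norm_of_nonneg (weight_pos hε.le _ ζ).le]
  calc _ ≤ weight ε s ζ * (C * ‖ζ‖) := by gcongr
    _ = C * (‖ζ‖ * weight ε s ζ) := by ring
    _ ≤ C * (1 / ε * weight ε (s + 1) ζ) :=
        mul_le_mul_of_nonneg_left (norm_mul_weight_le hε s ζ) hC
    _ = _ := by ring

theorem norm_weightOp_mono {P : Type} [Fintype P] {ε : ℝ} (hε : 0 ≤ ε) (s : ℕ)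
    (F : EuclideanSpace ℂ (S × P)) : ‖weightOp S P ε s F‖ ≤ ‖weightOp S P ε (s + 1) F‖ := by
  have h : ∀ x : S × P, ‖((weight ε s x.1.1 : ℝ) : ℂ)‖ ≤
      1 * ‖((weight ε (s + 1) x.1.1 : ℝ) : ℂ)‖ := by
    intro x
    rw [one_mul, Complex.norm_real, Complex.norm_real, Real.norm_of_nonneg (weight_pos hε _ _).le,
      Real.norm_of_nonneg (weight_pos hε _ _).le, weight, weight]
    have h1 : 1 ≤ 1 + ε * ‖x.1.1‖ := by
      have := mul_nonneg hε (norm_nonneg x.1.1); linarith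
    exact pow_le_pow_right₀ h1 (Nat.le_succ s)
  exact (norm_diagOp_le zero_le_one h F).trans (one_mul _).le

theorem seven_mul_sqrt_le {ε : ℝ} (hε : 0 < ε) (hε1 : ε ≤ 1) :
    7 / ε * √d ≤ 7 * (d + 1) / ε ^ 2 := by
  have h1 : √(d : ℝ) ≤ d + 1 := by
    rw [Real.sqrt_le_left (by positivity)]
    nlinarith [Nat.cast_nonneg (α := ℝ) d]
  calc 7 / ε * √d ≤ 7 / ε ^ 2 * (d + 1) := by
        gcongr
        nlinarith
    _ = _ := by ring

theorem norm_weightOp_gradOp_le {ε : ℝ} (hε : 0 < ε) (hε1 : ε ≤ 1) (s : ℕ)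
    (v : EuclideanSpace ℂ (S × Fin m)) :
    ‖weightOp S (Fin d × Fin m) ε s (gradOp S v)‖ ≤
      7 * (d + 1) / ε ^ 2 * ‖weightOp S (Fin m) ε (s + 1) v‖ := by
  have h1 : weightOp S (Fin d × Fin m) ε s (gradOp S v) =
      spreadOp (Fin m) (fun a i => (weight ε s a.1 : ℂ) * gradSymbol a.1 i) v := by
    ext x
    simp only [gradOp, weightOp_apply, spreadOp_apply]
    ring
  have h2 := norm_spreadOp_le (P := Fin m) (I := S)
    (c := fun a i => (weight ε s a.1 : ℂ) * gradSymbol a.1 i)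
    (r := fun a => ((weight ε (s + 1) a.1 : ℝ) : ℂ)) (C := 7 / ε) (by positivity)
    (fun a i => norm_weight_mul_le hε s (by norm_num) (norm_gradSymbol_le a.1 i)) v
  rw [← h1] at h2
  exact h2.trans (mul_le_mul_of_nonneg_right (seven_mul_sqrt_le hε hε1) (norm_nonneg _))

theorem norm_weightOp_divOp_le {ε : ℝ} (hε : 0 < ε) (hε1 : ε ≤ 1) (s : ℕ)
    (F : EuclideanSpace ℂ (S × Fin d × Fin m)) :
    ‖weightOp S (Fin m) ε s (divOp S F)‖ ≤
      7 * (d + 1) / ε ^ 2 * ‖weightOp S (Fin d × Fin m) ε (s + 1) F‖ := by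
  have h1 : weightOp S (Fin m) ε s (divOp S F) =
      contractOp (Fin m) (fun a i => (weight ε s a.1 : ℂ) * gradSymbol a.1 i) F := by
    ext x
    simp only [divOp, weightOp_apply, contractOp_apply, Finset.mul_sum]
    exact Finset.sum_congr rfl fun i _ => by ring
  have h2 := norm_contractOp_le (P := Fin m) (I := S)
    (c := fun a i => (weight ε s a.1 : ℂ) * gradSymbol a.1 i)
    (r := fun a => ((weight ε (s + 1) a.1 : ℝ) : ℂ)) (C := 7 / ε) (by positivity)
    (fun a i => norm_weight_mul_le hε s (by norm_num) (norm_gradSymbol_le a.1 i)) F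
  rw [← h1] at h2
  exact h2.trans (mul_le_mul_of_nonneg_right (seven_mul_sqrt_le hε hε1) (norm_nonneg _))

theorem norm_weightOp_normalSymbol_le {ε : ℝ} (hε : 0 < ε) (hε1 : ε ≤ 1) (s : ℕ)
    (F : EuclideanSpace ℂ (S × Fin d × Fin m)) :
    ‖weightOp S (Fin d × Fin m) ε s (diagOp (fun x => pb.normalSymbol x.1.1) F)‖ ≤
      7 * (d + 1) / ε ^ 2 * ‖weightOp S (Fin d × Fin m) ε (s + 1) F‖ := by
  have h1 : weightOp S (Fin d × Fin m) ε s (diagOp (fun x => pb.normalSymbol x.1.1) F) =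
      diagOp (fun x => (weight ε s x.1.1 : ℂ) * pb.normalSymbol x.1.1) F := by
    ext x
    simp only [weightOp_apply, diagOp_apply]
    ring
  have h3 : 7 * d / ε ≤ 7 * (d + 1) / ε ^ 2 := by
    gcongr
    · linarith
    · nlinarith
  have h2 := norm_diagOp_le (J := S × Fin d × Fin m)
    (c := fun x => (weight ε s x.1.1 : ℂ) * pb.normalSymbol x.1.1)
    (c' := fun x => ((weight ε (s + 1) x.1.1 : ℝ) : ℂ)) (C := 7 * (d + 1) / ε ^ 2) (by positivity)
    (fun x => (norm_weight_mul_le hε s (by positivity) (pb.norm_normalSymbol_le x.1.1)).trans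
      (mul_le_mul_of_nonneg_right h3 (norm_nonneg _))) F
  rw [← h1] at h2
  exact h2

set_option maxHeartbeats 1000000 in
/-- The Galerkin system with modes in `S`. -/
def system (S : Finset (Fin d → ℤ)) {p : ℕ} {SA Sg : ℝ} (hA : MomentLE p (tensorCoeff pb.A) SA)
    (hg : MomentLE (p + 1) (vectorCoeff pb.g) Sg) :
    GalerkinSystem (EuclideanSpace ℂ (S × Fin m)) (EuclideanSpace ℂ (S × Fin d × Fin m)) p
      (pb.μ / 2) (d * m * SA) (7 * (d + 1) / smallParam d m pb.μ SA ^ 2)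
      (14 * (d + 1) * m * Sg) pb.κ where
  G := gradOp S
  N := pb.normalOp S
  Nt := pb.normalCompOp S
  Dv := divOp S
  dn := diagOp fun x => pb.normalSymbol x.1.1
  A := kernelOp (pb.kernel S)
  W := weightOp S (Fin m) (smallParam d m pb.μ SA)
  V := weightOp S (Fin d × Fin m) (smallParam d m pb.μ SA)
  E := meanOp S
  h := pb.datum S
  inner_N F w := by
    rw [normalOp, inner_spreadOp]
    simp only [Complex.conj_ofReal]
    rfl
  Nt_N w := by
    ext x
    simp only [normalOp, normalCompOp, contractOp_apply, spreadOp_apply, ← mul_assoc]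
    rw [← Finset.sum_mul, sum_n_sq, one_mul]
  inner_G F w := by
    rw [gradOp, inner_spreadOp, ← inner_neg_left]
    congr 1
    ext x
    simp only [divOp, PiLp.neg_apply, contractOp_apply, conj_gradSymbol, neg_mul,
      Finset.sum_neg_distrib]
  skew w := by
    rw [real_inner_eq_sum]
    refine Finset.sum_eq_zero fun x _ => ?_
    rw [normalCompOp_gradOp_apply, normalSymbol_eq]
    have : 2 * Real.pi * Complex.I * ∑ i, (pb.n i : ℂ) * (x.1.1 i : ℂ) =
        ((2 * Real.pi * ∑ i, pb.n i * (x.1.1 i : ℝ) : ℝ) : ℂ) * Complex.I := by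
      push_cast; ring
    rw [this]
    simp [Complex.mul_re, Complex.mul_im]
    ring
  dn_G v := by
    ext x
    simp only [gradOp, diagOp_apply, spreadOp_apply]
    change _ = _ * pb.normalCompOp S (gradOp S v) (x.1, x.2.2)
    rw [normalCompOp_gradOp_apply]
    ring
  dn_N v := by
    ext x
    simp only [normalOp, diagOp_apply, spreadOp_apply]
    rw [normalCompOp_gradOp_apply]
    ring
  W_symm s x y := inner_diagOp (fun x : S × Fin m => weight _ s x.1.1) x y
  V_symm s x y := inner_diagOp (fun x : S × Fin d × Fin m => weight _ s x.1.1) x y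
  V_G s v := by
    ext x
    simp only [gradOp, weightOp_apply, spreadOp_apply]
    ring
  V_N s v := by
    ext x
    simp only [normalOp, weightOp_apply, spreadOp_apply]
    ring
  W_Nt s F := by
    ext x
    simp only [normalCompOp, weightOp_apply, contractOp_apply, Finset.mul_sum]
    exact Finset.sum_congr rfl fun i _ => by ring
  norm_V_mono s F := by
    have hε := pb.eps_pos hA.nonneg
    exact norm_weightOp_mono hε.le s F
  norm_V_G s v := norm_weightOp_gradOp_le (pb.eps_pos hA.nonneg) (pb.eps_le_one SA) s v
  norm_V_dn s F := pb.norm_weightOp_normalSymbol_le (pb.eps_pos hA.nonneg) (pb.eps_le_one SA) s F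
  norm_W_Dv s F := norm_weightOp_divOp_le (pb.eps_pos hA.nonneg) (pb.eps_le_one SA) s F
  V_zero F := by
    ext x
    simp [weightOp_apply, weight]
  E_symm x y := inner_diagOp (fun x : S × Fin m => if x.1.1 = 0 then 1 else 0) x y
  norm_E v := by
    have h1 : ‖v‖ = 1 * ‖diagOp (fun _ : S × Fin m => (1 : ℂ)) v‖ := by
      rw [one_mul]; congr 1; ext x; simp
    rw [h1]
    refine norm_diagOp_le zero_le_one (fun x => ?_) v
    split_ifs <;> simp
  W_E s v := by
    ext x
    simp only [meanOp, weightOp_apply, diagOp_apply]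
    split_ifs with h
    · simp [weight, h]
    · simp
  G_E v := by
    ext x
    simp only [gradOp, meanOp, spreadOp_apply, diagOp_apply]
    split_ifs with h
    · simp [gradSymbol, h]
    · simp
  E_Nt_G v := by
    ext x
    simp only [meanOp, diagOp_apply, normalCompOp_gradOp_apply]
    split_ifs with h
    · simp [normalSymbol, gradSymbol, h]
    · simp
  E_h := by
    ext x
    simp only [meanOp, diagOp_apply, datum_apply]
    split_ifs with h
    · simp [h]
    · simp
  coercive s hs F := pb.coercive_weightOp_kernelOp S hA hs F
  bounded s hs F := pb.norm_weightOp_kernelOp_le S hA hs (pb.eps_pos hA.nonneg).le (pb.eps_le_one SA) F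
  diophantine s v q := pb.norm_weightOp_sub_meanOp_le (pb.eps_pos hA.nonneg) s v q
  datum_left s hs v q := by
    refine pb.abs_inner_datum_le hg hs (pb.eps_pos hA.nonneg).le (pb.eps_le_one SA) v _ fun x => ?_
    simp only [gradOp_sub_normalOp]
    refine (norm_tangential_left_le x.1.1 (v x) (q x) pb.norm_T pb.inner_T_n).trans ?_
    refine le_mul_of_one_le_left (Real.sqrt_nonneg _) ?_
    have h1 := norm_nonneg x.1.1
    have h2 := Nat.cast_nonneg (α := ℝ) d
    nlinarith [mul_nonneg h2 h1]
  datum_right s hs v q := by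
    refine pb.abs_inner_datum_le hg hs (pb.eps_pos hA.nonneg).le (pb.eps_le_one SA) q _ fun x => ?_
    simp only [gradOp_sub_normalOp]
    refine (norm_tangential_right_le x.1.1 (v x) (q x) pb.norm_n pb.norm_T pb.inner_T_n).trans ?_
    gcongr
    · linarith
    · linarith
  c_pos := half_pos pb.μ_pos
  B_nonneg := by have := hA.nonneg; positivity
  D_nonneg := by have := pb.eps_pos hA.nonneg; positivity
  H_nonneg := by have := hg.nonneg; positivity
  κ_pos := pb.κ_pos
  κ_le_one := pb.diophantine.le_one pb.two_le pb.norm_n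

end NeumannData

end

/-! ### From Fourier profiles to functions on the half-space -/

section

open scoped RealInnerProductSpace

variable {d m : ℕ}

/-- Derivatives of a function of one variable composed with an affine functional. -/
theorem norm_iteratedFDeriv_comp_affine_le {E : Type*} [NormedAddCommGroup E] [NormedSpace ℝ E]
    {φ : ℝ → ℂ} (hφ : ContDiff ℝ ∞ φ) (L : E →L[ℝ] ℝ) (b : ℝ) {M : ℝ} (hL : ‖L‖ ≤ M) (k : ℕ) (x : E) :
    ‖iteratedFDeriv ℝ k (fun y => φ (L y + b)) x‖ ≤ M ^ k * ‖iteratedDeriv k φ (L x + b)‖ := by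
  have h1 : ContDiff ℝ ∞ fun s => φ (s + b) := hφ.comp (contDiff_id.add contDiff_const)
  have h2 := L.iteratedFDeriv_comp_right h1 x (i := k) (by exact_mod_cast le_top)
  have h3 : (fun y => φ (L y + b)) = (fun s => φ (s + b)) ∘ L := rfl
  rw [h3, h2]
  refine (ContinuousMultilinearMap.norm_compContinuousLinearMap_le _ _).trans ?_
  rw [iteratedFDeriv_comp_add_right, norm_iteratedFDeriv_eq_norm_iteratedDeriv, mul_comm]
  gcongr
  simp only [Finset.prod_const, Finset.card_univ, Fintype.card_fin]
  gcongr

theorem iteratedDeriv_cexp_mul (c : ℂ) (k : ℕ) :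
    iteratedDeriv k (fun s : ℝ => Complex.exp (c * s)) = fun s : ℝ => c ^ k * Complex.exp (c * s) := by
  induction k with
  | zero => simp
  | succ k ih =>
    rw [iteratedDeriv_succ, ih]
    funext s
    have h1 : HasDerivAt (fun s : ℝ => c * (s : ℂ)) c s := by
      simpa using (Complex.ofRealCLM.hasDerivAt (x := s)).const_mul c
    rw [(h1.cexp.const_mul (c ^ k)).deriv]
    ring

theorem norm_iteratedFDeriv_wave_le (ζ : Fin d → ℤ) (k : ℕ) (x : EuclideanSpace ℝ (Fin d)) :
    ‖iteratedFDeriv ℝ k (wave ζ) x‖ ≤ (7 * d * ‖ζ‖) ^ k := by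
  let L : EuclideanSpace ℝ (Fin d) →L[ℝ] ℝ := ∑ i, (ζ i : ℝ) • EuclideanSpace.proj i
  have hL : ‖L‖ ≤ d * ‖ζ‖ := by
    calc ‖L‖ ≤ ∑ i : Fin d, ‖(ζ i : ℝ) • (EuclideanSpace.proj i : EuclideanSpace ℝ (Fin d) →L[ℝ] ℝ)‖ :=
          norm_sum_le _ _
      _ ≤ ∑ _i : Fin d, ‖ζ‖ * 1 := by
          refine Finset.sum_le_sum fun i _ => ?_
          rw [norm_smul]
          refine mul_le_mul ?_ ?_ (norm_nonneg _) (norm_nonneg _)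
          · rw [Real.norm_eq_abs, ← Int.norm_eq_abs]; exact norm_le_pi_norm ζ i
          · refine ContinuousLinearMap.opNorm_le_bound _ zero_le_one fun y => ?_
            rw [one_mul]; exact PiLp.norm_apply_le y i
      _ = d * ‖ζ‖ := by simp
  have h1 : wave ζ = fun y => (fun s : ℝ => Complex.exp (2 * Real.pi * Complex.I * s)) (L y + 0) := by
    funext y
    simp only [wave, add_zero, L]
    congr 2
    simp
  have hφ : ContDiff ℝ ∞ (fun s : ℝ => Complex.exp (2 * Real.pi * Complex.I * s)) :=
    Complex.contDiff_exp.comp (contDiff_const.mul Complex.ofRealCLM.contDiff)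
  rw [h1]
  refine (norm_iteratedFDeriv_comp_affine_le hφ L 0 hL k x).trans ?_
  rw [iteratedDeriv_cexp_mul]
  have h2 : ‖Complex.exp (2 * Real.pi * Complex.I * ((L x + 0 : ℝ) : ℂ))‖ = 1 := by
    have : 2 * Real.pi * Complex.I * ((L x + 0 : ℝ) : ℂ) =
      ((2 * Real.pi * (L x + 0) : ℝ) : ℂ) * Complex.I := by push_cast; ring
    rw [this, Complex.norm_exp_ofReal_mul_I]
  rw [norm_mul, h2, mul_one, norm_pow, ← mul_pow]
  have h3 : ‖(2 * Real.pi * Complex.I : ℂ)‖ ≤ 7 := by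
    simp only [norm_mul, Complex.norm_I, Complex.norm_real, Complex.norm_ofNat, mul_one]
    rw [Real.norm_of_nonneg Real.pi_pos.le]
    linarith [Real.pi_lt_d2]
  refine pow_le_pow_left₀ (by positivity) ?_ k
  calc d * ‖ζ‖ * ‖(2 * Real.pi * Complex.I : ℂ)‖ ≤ d * ‖ζ‖ * 7 := by gcongr
    _ = _ := by ring

/-- The distance to the boundary hyperplane. -/
def depth (n : EuclideanSpace ℝ (Fin d)) (a : ℝ) (x : EuclideanSpace ℝ (Fin d)) : ℝ :=
  -(inner ℝ x n + a)

/-- The quasi-periodic function on the half-space with Fourier profile `G`. -/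
def synth {S : Finset (Fin d → ℤ)} {P : Type} [Fintype P] (n : EuclideanSpace ℝ (Fin d)) (a : ℝ)
    (G : ℝ → EuclideanSpace ℂ (S × P)) (q : P) (x : EuclideanSpace ℝ (Fin d)) : ℂ :=
  ∑ ζ : S, G (depth n a x) (ζ, q) * wave ζ.1 x

section Synth

variable {S : Finset (Fin d → ℤ)} {P : Type} [Fintype P] (n : EuclideanSpace ℝ (Fin d)) (a : ℝ)
  {G : ℝ → EuclideanSpace ℂ (S × P)}

theorem hasFDerivAt_depth (x : EuclideanSpace ℝ (Fin d)) :
    HasFDerivAt (depth n a) (-(innerSL ℝ n)) x := by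
  have h := ((innerSL ℝ n).hasFDerivAt (x := x)).add_const a
  have h2 := h.neg
  refine h2.congr_of_eventuallyEq (Filter.Eventually.of_forall fun y => ?_)
  simp [depth, real_inner_comm]

/-- A coordinate as a real-linear functional. -/
def coordCLM (J : Type) [Fintype J] (x : J) : EuclideanSpace ℂ J →L[ℝ] ℂ :=
  (EuclideanSpace.proj (𝕜 := ℂ) x).restrictScalars ℝ

theorem contDiff_coord (hG : ContDiff ℝ ∞ G) (x : S × P) : ContDiff ℝ ∞ fun t => G t x :=
  (coordCLM (S × P) x).contDiff.comp hG

theorem hasDerivAt_coord (hG : ContDiff ℝ ∞ G) (x : S × P) (t : ℝ) :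
    HasDerivAt (fun t => G t x) (deriv G t x) t :=
  (coordCLM (S × P) x).hasFDerivAt.comp_hasDerivAt t
    (hG.differentiable (by simp) t).hasDerivAt

theorem iteratedDeriv_coord (hG : ContDiff ℝ ∞ G) (x : S × P) (k : ℕ) :
    iteratedDeriv k (fun t => G t x) = fun t => (deriv^[k] G t) x := by
  induction k generalizing G with
  | zero => simp
  | succ k ih =>
    rw [iteratedDeriv_succ', funext fun t => (hasDerivAt_coord hG x t).deriv,
      ih (GalerkinSystem.contDiff_deriv hG)]
    rfl

theorem contDiff_depth : ContDiff ℝ ∞ (depth n a) :=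
  ((contDiff_id.inner ℝ contDiff_const).add contDiff_const).neg

theorem contDiff_synth (hG : ContDiff ℝ ∞ G) (q : P) : ContDiff ℝ ∞ (synth n a G q) :=
  ContDiff.sum fun ζ _ =>
    ((contDiff_coord hG (ζ, q)).comp (contDiff_depth n a)).mul (contDiff_wave ζ.1)

/-- The depth has gradient `-n`, so the chain rule produces the lifted gradient `∇_y - n ∂_t` on the
profile. -/
theorem fderiv_synth (hG : ContDiff ℝ ∞ G) (q : P) (x : EuclideanSpace ℝ (Fin d)) (j : Fin d) :
    fderiv ℝ (synth n a G q) x (EuclideanSpace.single j 1) =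
      ∑ ζ : S, (gradSymbol ζ.1 j * G (depth n a x) (ζ, q) -
        (n j : ℂ) * (deriv G (depth n a x)) (ζ, q)) * wave ζ.1 x := by
  have h0 : ∀ ζ : S, HasFDerivAt (fun x => G (depth n a x) (ζ, q))
      ((deriv G (depth n a x)) (ζ, q) • (-(innerSL ℝ n)).smulRight (1 : ℂ)) x := fun ζ => by
    have h := (hasDerivAt_coord hG (ζ, q) (depth n a x)).hasFDerivAt.comp x
      (hasFDerivAt_depth n a x)
    refine h.congr_fderiv ?_
    ext y
    simp [mul_comm]
  have h1 : ∀ ζ : S, HasFDerivAt (fun x => G (depth n a x) (ζ, q) * wave ζ.1 x) _ x := fun ζ =>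
    (h0 ζ).fun_mul ((contDiff_wave ζ.1).differentiable (by simp) x).hasFDerivAt
  have h2 := HasFDerivAt.fun_sum fun ζ (_ : ζ ∈ Finset.univ) => h1 ζ
  have h3 : fderiv ℝ (synth n a G q) x = _ := h2.fderiv
  rw [h3]
  simp only [sum_apply, add_apply, smul_apply, smul_eq_mul, fderiv_wave]
  refine Finset.sum_congr rfl fun ζ _ => ?_
  have h4 : ∑ i, (ζ.1 i : ℂ) * (((EuclideanSpace.single j (1 : ℝ) : EuclideanSpace ℝ (Fin d)) i : ℝ) : ℂ)
      = ζ.1 j := by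
    rw [Finset.sum_eq_single j] <;> simp +contextual
  rw [h4, gradSymbol]
  simp [EuclideanSpace.inner_single_right]
  ring

/-- Leibniz rule: `i` derivatives fall on the profile through the depth, and `k - i` on the
character, each of these giving a factor of order `‖ζ‖`. -/
theorem norm_iteratedFDeriv_synth_le (hn : ‖n‖ = 1) (hG : ContDiff ℝ ∞ G) (q : P) (k : ℕ)
    (x : EuclideanSpace ℝ (Fin d)) :
    ‖iteratedFDeriv ℝ k (synth n a G q) x‖ ≤ ∑ i ∈ Finset.range (k + 1), ∑ ζ : S, (k.choose i : ℝ) *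
      ‖(deriv^[i] G (depth n a x)) (ζ, q)‖ * (7 * d * ‖ζ.1‖) ^ (k - i) := by
  have hterm : ∀ ζ : S, ContDiff ℝ ∞ fun x => G (depth n a x) (ζ, q) := fun ζ =>
    (contDiff_coord hG (ζ, q)).comp (contDiff_depth n a)
  have hsum : iteratedFDeriv ℝ k (synth n a G q) x =
      ∑ ζ : S, iteratedFDeriv ℝ k (fun x => G (depth n a x) (ζ, q) * wave ζ.1 x) x := by
    have := iteratedFDeriv_sum (𝕜 := ℝ) (i := k) (u := (Finset.univ : Finset S))
      (f := fun ζ x => G (depth n a x) (ζ, q) * wave ζ.1 x)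
      (fun ζ _ => ((hterm ζ).mul (contDiff_wave ζ.1)).of_le (by exact_mod_cast le_top))
    have h2 := congrFun this x
    simp only [Finset.sum_apply] at h2
    exact h2
  rw [hsum, Finset.sum_comm]
  refine (norm_sum_le _ _).trans (Finset.sum_le_sum fun ζ _ => ?_)
  refine (norm_iteratedFDeriv_mul_le (hterm ζ) (contDiff_wave ζ.1) x
    (by exact_mod_cast le_top)).trans (Finset.sum_le_sum fun i _ => ?_)
  gcongr
  · have h1 := norm_iteratedFDeriv_comp_affine_le (contDiff_coord hG (ζ, q))
      (-(innerSL ℝ n)) (-a) (M := 1) (by rw [norm_neg, innerSL_apply_norm, hn]) i x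
    rw [one_pow, one_mul, iteratedDeriv_coord hG] at h1
    have h2 : ∀ y, (-(innerSL ℝ n)) y + -a = depth n a y := fun y => by
      simp [depth, real_inner_comm]; ring
    simpa only [h2] using h1
  · exact norm_iteratedFDeriv_wave_le ζ.1 (k - i) x

end Synth

end

/-! ### Derivatives of the approximate solutions in terms of weighted norms -/

section

open scoped RealInnerProductSpace

variable {d m : ℕ}

open NeumannData

/-- The triangle inequality for the derivatives of a sum. -/
theorem norm_iteratedFDeriv_sum_le {E F ι : Type*} [NormedAddCommGroup E] [NormedSpace ℝ E]
    [NormedAddCommGroup F] [NormedSpace ℝ F] [Fintype ι] {f : ι → E → F}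
    (hf : ∀ i, ContDiff ℝ ∞ (f i)) (k : ℕ) (x : E) :
    ‖iteratedFDeriv ℝ k (fun y => ∑ i, f i y) x‖ ≤ ∑ i, ‖iteratedFDeriv ℝ k (f i) x‖ := by
  have h := congrFun (iteratedFDeriv_sum (𝕜 := ℝ) (i := k) (u := (Finset.univ : Finset ι))
    (f := f) (fun i _ => (hf i).of_le (by exact_mod_cast le_top))) x
  rw [Finset.sum_apply] at h
  rw [h]
  exact norm_sum_le _ _

section WeightedSums

variable {S : Finset (Fin d → ℤ)} {P : Type} [Fintype P]

theorem norm_mul_weight_le_norm_weightOp {ε : ℝ} (hε : 0 ≤ ε) (s : ℕ) (F : EuclideanSpace ℂ (S × P))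
    (x : S × P) : ‖F x‖ * weight ε s x.1.1 ≤ ‖weightOp S P ε s F‖ := by
  have h := PiLp.norm_apply_le (weightOp S P ε s F) x
  rwa [weightOp_apply, norm_mul, Complex.norm_real, Real.norm_of_nonneg (weight_pos hε _ _).le,
    mul_comm] at h

/-- A crude Sobolev embedding: each coefficient is bounded by the whole norm, and `2 * d` extra
orders make the sum over frequencies converge, uniformly in `S`. -/
theorem sum_norm_mul_weight_le {ε : ℝ} (hε : 0 < ε) (hε1 : ε ≤ 1) (s : ℕ)
    (F : EuclideanSpace ℂ (S × P)) (q : P) :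
    ∑ ζ : S, ‖F (ζ, q)‖ * weight ε s ζ.1 ≤
      weightSum d / ε ^ (2 * d) * ‖weightOp S P ε (s + 2 * d) F‖ := by
  set K := ‖weightOp S P ε (s + 2 * d) F‖ with hK
  have hK0 : 0 ≤ K := norm_nonneg _
  have h1 : ∀ ζ : S, ‖F (ζ, q)‖ * weight ε s ζ.1 ≤
      K / ε ^ (2 * d) * (((1 : ℝ) + ‖ζ.1‖) ^ (2 * d))⁻¹ := by
    intro ζ
    have hn := norm_nonneg ζ.1
    have e1 := norm_mul_weight_le_norm_weightOp hε.le (s + 2 * d) F (ζ, q)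
    have e2 : ε ^ (2 * d) * (1 + ‖ζ.1‖) ^ (2 * d) ≤ weight ε (2 * d) ζ.1 := by
      rw [← mul_pow, weight]
      gcongr
      nlinarith
    have e3 : weight ε (s + 2 * d) ζ.1 = weight ε s ζ.1 * weight ε (2 * d) ζ.1 := pow_add _ _ _
    have hw := (weight_pos hε.le s ζ.1).le
    rw [div_mul_eq_mul_div, ← div_eq_mul_inv, div_div, le_div_iff₀ (by positivity)]
    refine le_trans ?_ e1
    rw [e3]
    calc _ = ‖F (ζ, q)‖ * (weight ε s ζ.1 * (ε ^ (2 * d) * (1 + ‖ζ.1‖) ^ (2 * d))) := by ring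
      _ ≤ _ := by gcongr
  refine (Finset.sum_le_sum fun ζ _ => h1 ζ).trans ?_
  rw [← Finset.mul_sum, Finset.sum_coe_sort S fun a => (((1 : ℝ) + ‖a‖) ^ (2 * d))⁻¹]
  have h2 : ∑ a ∈ S, (((1 : ℝ) + ‖a‖) ^ (2 * d))⁻¹ ≤ weightSum d :=
    (summable_weight d).sum_le_tsum _ fun _ _ => by positivity
  calc _ ≤ K / ε ^ (2 * d) * weightSum d := by gcongr
    _ = _ := by ring

theorem pow_norm_le_weight {ε : ℝ} (hε : 0 < ε) (r : ℕ) (ζ : Fin d → ℤ) :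
    ‖ζ‖ ^ r ≤ (1 / ε) ^ r * weight ε r ζ := by
  rw [weight, ← mul_pow]
  gcongr
  rw [mul_add, ← mul_assoc, one_div_mul_cancel hε.ne', one_mul]
  have : 0 ≤ 1 / ε * 1 := by positivity
  linarith

theorem norm_iteratedFDeriv_synth_le_weightOp {n : EuclideanSpace ℝ (Fin d)} (a : ℝ) (hn : ‖n‖ = 1)
    {G : ℝ → EuclideanSpace ℂ (S × P)} (hG : ContDiff ℝ ∞ G) (q : P) {ε : ℝ} (hε : 0 < ε)
    (hε1 : ε ≤ 1) (k : ℕ) (x : EuclideanSpace ℝ (Fin d)) :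
    ‖iteratedFDeriv ℝ k (synth n a G q) x‖ ≤
      ∑ i ∈ Finset.range (k + 1), (k.choose i : ℝ) * (7 * d / ε) ^ (k - i) *
        (weightSum d / ε ^ (2 * d)) *
          ‖weightOp S P ε (k - i + 2 * d) (deriv^[i] G (depth n a x))‖ := by
  refine (norm_iteratedFDeriv_synth_le n a hn hG q k x).trans (Finset.sum_le_sum fun i _ => ?_)
  set F := deriv^[i] G (depth n a x)
  calc _ ≤ ∑ ζ : S, (k.choose i : ℝ) * (7 * d / ε) ^ (k - i) *
        (‖F (ζ, q)‖ * weight ε (k - i) ζ.1) := by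
        refine Finset.sum_le_sum fun ζ _ => ?_
        have h1 := pow_norm_le_weight hε (k - i) ζ.1
        rw [mul_pow]
        calc _ ≤ (k.choose i : ℝ) * ‖F (ζ, q)‖ * ((7 * d) ^ (k - i) *
              ((1 / ε) ^ (k - i) * weight ε (k - i) ζ.1)) := by gcongr
          _ = _ := by rw [div_eq_mul_one_div (7 * (d : ℝ)), mul_pow (7 * (d : ℝ)) (1 / ε)]; ring
    _ = (k.choose i : ℝ) * (7 * d / ε) ^ (k - i) * ∑ ζ : S, ‖F (ζ, q)‖ * weight ε (k - i) ζ.1 := by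
        rw [Finset.mul_sum]
    _ ≤ (k.choose i : ℝ) * (7 * d / ε) ^ (k - i) * (weightSum d / ε ^ (2 * d) *
          ‖weightOp S P ε (k - i + 2 * d) F‖) := by
        gcongr
        exact sum_norm_mul_weight_le hε hε1 (k - i) F q
    _ = _ := by ring

theorem norm_synth_le {n : EuclideanSpace ℝ (Fin d)} (a : ℝ) (G : ℝ → EuclideanSpace ℂ (S × P))
    (q : P) {ε : ℝ} (hε : 0 < ε) (hε1 : ε ≤ 1) (x : EuclideanSpace ℝ (Fin d)) :
    ‖synth n a G q x‖ ≤
      weightSum d / ε ^ (2 * d) * ‖weightOp S P ε (2 * d) (G (depth n a x))‖ := by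
  have h := sum_norm_mul_weight_le hε hε1 0 (G (depth n a x)) q
  rw [zero_add] at h
  refine le_trans ?_ h
  refine (norm_sum_le _ _).trans (Finset.sum_le_sum fun ζ _ => ?_)
  rw [norm_mul, norm_wave, weight, pow_zero]

end WeightedSums

namespace NeumannData

variable (pb : NeumannData d m) {S : Finset (Fin d → ℤ)}

/-- The Fourier profile of the gradient of the function with Fourier profile `v`. -/
def gradient (v : ℝ → EuclideanSpace ℂ (S × Fin m)) (t : ℝ) :
    EuclideanSpace ℂ (S × Fin d × Fin m) :=
  gradOp S (v t) - pb.normalOp S (deriv v t)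

/-- The Galerkin problem on the slab of width `R`. -/
structure IsGalerkin (R : ℝ) (v : ℝ → EuclideanSpace ℂ (S × Fin m)) : Prop where
  smooth : ContDiff ℝ ∞ v
  weak : ∀ t w, ⟪kernelOp (pb.kernel S) (pb.gradient (deriv v) t), pb.normalOp S w⟫ =
    -⟪kernelOp (pb.kernel S) (pb.gradient v t), gradOp S w⟫
  one_le : 1 ≤ R
  neumann : ∀ w, ⟪kernelOp (pb.kernel S) (pb.gradient v 0), pb.normalOp S w⟫ = ⟪pb.datum S, w⟫
  dirichlet : v R = 0

variable {pb}

/-- `IsGalerkin` mentions neither the order `p` nor the parameter `ε`. The same curve therefore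
satisfies the estimates of all orders, and in the end one solution `u` serves all derivatives and
decay exponents. -/
theorem IsGalerkin.isBoundarySol {R : ℝ} {v : ℝ → EuclideanSpace ℂ (S × Fin m)}
    (hv : pb.IsGalerkin R v) {p : ℕ} {SA Sg : ℝ} (hA : MomentLE p (tensorCoeff pb.A) SA)
    (hg : MomentLE (p + 1) (vectorCoeff pb.g) Sg) : (pb.system S hA hg).IsBoundarySol R v :=
  ⟨⟨hv.smooth, hv.weak⟩, hv.one_le, hv.neumann, hv.dirichlet⟩

theorem contDiff_gradient {v : ℝ → EuclideanSpace ℂ (S × Fin m)} (hv : ContDiff ℝ ∞ v) :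
    ContDiff ℝ ∞ (pb.gradient v) :=
  ((gradOp S).contDiff.comp hv).sub
    ((pb.normalOp S).contDiff.comp (GalerkinSystem.contDiff_deriv hv))

theorem deriv_gradient {v : ℝ → EuclideanSpace ℂ (S × Fin m)} (hv : ContDiff ℝ ∞ v) :
    deriv (pb.gradient v) = pb.gradient (deriv v) := by
  funext t
  have h1 : HasDerivAt v (deriv v t) t := (hv.differentiable (by simp) t).hasDerivAt
  have h2 : HasDerivAt (deriv v) (deriv (deriv v) t) t :=
    ((GalerkinSystem.contDiff_deriv hv).differentiable (by simp) t).hasDerivAt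
  exact (((gradOp S).hasFDerivAt.comp_hasDerivAt t h1).sub
    ((pb.normalOp S).hasFDerivAt.comp_hasDerivAt t h2)).deriv

theorem iterate_deriv_gradient {v : ℝ → EuclideanSpace ℂ (S × Fin m)} (hv : ContDiff ℝ ∞ v) (k : ℕ) :
    deriv^[k] (pb.gradient v) = pb.gradient (deriv^[k] v) := by
  induction k generalizing v with
  | zero => rfl
  | succ k ih =>
    rw [Function.iterate_succ_apply, Function.iterate_succ_apply, deriv_gradient hv,
      ih (GalerkinSystem.contDiff_deriv hv)]

theorem fderiv_synth_eq (a : ℝ) {v : ℝ → EuclideanSpace ℂ (S × Fin m)} (hv : ContDiff ℝ ∞ v)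
    (β : Fin m) (x : EuclideanSpace ℝ (Fin d)) (j : Fin d) :
    fderiv ℝ (synth pb.n a v β) x (EuclideanSpace.single j 1) =
      synth pb.n a (pb.gradient v) (j, β) x := by
  rw [fderiv_synth _ _ hv]
  rfl

variable (pb)

/-- The real vector field with Fourier profile `v`. -/
def approx (a : ℝ) (v : ℝ → EuclideanSpace ℂ (S × Fin m)) (x : EuclideanSpace ℝ (Fin d)) :
    EuclideanSpace ℝ (Fin m) :=
  WithLp.toLp 2 fun β => (synth pb.n a v β x).re

theorem approx_apply (a : ℝ) (v : ℝ → EuclideanSpace ℂ (S × Fin m)) (x : EuclideanSpace ℝ (Fin d))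
    (β : Fin m) : pb.approx a v x β = (synth pb.n a v β x).re := rfl

variable {pb}

theorem contDiff_approx (a : ℝ) {v : ℝ → EuclideanSpace ℂ (S × Fin m)} (hv : ContDiff ℝ ∞ v) :
    ContDiff ℝ ∞ (pb.approx a v) := by
  refine contDiff_euclidean.2 fun β => ?_
  exact Complex.reCLM.contDiff.comp (contDiff_synth pb.n a hv β)

theorem fderiv_approx_apply (a : ℝ) {v : ℝ → EuclideanSpace ℂ (S × Fin m)} (hv : ContDiff ℝ ∞ v)
    (x : EuclideanSpace ℝ (Fin d)) (j : Fin d) (β : Fin m) :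
    fderiv ℝ (pb.approx a v) x (EuclideanSpace.single j 1) β =
      (synth pb.n a (pb.gradient v) (j, β) x).re := by
  have h1 : HasFDerivAt (fun y => pb.approx a v y β)
      ((EuclideanSpace.proj β).comp (fderiv ℝ (pb.approx a v) x)) x :=
    (EuclideanSpace.proj (𝕜 := ℝ) β).hasFDerivAt.comp x
      ((contDiff_approx a hv).differentiable (by simp) x).hasFDerivAt
  have h2 : HasFDerivAt (fun y => pb.approx a v y β)
      (Complex.reCLM.comp (fderiv ℝ (synth pb.n a v β) x)) x :=
    Complex.reCLM.hasFDerivAt.comp x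
      ((contDiff_synth pb.n a hv β).differentiable (by simp) x).hasFDerivAt
  have h3 := DFunLike.congr_fun (h1.unique h2) (EuclideanSpace.single j 1)
  have h4 := congrArg Complex.re (fderiv_synth_eq (pb := pb) a hv β x j)
  exact h3.trans h4

/-- The linear map `w ↦ w_j e_β`. -/
def unitMap (j : Fin d) (β : Fin m) : EuclideanSpace ℝ (Fin d) →L[ℝ] EuclideanSpace ℝ (Fin m) :=
  (EuclideanSpace.proj (𝕜 := ℝ) j).smulRight (EuclideanSpace.single β 1)

theorem norm_unitMap_le (j : Fin d) (β : Fin m) : ‖unitMap j β‖ ≤ 1 := by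
  refine ContinuousLinearMap.opNorm_le_bound _ zero_le_one fun y => ?_
  simp only [unitMap, ContinuousLinearMap.smulRight_apply, norm_smul, PiLp.norm_single, norm_one,
    mul_one, one_mul]
  exact PiLp.norm_apply_le y j

theorem fderiv_approx (a : ℝ) {v : ℝ → EuclideanSpace ℂ (S × Fin m)} (hv : ContDiff ℝ ∞ v) :
    fderiv ℝ (pb.approx a v) = fun x => ∑ q : Fin d × Fin m,
      (Complex.reCLM.smulRight (unitMap q.1 q.2)) (synth pb.n a (pb.gradient v) q x) := by
  funext x
  refine ContinuousLinearMap.coe_injective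
    ((EuclideanSpace.basisFun (Fin d) ℝ).toBasis.ext fun j => ?_)
  simp only [OrthonormalBasis.coe_toBasis, EuclideanSpace.basisFun_apply,
    ContinuousLinearMap.coe_coe]
  ext β
  rw [fderiv_approx_apply a hv, sum_apply, WithLp.ofLp_sum, Finset.sum_apply,
    Finset.sum_eq_single (j, β)]
  · simp [unitMap]
  · rintro ⟨i, γ⟩ - hne
    simp only [ContinuousLinearMap.smulRight_apply, smul_apply, unitMap, PiLp.smul_apply, smul_eq_mul]
    by_cases hi : i = j
    · have hγ : β ≠ γ := fun h => hne (by rw [hi, h])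
      simp [hγ]
    · simp [hi]
  · simp

/-- Derivatives of positive order are estimated through the profile of the gradient and not through
`v`, whose bound contains `1/κ`. -/
theorem norm_iteratedFDeriv_approx_le (a : ℝ) {v : ℝ → EuclideanSpace ℂ (S × Fin m)}
    (hv : ContDiff ℝ ∞ v) (k : ℕ) (x : EuclideanSpace ℝ (Fin d)) :
    ‖iteratedFDeriv ℝ (k + 1) (pb.approx a v) x‖ ≤ ∑ q : Fin d × Fin m,
      ‖iteratedFDeriv ℝ k (synth pb.n a (pb.gradient v) q) x‖ := by
  rw [← norm_iteratedFDeriv_fderiv, fderiv_approx a hv]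
  have hs : ∀ q : Fin d × Fin m, ContDiff ℝ ∞ (synth pb.n a (pb.gradient v) q) := fun q =>
    contDiff_synth pb.n a (contDiff_gradient hv) q
  refine (norm_iteratedFDeriv_sum_le
    (fun q => (ContinuousLinearMap.contDiff _).comp (hs q)) k x).trans
    (Finset.sum_le_sum fun q _ => ?_)
  have hL : ‖Complex.reCLM.smulRight (unitMap q.1 q.2)‖ ≤ 1 := by
    refine ContinuousLinearMap.opNorm_le_bound _ zero_le_one fun z => ?_
    rw [ContinuousLinearMap.smulRight_apply, norm_smul, one_mul]
    exact (mul_le_of_le_one_right (norm_nonneg _) (norm_unitMap_le _ _)).trans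
      (Complex.abs_re_le_norm z)
  refine (ContinuousLinearMap.norm_iteratedFDeriv_comp_left _ (N := ∞) (hs q).contDiffAt
    (by exact_mod_cast le_top)).trans ?_
  exact mul_le_of_le_one_left (norm_nonneg _) hL

end NeumannData

end

/-! ### Decay of the approximate solutions, with explicit constants -/

section

open scoped RealInnerProductSpace

variable {d m : ℕ}

open GalerkinSystem

/-- The constant in the decay estimate for the gradient. -/
def gradConst (d m : ℕ) (μ SA Sg : ℝ) (l : ℕ) : ℝ :=
  √(fluxConst (μ / 2) (d * m * SA) (7 * (d + 1) / smallParam d m μ SA ^ 2)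
    (14 * (d + 1) * m * Sg) (2 * l))

/-- The price of a normal derivative. -/
def normalConst (d m : ℕ) (μ SA : ℝ) : ℝ :=
  4 * (7 * (d + 1) / smallParam d m μ SA ^ 2) +
    5 * (7 * (d + 1) / smallParam d m μ SA ^ 2) * (d * m * SA) / (μ / 2)

/-- The constant in the bound for the derivatives of order `k + 1`. -/
def derivConst (d m : ℕ) (μ SA Sg : ℝ) (k l : ℕ) : ℝ :=
  d * m * ∑ i ∈ Finset.range (k + 1), (k.choose i : ℝ) * (7 * d / smallParam d m μ SA) ^ (k - i) *
    (weightSum d / smallParam d m μ SA ^ (2 * d)) * (normalConst d m μ SA ^ i * gradConst d m μ SA Sg l)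

/-- The constant in the bound for the solution. -/
def sizeConst (d m : ℕ) (μ SA Sg : ℝ) (l : ℕ) : ℝ :=
  m * (weightSum d / smallParam d m μ SA ^ (2 * d) *
    (gradConst d m μ SA Sg (l + 1) + 7 * (d + 1) / smallParam d m μ SA ^ 2 * gradConst d m μ SA Sg l))

namespace NeumannData

variable {pb : NeumannData d m} {S : Finset (Fin d → ℤ)} {R : ℝ}
  {v : ℝ → EuclideanSpace ℂ (S × Fin m)}

theorem IsGalerkin.norm_gradient_decay (hv : pb.IsGalerkin R v) {s k l : ℕ} {SA Sg : ℝ}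
    (hA : MomentLE (s + k + 1 + 4 * l) (tensorCoeff pb.A) SA)
    (hg : MomentLE (s + k + 1 + 4 * l + 1) (vectorCoeff pb.g) Sg) {t : ℝ} (ht0 : 0 ≤ t)
    (ht : t ≤ R) :
    ‖weightOp S (Fin d × Fin m) (smallParam d m pb.μ SA) s (deriv^[k] (pb.gradient v) t)‖ ≤
      normalConst d m pb.μ SA ^ k * gradConst d m pb.μ SA Sg l / (1 + pb.κ * t) ^ l := by
  rw [iterate_deriv_gradient hv.smooth]
  exact (hv.isBoundarySol hA hg).norm_flux_decay (s := s) (k := k) (l := l) le_rfl ht0 ht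

theorem IsGalerkin.norm_mean_le (hv : pb.IsGalerkin R v) {l : ℕ} (hl : 1 ≤ l) {SA Sg : ℝ}
    (hA : MomentLE (1 + 4 * (l + 1)) (tensorCoeff pb.A) SA)
    (hg : MomentLE (1 + 4 * (l + 1) + 1) (vectorCoeff pb.g) Sg) {t : ℝ} (ht0 : 0 ≤ t)
    (ht : t ≤ R) : ‖meanOp S (v t)‖ ≤ gradConst d m pb.μ SA Sg (l + 1) / (pb.κ * (1 + pb.κ * t) ^ l) :=
  (hv.isBoundarySol hA hg).norm_mean_decay hl le_rfl ht0 ht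

theorem IsGalerkin.norm_iteratedFDeriv_approx_decay (hv : pb.IsGalerkin R v) (a : ℝ) {k l : ℕ}
    {SA Sg : ℝ} (hA : MomentLE (k + 2 * d + 1 + 4 * l) (tensorCoeff pb.A) SA)
    (hg : MomentLE (k + 2 * d + 1 + 4 * l + 1) (vectorCoeff pb.g) Sg)
    {x : EuclideanSpace ℝ (Fin d)} (hx0 : 0 ≤ depth pb.n a x) (hx : depth pb.n a x ≤ R) :
    ‖iteratedFDeriv ℝ (k + 1) (pb.approx a v) x‖ ≤
      derivConst d m pb.μ SA Sg k l / (1 + pb.κ * depth pb.n a x) ^ l := by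
  have hε := pb.eps_pos hA.nonneg
  have hε1 := pb.eps_le_one SA
  have hW := weightSum_nonneg d
  refine (norm_iteratedFDeriv_approx_le a hv.smooth k x).trans ?_
  have hq : ∀ q : Fin d × Fin m, ‖iteratedFDeriv ℝ k (synth pb.n a (pb.gradient v) q) x‖ ≤
      (∑ i ∈ Finset.range (k + 1), (k.choose i : ℝ) * (7 * d / smallParam d m pb.μ SA) ^ (k - i) *
        (weightSum d / smallParam d m pb.μ SA ^ (2 * d)) *
          (normalConst d m pb.μ SA ^ i * gradConst d m pb.μ SA Sg l)) /
            (1 + pb.κ * depth pb.n a x) ^ l := by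
    intro q
    refine (norm_iteratedFDeriv_synth_le_weightOp a pb.norm_n (contDiff_gradient hv.smooth) q hε hε1
      k x).trans ?_
    rw [Finset.sum_div]
    refine Finset.sum_le_sum fun i hi => ?_
    have hik : i ≤ k := Nat.lt_succ_iff.1 (Finset.mem_range.1 hi)
    -- Normal and tangential derivatives cost the same: `i` of the former and `k - i` of the latter
    -- need an order that does not depend on `i`.
    have e : k - i + 2 * d + i + 1 + 4 * l = k + 2 * d + 1 + 4 * l := by omega
    have h1 := hv.norm_gradient_decay (s := k - i + 2 * d) (k := i) (l := l) (SA := SA) (Sg := Sg)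
      (by rw [e]; exact hA) (by rw [e]; exact hg) hx0 hx
    exact le_of_le_of_eq (mul_le_mul_of_nonneg_left h1 (by positivity)) (mul_div_assoc _ _ _).symm
  refine (Finset.sum_le_sum fun q _ => hq q).trans (le_of_eq ?_)
  rw [Finset.sum_const, Finset.card_univ, Fintype.card_prod, Fintype.card_fin, Fintype.card_fin,
    nsmul_eq_mul, derivConst]
  push_cast
  ring

theorem weightOp_meanOp (ε : ℝ) (s : ℕ) (w : EuclideanSpace ℂ (S × Fin m)) :
    weightOp S (Fin m) ε s (meanOp S w) = meanOp S w := by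
  ext x
  simp only [meanOp, weightOp_apply, diagOp_apply]
  split_ifs with h
  · simp [weight, h]
  · simp

theorem norm_approx_le (a : ℝ) (v : ℝ → EuclideanSpace ℂ (S × Fin m)) {ε : ℝ} (hε : 0 < ε)
    (hε1 : ε ≤ 1) (x : EuclideanSpace ℝ (Fin d)) :
    ‖pb.approx a v x‖ ≤ m * (weightSum d / ε ^ (2 * d) *
      ‖weightOp S (Fin m) ε (2 * d) (v (depth pb.n a x))‖) := by
  have h1 : pb.approx a v x =
      ∑ β : Fin m, EuclideanSpace.single β (synth pb.n a v β x).re := by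
    ext γ
    rw [approx_apply, WithLp.ofLp_sum, Finset.sum_apply, Finset.sum_eq_single γ] <;>
      simp +contextual [eq_comm]
  rw [h1]
  calc _ ≤ ∑ β : Fin m, ‖EuclideanSpace.single β (synth pb.n a v β x).re‖ := norm_sum_le _ _
    _ ≤ ∑ _β : Fin m, weightSum d / ε ^ (2 * d) *
        ‖weightOp S (Fin m) ε (2 * d) (v (depth pb.n a x))‖ := by
        refine Finset.sum_le_sum fun β _ => ?_
        rw [PiLp.norm_single]
        exact (Complex.abs_re_le_norm _).trans (norm_synth_le a v β hε hε1 x)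
    _ = _ := by simp

/-- Split `v` into its mean, bounded by integration from the far end, and the nonzero modes, bounded
by the gradient through the Diophantine condition. Each part costs exactly one factor `1/κ`. -/
theorem IsGalerkin.norm_approx_decay (hv : pb.IsGalerkin R v) (a : ℝ) {l : ℕ} (hl : 1 ≤ l)
    {SA Sg : ℝ} (hA : MomentLE (2 * d + 5 + 4 * l) (tensorCoeff pb.A) SA)
    (hg : MomentLE (2 * d + 5 + 4 * l + 1) (vectorCoeff pb.g) Sg)
    {x : EuclideanSpace ℝ (Fin d)} (hx0 : 0 ≤ depth pb.n a x) (hx : depth pb.n a x ≤ R) :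
    ‖pb.approx a v x‖ ≤
      sizeConst d m pb.μ SA Sg l / (pb.κ * (1 + pb.κ * depth pb.n a x) ^ l) := by
  have hε := pb.eps_pos hA.nonneg
  have hε1 := pb.eps_le_one SA
  have hκ := pb.κ_pos
  have hW := weightSum_nonneg d
  refine (norm_approx_le a v hε hε1 x).trans ?_
  set t := depth pb.n a x with ht
  set ε := smallParam d m pb.μ SA with hεdef
  have h1 := hv.norm_mean_le hl (hA.mono (by omega)) (hg.mono (by omega)) hx0 hx
  have h2 := hv.norm_gradient_decay (s := 2 * d + 2) (k := 0) (l := l)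
    (hA.mono (by omega)) (hg.mono (by omega)) hx0 hx
  rw [pow_zero, one_mul] at h2
  have h3 := pb.norm_weightOp_sub_meanOp_le hε (2 * d) (v t) (deriv v t)
  have h4 : ‖weightOp S (Fin m) ε (2 * d) (v t)‖ ≤
      (gradConst d m pb.μ SA Sg (l + 1) + 7 * (d + 1) / ε ^ 2 * gradConst d m pb.μ SA Sg l) /
        (pb.κ * (1 + pb.κ * t) ^ l) := by
    calc ‖weightOp S (Fin m) ε (2 * d) (v t)‖
        = ‖meanOp S (v t) + weightOp S (Fin m) ε (2 * d) (v t - meanOp S (v t))‖ := by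
          rw [map_sub, weightOp_meanOp]; congr 1; abel
      _ ≤ gradConst d m pb.μ SA Sg (l + 1) / (pb.κ * (1 + pb.κ * t) ^ l) + 7 * (d + 1) / ε ^ 2 / pb.κ *
          (gradConst d m pb.μ SA Sg l / (1 + pb.κ * t) ^ l) := by
          refine (norm_add_le _ _).trans (add_le_add h1 (h3.trans ?_))
          gcongr
          exact h2
      _ = _ := by
          have h5 : 0 < (1 + pb.κ * t) ^ l := by
            have := mul_nonneg hκ.le hx0
            positivity
          field_simp
  calc _ ≤ m * (weightSum d / ε ^ (2 * d) *
      ((gradConst d m pb.μ SA Sg (l + 1) + 7 * (d + 1) / ε ^ 2 * gradConst d m pb.μ SA Sg l) /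
        (pb.κ * (1 + pb.κ * t) ^ l))) := by gcongr
    _ = _ := by rw [sizeConst]; ring

/-- Solvability needs no regularity, so the system of order `p = 0` suffices. -/
theorem exists_isGalerkin (pb : NeumannData d m) (S : Finset (Fin d → ℤ)) {R : ℝ} (hR : 1 ≤ R) :
    ∃ v : ℝ → EuclideanSpace ℂ (S × Fin m), pb.IsGalerkin R v := by
  obtain ⟨K, hK⟩ := exists_ckNormLE pb.contDiff_A pb.periodic_A (0 + 2 * d)
  obtain ⟨K', hK'⟩ := exists_ckNormLE pb.contDiff_g pb.periodic_g (0 + 1 + 2 * d)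
  obtain ⟨v, hv⟩ := (pb.system S (momentLE_tensorCoeff pb.contDiff_A pb.periodic_A hK)
    (momentLE_vectorCoeff pb.contDiff_g pb.periodic_g hK')).exists_isBoundarySol hR
  exact ⟨v, hv.smooth, hv.weak, hv.one_le, hv.neumann, hv.dirichlet⟩

end NeumannData

end

/-! ### Moments, and Fourier expansion of `A∇u` and of its divergence -/

section

open scoped RealInnerProductSpace

variable {d m : ℕ}

section Moments

variable {s : ℕ} {b : (Fin d → ℤ) → ℂ} {B : ℝ}

theorem MomentLE.const_mul (h : MomentLE s b B) (c : ℂ) : MomentLE s (fun ξ => c * b ξ) (‖c‖ * B) := by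
  have e : (fun ξ => (1 + ‖ξ‖) ^ s * ‖c * b ξ‖) = fun ξ => ‖c‖ * ((1 + ‖ξ‖) ^ s * ‖b ξ‖) := by
    funext ξ; rw [norm_mul]; ring
  rw [MomentLE, e]
  refine ⟨h.1.mul_left _, ?_⟩
  rw [tsum_mul_left]
  exact mul_le_mul_of_nonneg_left h.2 (norm_nonneg c)

theorem MomentLE.of_le {V W : Type*} [SeminormedAddCommGroup V] [SeminormedAddCommGroup W]
    {s' : ℕ} {f : (Fin d → ℤ) → V} {f' : (Fin d → ℤ) → W} (h : MomentLE s f B)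
    (hle : ∀ ξ, (1 + ‖ξ‖) ^ s' * ‖f' ξ‖ ≤ (1 + ‖ξ‖) ^ s * ‖f ξ‖) : MomentLE s' f' B := by
  have h1 := Summable.of_nonneg_of_le (fun ξ => by positivity) hle h.1
  exact ⟨h1, (Summable.tsum_le_tsum hle h1 h.1).trans h.2⟩

theorem MomentLE.sum {ι : Type*} [Fintype ι] {b : ι → (Fin d → ℤ) → ℂ} {B : ι → ℝ}
    (h : ∀ i, MomentLE s (b i) (B i)) : MomentLE s (fun ξ => ∑ i, b i ξ) (∑ i, B i) := by
  have h1 : Summable fun ξ => ∑ i, (1 + ‖ξ‖) ^ s * ‖b i ξ‖ := summable_sum fun i _ => (h i).1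
  have hle : ∀ ξ, (1 + ‖ξ‖) ^ s * ‖∑ i, b i ξ‖ ≤ ∑ i, (1 + ‖ξ‖) ^ s * ‖b i ξ‖ := fun ξ => by
    rw [← Finset.mul_sum]
    gcongr
    exact norm_sum_le _ _
  have h2 := Summable.of_nonneg_of_le (fun ξ => by positivity) hle h1
  refine ⟨h2, (Summable.tsum_le_tsum hle h2 h1).trans ?_⟩
  rw [Summable.tsum_finsetSum fun i _ => (h i).1]
  exact Finset.sum_le_sum fun i _ => (h i).2

theorem MomentLE.sub {b' : (Fin d → ℤ) → ℂ} {B' : ℝ} (h : MomentLE s b B) (h' : MomentLE s b' B') :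
    MomentLE s (fun ξ => b ξ - b' ξ) (B + B') := by
  have hle : ∀ ξ, (1 + ‖ξ‖) ^ s * ‖b ξ - b' ξ‖ ≤ (1 + ‖ξ‖) ^ s * ‖b ξ‖ + (1 + ‖ξ‖) ^ s * ‖b' ξ‖ :=
    fun ξ => by
      rw [← mul_add]
      gcongr
      exact norm_sub_le _ _
  have h2 := Summable.of_nonneg_of_le (fun ξ => by positivity) hle (h.1.add h'.1)
  refine ⟨h2, (Summable.tsum_le_tsum hle h2 (h.1.add h'.1)).trans ?_⟩
  rw [h.1.tsum_add h'.1]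
  exact add_le_add h.2 h'.2

theorem MomentLE.shift (h : MomentLE s b B) (ζ : Fin d → ℤ) :
    MomentLE s (fun ξ => b (ξ - ζ)) ((1 + ‖ζ‖) ^ s * B) := by
  have hle : ∀ ξ, (1 + ‖ξ‖) ^ s * ‖b (ξ - ζ)‖ ≤
      (1 + ‖ζ‖) ^ s * ((1 + ‖ξ - ζ‖) ^ s * ‖b (ξ - ζ)‖) := fun ξ => by
    rw [← mul_assoc, ← mul_pow]
    gcongr
    have h1 : ‖ξ‖ ≤ ‖ξ - ζ‖ + ‖ζ‖ := by simpa using norm_add_le (ξ - ζ) ζ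
    nlinarith [norm_nonneg ζ, norm_nonneg (ξ - ζ)]
  have h1 : Summable fun ξ => (1 + ‖ζ‖) ^ s * ((1 + ‖ξ - ζ‖) ^ s * ‖b (ξ - ζ)‖) :=
    ((Equiv.subRight ζ).summable_iff.2 h.1).mul_left _
  have h2 := Summable.of_nonneg_of_le (fun ξ => by positivity) hle h1
  refine ⟨h2, (Summable.tsum_le_tsum hle h2 h1).trans ?_⟩
  rw [tsum_mul_left]
  have h3 := (Equiv.subRight ζ).tsum_eq fun ξ => (1 + ‖ξ‖) ^ s * ‖b ξ‖
  refine mul_le_mul_of_nonneg_left ?_ (by positivity)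
  exact h3.le.trans h.2

theorem MomentLE.gradSymbol_mul (h : MomentLE (s + 1) b B) (i : Fin d) :
    MomentLE s (fun ξ => gradSymbol ξ i * b ξ) (7 * B) := by
  have h7 := h.const_mul 7
  rw [Complex.norm_ofNat] at h7
  refine h7.of_le fun ξ => ?_
  have h1 := norm_gradSymbol_le ξ i
  have hn := norm_nonneg ξ
  rw [norm_mul, norm_mul, Complex.norm_ofNat, pow_succ]
  calc _ ≤ (1 + ‖ξ‖) ^ s * (7 * (1 + ‖ξ‖) * ‖b ξ‖) := by
        gcongr
        linarith
    _ = _ := by ring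

theorem MomentLE.summable (h : MomentLE s b B) : Summable b := by
  refine Summable.of_norm (Summable.of_nonneg_of_le (fun _ => norm_nonneg _) (fun ξ => ?_) h.1)
  exact le_mul_of_one_le_left (norm_nonneg _) (one_le_pow₀ (by linarith [norm_nonneg ξ]))

theorem hasSum_of_eq {f g : (Fin d → ℤ) → ℂ} {z w : ℂ} (h : HasSum f z) (hfg : ∀ ξ, g ξ = f ξ)
    (hzw : w = z) : HasSum g w := by
  rw [hzw, funext hfg]
  exact h

theorem hasSum_shift {f : ℂ} {x : EuclideanSpace ℝ (Fin d)}
    (h : HasSum (fun ξ => b ξ * wave ξ x) f) (ζ : Fin d → ℤ) :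
    HasSum (fun ξ => b (ξ - ζ) * wave ξ x) (f * wave ζ x) := by
  have h1 := (Equiv.subRight ζ).hasSum_iff.2 (h.mul_right (wave ζ x))
  refine hasSum_of_eq h1 (fun ξ => ?_) rfl
  have e : wave ξ x = wave (ξ - ζ) x * wave ζ x := by rw [← wave_add, sub_add_cancel]
  rw [e, ← mul_assoc]
  rfl

/-- A Fourier series without low frequencies is small. -/
theorem norm_le_of_hasSum_wave (h : MomentLE 1 b B) {N : ℝ} (hN : 0 < N)
    (hb : ∀ ξ, ‖ξ‖ ≤ N → b ξ = 0) {f : ℂ} {x : EuclideanSpace ℝ (Fin d)}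
    (hf : HasSum (fun ξ => b ξ * wave ξ x) f) : ‖f‖ ≤ B / N := by
  have hle : ∀ ξ, ‖b ξ * wave ξ x‖ ≤ 1 / N * ((1 + ‖ξ‖) ^ 1 * ‖b ξ‖) := fun ξ => by
    rw [norm_mul, norm_wave, mul_one]
    by_cases hξ : ‖ξ‖ ≤ N
    · rw [hb ξ hξ, norm_zero, mul_zero, mul_zero]
    · rw [← mul_assoc]
      refine le_mul_of_one_le_left (norm_nonneg _) ?_
      rw [pow_one, div_mul_eq_mul_div, one_mul, one_le_div hN]
      linarith
  rw [← hf.tsum_eq]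
  refine (tsum_of_norm_bounded (h.1.mul_left (1 / N)).hasSum hle).trans ?_
  rw [tsum_mul_left, div_eq_mul_one_div B, mul_comm]
  exact mul_le_mul_of_nonneg_right h.2 (by positivity)

end Moments

theorem gradSymbol_add (ξ ζ : Fin d → ℤ) (i : Fin d) :
    gradSymbol (ξ + ζ) i = gradSymbol ξ i + gradSymbol ζ i := by
  simp only [gradSymbol, Pi.add_apply]; push_cast; ring

section Expansion

variable {A : EuclideanSpace ℝ (Fin d) → Coeff d m}

theorem MomentLE.entry {s : ℕ} {SA : ℝ} (h : MomentLE s (tensorCoeff A) SA) (i j : Fin d)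
    (α β : Fin m) : MomentLE s (fun ξ => tensorCoeff A ξ i j α β) SA := by
  refine h.of_le fun ξ => ?_
  gcongr
  exact (norm_le_pi_norm (tensorCoeff A ξ i j α) β).trans <|
    (norm_le_pi_norm (tensorCoeff A ξ i j) α).trans <|
    (norm_le_pi_norm (tensorCoeff A ξ i) j).trans (norm_le_pi_norm (tensorCoeff A ξ) i)

theorem contDiff_entry (hA : ContDiff ℝ ∞ A) (i j : Fin d) (α β : Fin m) :
    ContDiff ℝ ∞ fun y => (A y i j α β : ℂ) :=
  (entryCLM i j α β).contDiff.comp hA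

theorem hasSum_tensorCoeff (hA : ContDiff ℝ ∞ A) (hp : IsPeriodic A) {SA : ℝ} {s : ℕ}
    (h : MomentLE s (tensorCoeff A) SA) (i j : Fin d) (α β : Fin m) (x : EuclideanSpace ℝ (Fin d)) :
    HasSum (fun ξ => tensorCoeff A ξ i j α β * wave ξ x) (A x i j α β : ℂ) :=
  hasSum_fcoeff (hp.map fun a => (a i j α β : ℂ)) (contDiff_entry hA i j α β).continuous
    (h.entry i j α β).summable x

theorem hasSum_fderiv_tensorCoeff (hA : ContDiff ℝ ∞ A) (hp : IsPeriodic A) {SA : ℝ} {s : ℕ}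
    (h : MomentLE (s + 1) (tensorCoeff A) SA) (i j : Fin d) (α β : Fin m)
    (x : EuclideanSpace ℝ (Fin d)) (k : Fin d) :
    HasSum (fun ξ => gradSymbol ξ k * tensorCoeff A ξ i j α β * wave ξ x)
      (fderiv ℝ (fun y => (A y i j α β : ℂ)) x (EuclideanSpace.single k 1)) := by
  have hper : IsPeriodic fun y => (A y i j α β : ℂ) := hp.map fun a => (a i j α β : ℂ)
  have e : ∀ ξ, fcoeff (fun y => fderiv ℝ (fun y => (A y i j α β : ℂ)) y (EuclideanSpace.single k 1)) ξ
      = gradSymbol ξ k * tensorCoeff A ξ i j α β := fun ξ => by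
    rw [fcoeff_fderiv hper ((contDiff_entry hA i j α β).of_le (by simp)), gradSymbol]
    congr 2
    rw [Finset.sum_eq_single k] <;> simp +contextual
  have hs := ((h.entry i j α β).gradSymbol_mul k).summable
  have h1 := hasSum_fcoeff (f := fun y => fderiv ℝ (fun y => (A y i j α β : ℂ)) y
    (EuclideanSpace.single k 1)) (hper.fderiv_apply _)
    (((contDiff_entry hA i j α β).continuous_fderiv (by simp)).clm_apply continuous_const)
    (by rw [funext e]; exact hs) x
  simpa only [e] using h1

variable (A) in
/-- The Fourier coefficients of `A F` for a trigonometric polynomial `F`. -/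
def fluxCoeff {S : Finset (Fin d → ℤ)} (F : EuclideanSpace ℂ (S × Fin d × Fin m))
    (ξ : Fin d → ℤ) (i : Fin d) (α : Fin m) : ℂ :=
  ∑ z : S × Fin d × Fin m, F z * tensorCoeff A (ξ - z.1.1) i z.2.1 α z.2.2

theorem MomentLE.fluxCoeff {s : ℕ} {SA : ℝ} (h : MomentLE s (tensorCoeff A) SA)
    {S : Finset (Fin d → ℤ)} (F : EuclideanSpace ℂ (S × Fin d × Fin m)) (i : Fin d) (α : Fin m) :
    MomentLE s (fun ξ => fluxCoeff A F ξ i α)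
      (∑ z : S × Fin d × Fin m, ‖F z‖ * ((1 + ‖z.1.1‖) ^ s * SA)) :=
  MomentLE.sum fun z => ((h.entry i z.2.1 α z.2.2).shift z.1.1).const_mul (F z)

theorem hasSum_fluxCoeff (hA : ContDiff ℝ ∞ A) (hp : IsPeriodic A) {SA : ℝ} {s : ℕ}
    (h : MomentLE s (tensorCoeff A) SA) {S : Finset (Fin d → ℤ)}
    (F : EuclideanSpace ℂ (S × Fin d × Fin m)) (i : Fin d) (α : Fin m) (x : EuclideanSpace ℝ (Fin d)) :
    HasSum (fun ξ => fluxCoeff A F ξ i α * wave ξ x)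
      (∑ z : S × Fin d × Fin m, A x i z.2.1 α z.2.2 * (F z * wave z.1.1 x)) := by
  simp only [HalfSpaceNeumann.fluxCoeff, Finset.sum_mul]
  refine hasSum_sum fun z _ => ?_
  have h1 := (hasSum_shift (hasSum_tensorCoeff hA hp h i z.2.1 α z.2.2 x) z.1.1).mul_left (F z)
  exact hasSum_of_eq h1 (fun ξ => by ring) (by ring)

/-- The product rule on the Fourier side: `gradSymbol ξ` splits into a part at `ξ - ζ`, which
differentiates `A`, and a part at `ζ`, which differentiates the character. For a flux depending on
the depth, `c` is a component of `n` and `F'` the derivative of the profile. -/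
theorem hasSum_divergence (hA : ContDiff ℝ ∞ A) (hp : IsPeriodic A) {SA : ℝ} {s : ℕ}
    (h : MomentLE (s + 1) (tensorCoeff A) SA) {S : Finset (Fin d → ℤ)}
    (F F' : EuclideanSpace ℂ (S × Fin d × Fin m)) (c : ℂ) (i : Fin d) (α : Fin m)
    (x : EuclideanSpace ℝ (Fin d)) :
    HasSum (fun ξ => (gradSymbol ξ i * fluxCoeff A F ξ i α - c * fluxCoeff A F' ξ i α) * wave ξ x)
      (∑ z : S × Fin d × Fin m,
        (fderiv ℝ (fun y => (A y i z.2.1 α z.2.2 : ℂ)) x (EuclideanSpace.single i 1) *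
          (F z * wave z.1.1 x) + A x i z.2.1 α z.2.2 *
            ((gradSymbol z.1.1 i * F z - c * F' z) * wave z.1.1 x))) := by
  simp only [HalfSpaceNeumann.fluxCoeff, Finset.mul_sum, ← Finset.sum_sub_distrib, Finset.sum_mul]
  refine hasSum_sum fun z _ => ?_
  have h1 := (hasSum_shift (hasSum_fderiv_tensorCoeff hA hp h i z.2.1 α z.2.2 x i) z.1.1).mul_left (F z)
  have h2 := (hasSum_shift (hasSum_tensorCoeff hA hp h i z.2.1 α z.2.2 x) z.1.1).mul_left
    (gradSymbol z.1.1 i * F z - c * F' z)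
  refine hasSum_of_eq (h1.add h2) (fun ξ => ?_) ?_
  · have e : gradSymbol ξ i = gradSymbol (ξ - z.1.1) i + gradSymbol z.1.1 i := by
      rw [← gradSymbol_add, sub_add_cancel]
    rw [e]
    ring
  · ring

end Expansion

end

/-! ### Residuals of the approximate solutions -/

section

open scoped RealInnerProductSpace

variable {d m : ℕ}

namespace NeumannData

variable {pb : NeumannData d m} {S : Finset (Fin d → ℤ)} {R : ℝ}
  {v : ℝ → EuclideanSpace ℂ (S × Fin m)}

theorem exists_momentLE (pb : NeumannData d m) (p : ℕ) : ∃ SA Sg : ℝ,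
    MomentLE p (tensorCoeff pb.A) SA ∧ MomentLE (p + 1) (vectorCoeff pb.g) Sg := by
  obtain ⟨K, hK⟩ := exists_ckNormLE pb.contDiff_A pb.periodic_A (p + 2 * d)
  obtain ⟨K', hK'⟩ := exists_ckNormLE pb.contDiff_g pb.periodic_g (p + 1 + 2 * d)
  exact ⟨_, _, momentLE_tensorCoeff pb.contDiff_A pb.periodic_A hK,
    momentLE_vectorCoeff pb.contDiff_g pb.periodic_g hK'⟩

theorem fluxCoeff_eq_kernelOp (F : EuclideanSpace ℂ (S × Fin d × Fin m)) (ξ : S) (i : Fin d)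
    (α : Fin m) : fluxCoeff pb.A F ξ.1 i α = kernelOp (pb.kernel S) F (ξ, i, α) := by
  rw [kernelOp_apply]
  exact Finset.sum_congr rfl fun z _ => mul_comm _ _

/-- The weak Galerkin equation, tested with every `w`, says that the Fourier coefficients of the
divergence vanish at the frequencies in `S`. The remaining coefficients, outside `S`, form the
residual. -/
theorem IsGalerkin.divergence_eq (hv : pb.IsGalerkin R v) (t : ℝ) (ξ : S) (α : Fin m) :
    ∑ i, (gradSymbol ξ.1 i * fluxCoeff pb.A (pb.gradient v t) ξ.1 i α -
      (pb.n i : ℂ) * fluxCoeff pb.A (pb.gradient (deriv v) t) ξ.1 i α) = 0 := by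
  obtain ⟨SA, Sg, hA, hg⟩ := pb.exists_momentLE 0
  have h1 : pb.normalCompOp S (kernelOp (pb.kernel S) (pb.gradient (deriv v) t)) =
      divOp S (kernelOp (pb.kernel S) (pb.gradient v t)) := by
    refine ext_inner_right ℝ fun w => ?_
    have e1 := (pb.system S hA hg).inner_N (kernelOp (pb.kernel S) (pb.gradient (deriv v) t)) w
    have e2 := (pb.system S hA hg).inner_G (kernelOp (pb.kernel S) (pb.gradient v t)) w
    have e3 := hv.weak t w
    refine e1.symm.trans (e3.trans ?_)
    exact neg_eq_iff_eq_neg.2 e2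
  have h2 := congrArg (fun w : EuclideanSpace ℂ (S × Fin m) => w (ξ, α)) h1
  simp only [normalCompOp, divOp, contractOp_apply, ← fluxCoeff_eq_kernelOp] at h2
  rw [Finset.sum_sub_distrib, sub_eq_zero]
  exact h2.symm

theorem IsGalerkin.neumann_eq (hv : pb.IsGalerkin R v) (ξ : S) (α : Fin m) :
    ∑ i, (pb.n i : ℂ) * fluxCoeff pb.A (pb.gradient v 0) ξ.1 i α =
      2 * Real.pi * Complex.I * (∑ j, (pb.T j : ℂ) * (ξ.1 j : ℂ)) * vectorCoeff pb.g ξ.1 α := by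
  obtain ⟨SA, Sg, hA, hg⟩ := pb.exists_momentLE 0
  have h1 : pb.normalCompOp S (kernelOp (pb.kernel S) (pb.gradient v 0)) = pb.datum S := by
    refine ext_inner_right ℝ fun w => ?_
    have e1 := (pb.system S hA hg).inner_N (kernelOp (pb.kernel S) (pb.gradient v 0)) w
    exact e1.symm.trans (hv.neumann w)
  have h2 := congrArg (fun w : EuclideanSpace ℂ (S × Fin m) => w (ξ, α)) h1
  simp only [normalCompOp, contractOp_apply, ← fluxCoeff_eq_kernelOp, datum_apply] at h2
  exact h2

/-- `A` is real, so taking the real part commutes with the flux. The complex Galerkin solution then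
gives a real one. -/
theorem flux_approx (a : ℝ) (hv : ContDiff ℝ ∞ v) (y : EuclideanSpace ℝ (Fin d)) (i : Fin d)
    (α : Fin m) : flux (pb.A y) (fderiv ℝ (pb.approx a v) y) i α =
      (∑ q : Fin d × Fin m, (pb.A y i q.1 α q.2 : ℂ) * synth pb.n a (pb.gradient v) q y).re := by
  rw [flux, Complex.re_sum, Fintype.sum_prod_type]
  refine Finset.sum_congr rfl fun j _ => Finset.sum_congr rfl fun β _ => ?_
  rw [fderiv_approx_apply a hv, Complex.re_ofReal_mul]

theorem sum_synth (a : ℝ) (G : ℝ → EuclideanSpace ℂ (S × Fin d × Fin m))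
    (y : EuclideanSpace ℝ (Fin d)) (c : Fin d × Fin m → ℂ) :
    ∑ q, c q * synth pb.n a G q y =
      ∑ z : S × Fin d × Fin m, c z.2 * (G (depth pb.n a y) z * wave z.1.1 y) := by
  refine Eq.trans ?_ (Fintype.sum_prod_type_right _).symm
  exact Finset.sum_congr rfl fun q _ => by rw [synth, Finset.mul_sum]

theorem fderiv_flux_approx (a : ℝ) (hv : ContDiff ℝ ∞ v) (x : EuclideanSpace ℝ (Fin d)) (i : Fin d)
    (α : Fin m) :
    fderiv ℝ (fun y => flux (pb.A y) (fderiv ℝ (pb.approx a v) y) i α) x (EuclideanSpace.single i 1) =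
      (∑ z : S × Fin d × Fin m,
        (fderiv ℝ (fun y => (pb.A y i z.2.1 α z.2.2 : ℂ)) x (EuclideanSpace.single i 1) *
          (pb.gradient v (depth pb.n a x) z * wave z.1.1 x) + pb.A x i z.2.1 α z.2.2 *
            ((gradSymbol z.1.1 i * pb.gradient v (depth pb.n a x) z -
              (pb.n i : ℂ) * pb.gradient (deriv v) (depth pb.n a x) z) * wave z.1.1 x))).re := by
  rw [funext fun y => flux_approx a hv y i α]
  have hA : ∀ q : Fin d × Fin m, HasFDerivAt (fun y => (pb.A y i q.1 α q.2 : ℂ)) _ x := fun q =>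
    ((contDiff_entry pb.contDiff_A i q.1 α q.2).differentiable (by simp) x).hasFDerivAt
  have hs : ∀ q : Fin d × Fin m, HasFDerivAt (synth pb.n a (pb.gradient v) q) _ x := fun q =>
    ((contDiff_synth pb.n a (contDiff_gradient hv) q).differentiable (by simp) x).hasFDerivAt
  have h1 : HasFDerivAt (fun y => ∑ q : Fin d × Fin m,
      (pb.A y i q.1 α q.2 : ℂ) * synth pb.n a (pb.gradient v) q y) _ x :=
    HasFDerivAt.fun_sum fun q (_ : q ∈ Finset.univ) => (hA q).fun_mul (hs q)
  have h2 : HasFDerivAt (fun y => (∑ q : Fin d × Fin m,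
      (pb.A y i q.1 α q.2 : ℂ) * synth pb.n a (pb.gradient v) q y).re) _ x :=
    Complex.reCLM.hasFDerivAt.comp x h1
  rw [h2.fderiv]
  simp only [ContinuousLinearMap.comp_apply, Complex.reCLM_apply, sum_apply, add_apply, smul_apply,
    smul_eq_mul]
  congr 1
  rw [Finset.sum_add_distrib, Finset.sum_add_distrib, add_comm]
  congr 1
  · rw [← sum_synth a (pb.gradient v) x fun q =>
      fderiv ℝ (fun y => (pb.A y i q.1 α q.2 : ℂ)) x (EuclideanSpace.single i 1)]
    exact Finset.sum_congr rfl fun q _ => mul_comm _ _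
  · refine Eq.trans ?_ (Fintype.sum_prod_type_right _).symm
    refine Finset.sum_congr rfl fun q _ => ?_
    rw [fderiv_synth pb.n a (contDiff_gradient hv), deriv_gradient hv, Finset.mul_sum]

theorem sum_norm_gradient_le {ε : ℝ} (hε : 0 < ε) (hε1 : ε ≤ 1) (s : ℕ)
    (F : EuclideanSpace ℂ (S × Fin d × Fin m)) :
    ∑ z : S × Fin d × Fin m, ‖F z‖ * (1 + ‖z.1.1‖) ^ s ≤
      d * m * ((1 / ε) ^ s * (weightSum d / ε ^ (2 * d) *
        ‖weightOp S (Fin d × Fin m) ε (s + 2 * d) F‖)) := by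
  rw [Fintype.sum_prod_type_right]
  calc _ ≤ ∑ _q : Fin d × Fin m, ((1 / ε) ^ s * (weightSum d / ε ^ (2 * d) *
        ‖weightOp S (Fin d × Fin m) ε (s + 2 * d) F‖)) := by
        refine Finset.sum_le_sum fun q _ => ?_
        refine le_trans ?_ (mul_le_mul_of_nonneg_left (sum_norm_mul_weight_le hε hε1 s F q)
          (by positivity))
        rw [Finset.mul_sum]
        refine Finset.sum_le_sum fun ζ _ => ?_
        rw [weight, mul_left_comm, ← mul_pow]
        gcongr
        rw [one_div, ← div_eq_inv_mul, le_div_iff₀ hε]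
        nlinarith [norm_nonneg ζ.1]
    _ = _ := by simp

/-- The approximate solutions solve the equation up to an error that is inversely proportional to
the cut-off frequency. -/
theorem exists_divergence_bound (pb : NeumannData d m) : ∃ M : ℝ, ∀ (S : Finset (Fin d → ℤ)) (R a N : ℝ)
    (v : ℝ → EuclideanSpace ℂ (S × Fin m)) (x : EuclideanSpace ℝ (Fin d)) (α : Fin m), 0 < N →
    (∀ ξ, ‖ξ‖ ≤ N → ξ ∈ S) → pb.IsGalerkin R v → 0 ≤ depth pb.n a x → depth pb.n a x ≤ R →
    |∑ i, fderiv ℝ (fun y => flux (pb.A y) (fderiv ℝ (pb.approx a v) y) i α) x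
      (EuclideanSpace.single i 1)| ≤ M / N := by
  obtain ⟨SA, Sg, hA, hg⟩ := pb.exists_momentLE (2 + 2 * d + 1 + 1)
  have hSA := hA.nonneg
  have hε := pb.eps_pos hA.nonneg
  have hε1 := pb.eps_le_one (d := d) (m := m) SA
  set ε := smallParam d m pb.μ SA with hεdef
  have hW := weightSum_nonneg d
  set M0 := d * m * ((1 / ε) ^ 2 * (weightSum d / ε ^ (2 * d) * gradConst d m pb.μ SA Sg 0)) with hM0
  set M1 := d * m * ((1 / ε) ^ 1 * (weightSum d / ε ^ (2 * d) *
    (normalConst d m pb.μ SA * gradConst d m pb.μ SA Sg 0))) with hM1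
  refine ⟨∑ i : Fin d, (7 * (M0 * SA) + ‖(pb.n i : ℂ)‖ * (M1 * SA)), ?_⟩
  intro S R a N v x α hN hS hv hx0 hx
  set t := depth pb.n a x with ht
  have b0 : ∑ z : S × Fin d × Fin m, ‖pb.gradient v t z‖ * (1 + ‖z.1.1‖) ^ 2 ≤ M0 := by
    refine (sum_norm_gradient_le hε hε1 2 _).trans ?_
    have h := hv.norm_gradient_decay (s := 2 + 2 * d) (k := 0) (l := 0) (SA := SA) (Sg := Sg)
      (hA.mono (by omega)) (hg.mono (by omega)) hx0 hx
    rw [pow_zero, pow_zero, one_mul, div_one] at h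
    rw [hM0]
    gcongr
    exact h
  have b1 : ∑ z : S × Fin d × Fin m, ‖pb.gradient (deriv v) t z‖ * (1 + ‖z.1.1‖) ^ 1 ≤ M1 := by
    refine (sum_norm_gradient_le hε hε1 1 _).trans ?_
    have h := hv.norm_gradient_decay (s := 1 + 2 * d) (k := 1) (l := 0) (SA := SA) (Sg := Sg)
      (hA.mono (by omega)) (hg.mono (by omega)) hx0 hx
    rw [pow_zero, pow_one, div_one, iterate_deriv_gradient hv.smooth] at h
    rw [hM1]
    gcongr
    exact h
  have m0 : ∀ i : Fin d, MomentLE 2 (fun ξ => fluxCoeff pb.A (pb.gradient v t) ξ i α) (M0 * SA) :=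
    fun i => by
      have h := (hA.mono (s := 2) (by omega)).fluxCoeff (pb.gradient v t) i α
      refine ⟨h.1, h.2.trans ?_⟩
      simp only [← mul_assoc, ← Finset.sum_mul]
      gcongr
  have m1 : ∀ i : Fin d, MomentLE 1 (fun ξ => fluxCoeff pb.A (pb.gradient (deriv v) t) ξ i α)
      (M1 * SA) := fun i => by
      have h := (hA.mono (s := 1) (by omega)).fluxCoeff (pb.gradient (deriv v) t) i α
      refine ⟨h.1, h.2.trans ?_⟩
      simp only [← mul_assoc, ← Finset.sum_mul]
      gcongr
  -- The divergence has a first moment bounded independently of `S`, `R`, `a` and `v`. As its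
  -- coefficients vanish up to frequency `N`, its values are at most this moment divided by `N`.
  have hmom : MomentLE 1 (fun ξ => ∑ i, (gradSymbol ξ i * fluxCoeff pb.A (pb.gradient v t) ξ i α -
      (pb.n i : ℂ) * fluxCoeff pb.A (pb.gradient (deriv v) t) ξ i α))
      (∑ i : Fin d, (7 * (M0 * SA) + ‖(pb.n i : ℂ)‖ * (M1 * SA))) :=
    MomentLE.sum fun i => ((m0 i).gradSymbol_mul i).sub ((m1 i).const_mul _)
  have hsum := hasSum_sum fun i (_ : i ∈ Finset.univ) => hasSum_divergence pb.contDiff_A pb.periodic_A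
    (hA.mono (s := 0 + 1) (by omega)) (pb.gradient v t) (pb.gradient (deriv v) t) (pb.n i : ℂ) i α x
  simp only [← Finset.sum_mul] at hsum
  have hle := norm_le_of_hasSum_wave hmom hN (fun ξ hξ => hv.divergence_eq t ⟨ξ, hS ξ hξ⟩ α) hsum
  simp only [fderiv_flux_approx a hv.smooth, ← Complex.re_sum]
  exact (Complex.abs_re_le_norm _).trans hle

/-- The Fourier coefficients of `T · ∇g`. -/
def datumCoeff (pb : NeumannData d m) (ξ : Fin d → ℤ) (α : Fin m) : ℂ :=
  ∑ j, (pb.T j : ℂ) * (gradSymbol ξ j * vectorCoeff pb.g ξ α)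

theorem datumCoeff_eq (pb : NeumannData d m) (ξ : Fin d → ℤ) (α : Fin m) : pb.datumCoeff ξ α =
    2 * Real.pi * Complex.I * (∑ j, (pb.T j : ℂ) * (ξ j : ℂ)) * vectorCoeff pb.g ξ α := by
  rw [datumCoeff, Finset.mul_sum, Finset.sum_mul]
  exact Finset.sum_congr rfl fun j _ => by rw [gradSymbol]; ring

theorem momentLE_datumCoeff (pb : NeumannData d m) {s : ℕ} {Sg : ℝ}
    (hg : MomentLE (s + 1) (vectorCoeff pb.g) Sg) (α : Fin m) :
    MomentLE s (fun ξ => pb.datumCoeff ξ α) (∑ j, ‖(pb.T j : ℂ)‖ * (7 * Sg)) := by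
  have h : MomentLE (s + 1) (fun ξ => vectorCoeff pb.g ξ α) Sg := hg.of_le fun ξ => by
    gcongr
    exact norm_le_pi_norm (vectorCoeff pb.g ξ) α
  exact MomentLE.sum fun j => (h.gradSymbol_mul j).const_mul _

theorem hasSum_datumCoeff (pb : NeumannData d m) (x : EuclideanSpace ℝ (Fin d)) (α : Fin m) :
    HasSum (fun ξ => pb.datumCoeff ξ α * wave ξ x) ((fderiv ℝ pb.g x pb.T α : ℝ) : ℂ) := by
  obtain ⟨-, Sg, -, hg⟩ := pb.exists_momentLE 0
  have hper : IsPeriodic fun y => compCLM α (pb.g y) := pb.periodic_g.map _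
  have hc : ContDiff ℝ ∞ fun y => compCLM α (pb.g y) := (compCLM α).contDiff.comp pb.contDiff_g
  have e : ∀ ξ, fcoeff (fun y => fderiv ℝ (fun y => compCLM α (pb.g y)) y pb.T) ξ =
      pb.datumCoeff ξ α := fun ξ => by
    rw [fcoeff_fderiv hper (hc.of_le (by simp)), datumCoeff_eq]
    congr 2
    exact Finset.sum_congr rfl fun j _ => mul_comm _ _
  have h1 := hasSum_fcoeff (f := fun y => fderiv ℝ (fun y => compCLM α (pb.g y)) y pb.T)
    (hper.fderiv_apply _) ((hc.continuous_fderiv (by simp)).clm_apply continuous_const)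
    (by rw [funext e]; exact (pb.momentLE_datumCoeff hg α).summable) x
  have h2 : HasFDerivAt (fun y => compCLM α (pb.g y)) ((compCLM α).comp (fderiv ℝ pb.g x)) x :=
    (compCLM α).hasFDerivAt.comp x (pb.contDiff_g.differentiable (by simp) x).hasFDerivAt
  refine hasSum_of_eq h1 (fun ξ => by rw [e]) ?_
  rw [h2.fderiv]
  rfl

/-- The approximate solutions satisfy the boundary condition up to an error that is inversely
proportional to the cut-off frequency. -/
theorem exists_boundary_bound (pb : NeumannData d m) : ∃ M : ℝ, ∀ (S : Finset (Fin d → ℤ)) (R a N : ℝ)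
    (v : ℝ → EuclideanSpace ℂ (S × Fin m)) (x : EuclideanSpace ℝ (Fin d)) (α : Fin m), 0 < N →
    (∀ ξ, ‖ξ‖ ≤ N → ξ ∈ S) → pb.IsGalerkin R v → depth pb.n a x = 0 →
    |∑ i, pb.n i * flux (pb.A x) (fderiv ℝ (pb.approx a v) x) i α - fderiv ℝ pb.g x pb.T α| ≤
      M / N := by
  obtain ⟨SA, Sg, hA, hg⟩ := pb.exists_momentLE (1 + 2 * d + 1)
  have hSA := hA.nonneg
  have hε := pb.eps_pos hA.nonneg
  have hε1 := pb.eps_le_one (d := d) (m := m) SA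
  set ε := smallParam d m pb.μ SA with hεdef
  have hW := weightSum_nonneg d
  set M0 := d * m * ((1 / ε) ^ 1 * (weightSum d / ε ^ (2 * d) * gradConst d m pb.μ SA Sg 0)) with hM0
  refine ⟨∑ i : Fin d, ‖(pb.n i : ℂ)‖ * (M0 * SA) + ∑ j, ‖(pb.T j : ℂ)‖ * (7 * Sg), ?_⟩
  intro S R a N v x α hN hS hv hx
  have b0 : ∑ z : S × Fin d × Fin m, ‖pb.gradient v 0 z‖ * (1 + ‖z.1.1‖) ^ 1 ≤ M0 := by
    refine (sum_norm_gradient_le hε hε1 1 _).trans ?_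
    have h := hv.norm_gradient_decay (s := 1 + 2 * d) (k := 0) (l := 0) (SA := SA) (Sg := Sg)
      (hA.mono (by omega)) (hg.mono (by omega)) le_rfl (zero_le_one.trans hv.one_le)
    rw [pow_zero, pow_zero, one_mul, div_one] at h
    rw [hM0]
    gcongr
    exact h
  have m0 : ∀ i : Fin d, MomentLE 1 (fun ξ => fluxCoeff pb.A (pb.gradient v 0) ξ i α) (M0 * SA) :=
    fun i => by
      have h := (hA.mono (s := 1) (by omega)).fluxCoeff (pb.gradient v 0) i α
      refine ⟨h.1, h.2.trans ?_⟩
      simp only [← mul_assoc, ← Finset.sum_mul]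
      gcongr
  have hmom : MomentLE 1 (fun ξ => ∑ i, (pb.n i : ℂ) * fluxCoeff pb.A (pb.gradient v 0) ξ i α -
      pb.datumCoeff ξ α)
      (∑ i : Fin d, ‖(pb.n i : ℂ)‖ * (M0 * SA) + ∑ j, ‖(pb.T j : ℂ)‖ * (7 * Sg)) :=
    (MomentLE.sum fun i => (m0 i).const_mul _).sub (pb.momentLE_datumCoeff (hg.mono (by omega)) α)
  have hsum := (hasSum_sum fun i (_ : i ∈ Finset.univ) => (hasSum_fluxCoeff pb.contDiff_A
    pb.periodic_A hA (pb.gradient v 0) i α x).mul_left (pb.n i : ℂ)).sub (pb.hasSum_datumCoeff x α)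
  simp only [← mul_assoc, ← Finset.sum_mul, ← sub_mul] at hsum
  -- Up to frequency `N` the Galerkin solution reproduces the datum exactly, so only the tails of
  -- the two series contribute.
  have hle := norm_le_of_hasSum_wave hmom hN (fun ξ hξ => by
    rw [hv.neumann_eq ⟨ξ, hS ξ hξ⟩ α, datumCoeff_eq, sub_self]) hsum
  refine le_trans (le_of_eq ?_) ((Complex.abs_re_le_norm _).trans hle)
  rw [Complex.sub_re, Complex.ofReal_re, Complex.re_sum]
  congr 2
  refine Finset.sum_congr rfl fun i _ => ?_
  rw [Complex.re_ofReal_mul, flux_approx a hv.smooth, sum_synth a (pb.gradient v) x fun q =>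
    (pb.A x i q.1 α q.2 : ℂ), hx]
  simp only [mul_assoc]

end NeumannData

end

/-! ### Limits of smooth functions along an ultrafilter -/

section

open Filter Topology

section Ultralimit

variable {E F : Type*} [NormedAddCommGroup E] [NormedSpace ℝ E] [NormedAddCommGroup F]
  [NormedSpace ℝ F] {s : Set E} {l : Ultrafilter ℕ}

theorem finiteDimensional_continuousMultilinearMap [FiniteDimensional ℝ E] [FiniteDimensional ℝ F]
    (k : ℕ) : FiniteDimensional ℝ (E [×k]→L[ℝ] F) :=
  FiniteDimensional.of_injective
    (ContinuousMultilinearMap.toMultilinearMapLinear (R' := ℝ) (A := ℝ) (M₁ := fun _ : Fin k => E)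
      (M₂ := F)) ContinuousMultilinearMap.toMultilinearMap_injective

theorem exists_tendsto_of_norm_le [FiniteDimensional ℝ F] {z : ℕ → F} {B : ℝ}
    (h : ∀ᶠ N in (l : Filter ℕ), ‖z N‖ ≤ B) : ∃ w, Tendsto z l (𝓝 w) := by
  have : ProperSpace F := FiniteDimensional.proper ℝ F
  obtain ⟨w, -, hw⟩ := (isCompact_closedBall (0 : F) B).ultrafilter_le_nhds (l.map z) (by
    rw [le_principal_iff]
    refine h.mono fun N hN => ?_
    simpa using hN)
  exact ⟨w, hw⟩

/-- Pointwise limits of functions whose derivatives are uniformly Lipschitz are differentiable. -/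
theorem hasFDerivWithinAt_of_tendsto {g : ℕ → E → F} {g' : ℕ → E → E →L[ℝ] F} (hs : Convex ℝ s)
    (hg : ∀ N x, HasFDerivAt (g N) (g' N x) x) {B : ℝ}
    (hB : ∀ r : ℝ, ∀ᶠ N in (l : Filter ℕ), ∀ x ∈ s, ‖x‖ ≤ r → ∀ y ∈ s, ‖y‖ ≤ r →
      ‖g' N y - g' N x‖ ≤ B * ‖y - x‖) {G : E → F} {G' : E → E →L[ℝ] F}
    (hG : ∀ x ∈ s, Tendsto (fun N => g N x) l (𝓝 (G x)))
    (hG' : ∀ x ∈ s, Tendsto (fun N => g' N x) l (𝓝 (G' x))) {x : E} (hx : x ∈ s) :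
    HasFDerivWithinAt G (G' x) s x := by
  -- The first-order Taylor remainder is quadratic with a constant independent of `N`, so the bound
  -- survives the limit.
  have key : ∀ y ∈ s, ‖G y - G x - G' x (y - x)‖ ≤ |B| * ‖y - x‖ * ‖y - x‖ := by
    intro y hy
    have hlim : Tendsto (fun N => ‖g N y - g N x - g' N x (y - x)‖) l
        (𝓝 ‖G y - G x - G' x (y - x)‖) :=
      (((hG y hy).sub (hG x hx)).sub (((ContinuousLinearMap.apply ℝ F (y - x)).continuous.tendsto _).comp (hG' x hx))).norm
    refine le_of_tendsto hlim ?_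
    filter_upwards [hB (max ‖x‖ ‖y‖)] with N hN
    have hseg : segment ℝ x y ⊆ s := hs.segment_subset hx hy
    refine (convex_segment x y).norm_image_sub_le_of_norm_hasFDerivWithin_le'
      (fun z _ => (hg N z).hasFDerivWithinAt) (fun z hz => ?_) (left_mem_segment ℝ x y)
      (right_mem_segment ℝ x y)
    have hz1 : ‖z‖ ≤ max ‖x‖ ‖y‖ := by
      have := (convex_closedBall (0 : E) (max ‖x‖ ‖y‖)).segment_subset (x := x) (y := y)
        (by simp) (by simp) hz
      simpa using this
    refine (hN x hx (le_max_left _ _) z (hseg hz) hz1).trans ?_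
    refine mul_le_mul (le_abs_self B) ?_ (norm_nonneg _) (abs_nonneg _)
    exact norm_sub_le_of_mem_segment hz
  rw [hasFDerivWithinAt_iff_isLittleO, Asymptotics.isLittleO_iff]
  intro c hc
  have h1 : ∀ᶠ y in 𝓝[s] x, |B| * ‖y - x‖ < c := by
    have h2 : Tendsto (fun y => |B| * ‖y - x‖) (𝓝[s] x) (𝓝 (|B| * ‖x - x‖)) :=
      ((continuous_const.mul ((continuous_id.sub continuous_const).norm)).tendsto x).mono_left
        nhdsWithin_le_nhds
    rw [sub_self, norm_zero, mul_zero] at h2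
    exact h2.eventually (gt_mem_nhds hc)
  filter_upwards [h1, self_mem_nhdsWithin] with y hy hys
  exact (key y hys).trans (mul_le_mul_of_nonneg_right hy.le (norm_nonneg _))

/-- Smooth functions with locally uniformly bounded derivatives converge, along an ultrafilter, to a
smooth function, together with all derivatives. -/
theorem exists_smooth_limit [FiniteDimensional ℝ E] [FiniteDimensional ℝ F] (hs : Convex ℝ s)
    (hu : UniqueDiffOn ℝ s) {f : ℕ → E → F} (hf : ∀ N, ContDiff ℝ ∞ (f N))
    (hB : ∀ k : ℕ, ∃ B : ℝ, ∀ r : ℝ, ∀ᶠ N in (l : Filter ℕ), ∀ x ∈ s, ‖x‖ ≤ r →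
      ‖iteratedFDeriv ℝ k (f N) x‖ ≤ B) :
    ∃ u : E → F, ContDiffOn ℝ ∞ u s ∧ ∀ k : ℕ, ∀ x ∈ s,
      Tendsto (fun N => iteratedFDeriv ℝ k (f N) x) l (𝓝 (iteratedFDerivWithin ℝ k u s x)) := by
  have hlim : ∀ (x : E) (k : ℕ), ∃ w : E [×k]→L[ℝ] F, x ∈ s →
      Tendsto (fun N => iteratedFDeriv ℝ k (f N) x) l (𝓝 w) := by
    intro x k
    by_cases hx : x ∈ s
    · obtain ⟨B, hB⟩ := hB k
      have := finiteDimensional_continuousMultilinearMap (E := E) (F := F) k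
      obtain ⟨w, hw⟩ := exists_tendsto_of_norm_le (l := l) (z := fun N => iteratedFDeriv ℝ k (f N) x)
        (B := B) ((hB ‖x‖).mono fun N hN => hN x hx le_rfl)
      exact ⟨w, fun _ => hw⟩
    · exact ⟨0, fun h => absurd h hx⟩
  choose p hp using hlim
  have hd : ∀ (N k : ℕ) (x : E), HasFDerivAt (iteratedFDeriv ℝ k (f N))
      (iteratedFDeriv ℝ (k + 1) (f N) x).curryLeft x := fun N k x =>
    (hf N).ftaylorSeries.fderiv k (by exact_mod_cast ENat.natCast_lt_top k) x
  have hder : ∀ (k : ℕ), ∀ x ∈ s, HasFDerivWithinAt (fun y => p y k) (p x (k + 1)).curryLeft s x := by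
    intro k x hx
    obtain ⟨B, hB2⟩ := hB (k + 2)
    -- The bound of order `k + 2` makes the derivatives of order `k + 1` Lipschitz on the convex
    -- sets `s ∩ closedBall 0 r`.
    refine hasFDerivWithinAt_of_tendsto (l := l) hs (fun N x => hd N k x) (B := B) (fun r => ?_)
      (fun y hy => hp y k hy) (G' := fun y => (p y (k + 1)).curryLeft) (fun y hy => ?_) hx
    · filter_upwards [hB2 r] with N hN y hy hyr z hz hzr
      have hconv : Convex ℝ (s ∩ Metric.closedBall 0 r) := hs.inter (convex_closedBall 0 r)
      have h1 := hconv.norm_image_sub_le_of_norm_hasFDerivWithin_le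
        (fun x _ => (hd N (k + 1) x).hasFDerivWithinAt) (C := B) (fun x hx => by
          rw [ContinuousMultilinearMap.curryLeft_norm]
          exact hN x hx.1 (by simpa using hx.2)) (x := y) (y := z) ⟨hy, by simpa using hyr⟩
          ⟨hz, by simpa using hzr⟩
      refine le_trans (le_of_eq ?_) h1
      exact (continuousMultilinearCurryLeftEquiv ℝ (fun _ : Fin (k + 1) => E) F).norm_map
        (iteratedFDeriv ℝ (k + 1) (f N) z - iteratedFDeriv ℝ (k + 1) (f N) y) ▸ rfl
    · exact ((continuousMultilinearCurryLeftEquiv ℝ (fun _ : Fin (k + 1) => E) F).continuous.tendsto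
        _).comp (hp y (k + 1) hy)
  have hT : HasFTaylorSeriesUpToOn ∞ (fun x => (p x 0).curry0) p s :=
    ⟨fun x _ => rfl, fun k _ x hx => hder k x hx, fun k _ x hx => (hder k x hx).continuousWithinAt⟩
  refine ⟨fun x => (p x 0).curry0, hT.contDiffOn, fun k x hx => ?_⟩
  rw [← hT.eq_iteratedFDerivWithin_of_uniqueDiffOn (by exact_mod_cast le_top) hu hx]
  exact hp x k hx

end Ultralimit

end

/-! ### Passage to the limit -/

section

open Filter Topology

variable {d m : ℕ}

/-- In this expanded form the divergence involves only first and second derivatives of `u` at `x`,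
so pointwise convergence of derivatives suffices to pass to the limit. -/
theorem sum_fderiv_flux {A : EuclideanSpace ℝ (Fin d) → Coeff d m} (hA : ContDiff ℝ ∞ A)
    {u : EuclideanSpace ℝ (Fin d) → EuclideanSpace ℝ (Fin m)} {x : EuclideanSpace ℝ (Fin d)}
    (hu : DifferentiableAt ℝ (fderiv ℝ u) x) (α : Fin m) :
    ∑ i, fderiv ℝ (fun y => flux (A y) (fderiv ℝ u y) i α) x (EuclideanSpace.single i 1) =
      ∑ i, ∑ j, ∑ β, (A x i j α β * fderiv ℝ (fderiv ℝ u) x (EuclideanSpace.single i 1)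
        (EuclideanSpace.single j 1) β + fderiv ℝ u x (EuclideanSpace.single j 1) β *
          fderiv ℝ (fun y => A y i j α β) x (EuclideanSpace.single i 1)) := by
  refine Finset.sum_congr rfl fun i _ => ?_
  have hAd : ∀ j β, DifferentiableAt ℝ (fun y => A y i j α β) x := fun j β =>
    (((contDiff_pi.1 (contDiff_pi.1 (contDiff_pi.1 (contDiff_pi.1 hA i) j) α) β).differentiable
      (by simp)) x)
  let ev : Fin d → Fin m → (EuclideanSpace ℝ (Fin d) →L[ℝ] EuclideanSpace ℝ (Fin m)) →L[ℝ] ℝ :=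
    fun j β => (EuclideanSpace.proj (𝕜 := ℝ) β).comp
      (ContinuousLinearMap.apply ℝ _ (EuclideanSpace.single j 1))
  have hL : ∀ j β, HasFDerivAt (fun y => fderiv ℝ u y (EuclideanSpace.single j 1) β)
      ((ev j β).comp (fderiv ℝ (fderiv ℝ u) x)) x := fun j β =>
    (ev j β).hasFDerivAt.comp x hu.hasFDerivAt
  have h1 : HasFDerivAt (fun y => flux (A y) (fderiv ℝ u y) i α) _ x :=
    HasFDerivAt.fun_sum fun j (_ : j ∈ Finset.univ) => HasFDerivAt.fun_sum
      fun β (_ : β ∈ Finset.univ) => (hAd j β).hasFDerivAt.fun_mul (hL j β)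
  rw [h1.fderiv]
  simp only [sum_apply, add_apply, smul_apply, smul_eq_mul]
  rfl

theorem depth_nonneg {n : EuclideanSpace ℝ (Fin d)} {a : ℝ} {x : EuclideanSpace ℝ (Fin d)}
    (hx : x ∈ closedHalfSpace n a) : 0 ≤ depth n a x := by
  have : inner ℝ x n ≤ -a := hx
  rw [depth]; linarith

theorem abs_inner_add {n : EuclideanSpace ℝ (Fin d)} {a : ℝ} {x : EuclideanSpace ℝ (Fin d)}
    (hx : x ∈ closedHalfSpace n a) : |inner ℝ x n + a| = depth n a x := by
  rw [abs_of_nonpos (by have := depth_nonneg hx; rw [depth] at this; linarith), depth]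

theorem depth_le {n : EuclideanSpace ℝ (Fin d)} (hn : ‖n‖ = 1) (a : ℝ) {r : ℝ}
    {x : EuclideanSpace ℝ (Fin d)} (hx : ‖x‖ ≤ r) : depth n a x ≤ r + |a| := by
  have h1 := (abs_le.1 (abs_real_inner_le_norm x n)).1
  rw [hn, mul_one] at h1
  rw [depth]
  linarith [neg_abs_le a]

theorem isOpen_halfSpace (n : EuclideanSpace ℝ (Fin d)) (a : ℝ) : IsOpen (halfSpace n a) :=
  isOpen_lt (continuous_id.inner continuous_const) continuous_const

theorem halfSpace_subset (n : EuclideanSpace ℝ (Fin d)) (a : ℝ) :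
    halfSpace n a ⊆ closedHalfSpace n a :=
  fun x (hx : inner ℝ x n < -a) => show inner ℝ x n ≤ -a from hx.le

theorem convex_closedHalfSpace (n : EuclideanSpace ℝ (Fin d)) (a : ℝ) :
    Convex ℝ (closedHalfSpace n a) := by
  refine convex_halfSpace_le (f := fun x => inner ℝ x n) ?_ _
  exact ⟨fun x y => inner_add_left x y n, fun c x => real_inner_smul_left x n c⟩

theorem uniqueDiffOn_closedHalfSpace {n : EuclideanSpace ℝ (Fin d)} (hn : ‖n‖ = 1) (a : ℝ) :
    UniqueDiffOn ℝ (closedHalfSpace n a) := by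
  refine uniqueDiffOn_convex (convex_closedHalfSpace n a) ⟨-(a + 1) • n, ?_⟩
  refine interior_maximal (halfSpace_subset n a) (isOpen_halfSpace n a) ?_
  change inner ℝ (-(a + 1) • n) n < -a
  rw [real_inner_smul_left, real_inner_self_eq_norm_sq, hn]
  linarith

/-- The frequencies of size at most `N`. -/
def box (d N : ℕ) : Finset (Fin d → ℤ) := Fintype.piFinset fun _ => Finset.Icc (-(N : ℤ)) N

theorem mem_box {N : ℕ} {ξ : Fin d → ℤ} (h : ‖ξ‖ ≤ N) : ξ ∈ box d N := by
  rw [box, Fintype.mem_piFinset]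
  intro i
  have h1 := (norm_le_pi_norm ξ i).trans h
  rw [Int.norm_eq_abs] at h1
  rw [Finset.mem_Icc]
  exact abs_le.1 (by exact_mod_cast h1)

namespace NeumannData

variable (pb : NeumannData d m)

/-- The approximations use the frequencies up to `N` on a slab of width `N + 1`. Bounded sequences
converge along a nonprincipal ultrafilter, so no diagonal subsequence is needed. All estimates are
stated after `u`, with moments of any order, since each passes to the same limit. -/
theorem exists_solution (a : ℝ) : ∃ u : EuclideanSpace ℝ (Fin d) → EuclideanSpace ℝ (Fin m),
    IsSmoothSolution pb.A pb.n a pb.T pb.g u ∧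
    (∀ l : ℕ, 1 ≤ l → ∀ SA Sg : ℝ, MomentLE (2 * d + 5 + 4 * l) (tensorCoeff pb.A) SA →
      MomentLE (2 * d + 5 + 4 * l + 1) (vectorCoeff pb.g) Sg → ∀ x ∈ closedHalfSpace pb.n a,
      ‖u x‖ ≤ sizeConst d m pb.μ SA Sg l / (pb.κ * (1 + pb.κ * |inner ℝ x pb.n + a|) ^ l)) ∧
    (∀ k l : ℕ, ∀ SA Sg : ℝ, MomentLE (k + 2 * d + 1 + 4 * l) (tensorCoeff pb.A) SA →
      MomentLE (k + 2 * d + 1 + 4 * l + 1) (vectorCoeff pb.g) Sg → ∀ x ∈ closedHalfSpace pb.n a,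
      ‖iteratedFDerivWithin ℝ (k + 1) u (closedHalfSpace pb.n a) x‖ ≤
        derivConst d m pb.μ SA Sg k l / (1 + pb.κ * |inner ℝ x pb.n + a|) ^ l) := by
  set s := closedHalfSpace pb.n a with hs
  have hex : ∀ N : ℕ, ∃ v : ℝ → EuclideanSpace ℂ (box d N × Fin m),
      pb.IsGalerkin (N + 1 : ℝ) v := fun N =>
    pb.exists_isGalerkin (box d N) (by linarith [Nat.cast_nonneg (α := ℝ) N])
  choose v hv using hex
  set f : ℕ → EuclideanSpace ℝ (Fin d) → EuclideanSpace ℝ (Fin m) := fun N => pb.approx a (v N)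
    with hf
  have hfs : ∀ N, ContDiff ℝ ∞ (f N) := fun N => contDiff_approx a (hv N).smooth
  -- The estimates hold only inside the slab, which eventually covers the part of the half-space in
  -- any given ball.
  have hdeep : ∀ r : ℝ, ∀ᶠ N : ℕ in (hyperfilter ℕ : Filter ℕ), r + |a| ≤ N + 1 := fun r => by
    refine Nat.hyperfilter_le_atTop ?_
    filter_upwards [eventually_ge_atTop ⌈r + |a|⌉₊] with N hN
    linarith [Nat.ceil_le.1 hN]
  have hdepth : ∀ x, ∀ᶠ N : ℕ in (hyperfilter ℕ : Filter ℕ), depth pb.n a x ≤ N + 1 := fun x =>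
    (hdeep ‖x‖).mono fun N hN => (depth_le pb.norm_n a le_rfl).trans hN
  have hbig : ∀ᶠ N : ℕ in (hyperfilter ℕ : Filter ℕ), (0 : ℝ) < N := by
    refine Nat.hyperfilter_le_atTop ?_
    filter_upwards [eventually_gt_atTop 0] with N hN
    exact_mod_cast hN
  have hκ := pb.κ_pos
  -- These bounds serve only compactness. They may depend on `κ`, and no decay is used.
  have hB : ∀ k : ℕ, ∃ B : ℝ, ∀ r : ℝ, ∀ᶠ N in (hyperfilter ℕ : Filter ℕ), ∀ x ∈ s, ‖x‖ ≤ r →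
      ‖iteratedFDeriv ℝ k (f N) x‖ ≤ B := by
    rintro (_ | k)
    · obtain ⟨SA, Sg, hA, hg⟩ := pb.exists_momentLE (2 * d + 5 + 4 * 1)
      refine ⟨|sizeConst d m pb.μ SA Sg 1| / pb.κ, fun r => ?_⟩
      filter_upwards [hdeep r] with N hN x hx hxr
      rw [norm_iteratedFDeriv_zero]
      refine ((hv N).norm_approx_decay a le_rfl hA hg (depth_nonneg hx)
        ((depth_le pb.norm_n a hxr).trans hN)).trans ?_
      have h0 := mul_nonneg hκ.le (depth_nonneg hx)
      gcongr
      · exact le_abs_self _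
      · rw [pow_one]
        nlinarith
    · obtain ⟨SA, Sg, hA, hg⟩ := pb.exists_momentLE (k + 2 * d + 1 + 4 * 0)
      refine ⟨derivConst d m pb.μ SA Sg k 0, fun r => ?_⟩
      filter_upwards [hdeep r] with N hN x hx hxr
      have h := (hv N).norm_iteratedFDeriv_approx_decay a hA hg (depth_nonneg hx)
        ((depth_le pb.norm_n a hxr).trans hN)
      rwa [pow_zero, div_one] at h
  have huniq := uniqueDiffOn_closedHalfSpace pb.norm_n a
  obtain ⟨u, hu, hlim⟩ := exists_smooth_limit (convex_closedHalfSpace pb.n a) huniq hfs hB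
  have hlim0 : ∀ x ∈ s, Tendsto (fun N => f N x) (hyperfilter ℕ) (𝓝 (u x)) := fun x hx => by
    have h := ((ContinuousMultilinearMap.apply ℝ (fun _ : Fin 0 => EuclideanSpace ℝ (Fin d))
      (EuclideanSpace ℝ (Fin m)) 0).continuous.tendsto _).comp (hlim 0 x hx)
    exact h
  have hlim1 : ∀ x ∈ s, ∀ j β, Tendsto (fun N => fderiv ℝ (f N) x (EuclideanSpace.single j 1) β)
      (hyperfilter ℕ) (𝓝 (fderivWithin ℝ u s x (EuclideanSpace.single j 1) β)) := by
    intro x hx j β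
    have h := ((EuclideanSpace.proj (𝕜 := ℝ) β).continuous.tendsto _).comp
      (((ContinuousMultilinearMap.apply ℝ (fun _ : Fin 1 => EuclideanSpace ℝ (Fin d))
      (EuclideanSpace ℝ (Fin m)) fun _ => EuclideanSpace.single j 1).continuous.tendsto _).comp
        (hlim 1 x hx))
    simpa [Function.comp_def, iteratedFDeriv_one_apply, iteratedFDerivWithin_one_apply (huniq x hx)]
      using h
  refine ⟨u, ⟨hu, fun x hx α => ?_, fun x hx α => ?_⟩, ?_, ?_⟩
  · have hxs : x ∈ s := halfSpace_subset _ _ hx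
    have hnhds : s ∈ 𝓝 x := mem_of_superset ((isOpen_halfSpace pb.n a).mem_nhds hx)
      (halfSpace_subset _ _)
    have hux : ContDiffAt ℝ ∞ u x := (hu x hxs).contDiffAt hnhds
    have hdu : DifferentiableAt ℝ (fderiv ℝ u) x :=
      (hux.fderiv_right (m := ∞) (by simp)).differentiableAt (by simp)
    have hset : s =ᶠ[𝓝 x] Set.univ := eventuallyEq_univ.2 hnhds
    have hlim2 : ∀ i j β, Tendsto (fun N => fderiv ℝ (fderiv ℝ (f N)) x (EuclideanSpace.single i 1)
        (EuclideanSpace.single j 1) β) (hyperfilter ℕ)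
        (𝓝 (fderiv ℝ (fderiv ℝ u) x (EuclideanSpace.single i 1) (EuclideanSpace.single j 1) β)) := by
      intro i j β
      have h := ((EuclideanSpace.proj (𝕜 := ℝ) β).continuous.tendsto _).comp
        (((ContinuousMultilinearMap.apply ℝ (fun _ : Fin 2 => EuclideanSpace ℝ (Fin d))
        (EuclideanSpace ℝ (Fin m)) ![EuclideanSpace.single i 1,
          EuclideanSpace.single j 1]).continuous.tendsto _).comp (hlim 2 x hxs))
      rw [iteratedFDerivWithin_congr_set hset, iteratedFDerivWithin_univ] at h
      simpa [Function.comp_def, iteratedFDeriv_two_apply] using h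
    have hlim1' : ∀ j β, Tendsto (fun N => fderiv ℝ (f N) x (EuclideanSpace.single j 1) β)
        (hyperfilter ℕ) (𝓝 (fderiv ℝ u x (EuclideanSpace.single j 1) β)) := fun j β => by
      rw [← fderivWithin_of_mem_nhds hnhds]
      exact hlim1 x hxs j β
    have hdf : ∀ N, DifferentiableAt ℝ (fderiv ℝ (f N)) x := fun N =>
      (((hfs N).fderiv_right (m := ∞) (by simp)).differentiable (by simp)) x
    have hconv : Tendsto (fun N => ∑ i, fderiv ℝ (fun y => flux (pb.A y) (fderiv ℝ (f N) y) i α) x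
        (EuclideanSpace.single i 1)) (hyperfilter ℕ)
        (𝓝 (∑ i, fderiv ℝ (fun y => flux (pb.A y) (fderiv ℝ u y) i α) x
          (EuclideanSpace.single i 1))) := by
      rw [sum_fderiv_flux pb.contDiff_A hdu]
      simp only [fun N => sum_fderiv_flux pb.contDiff_A (hdf N) α]
      exact tendsto_finsetSum _ fun i _ => tendsto_finsetSum _ fun j _ => tendsto_finsetSum _
        fun β _ => ((hlim2 i j β).const_mul _).add ((hlim1' j β).mul_const _)
    obtain ⟨M, hM⟩ := pb.exists_divergence_bound
    have hzero : Tendsto (fun N : ℕ => M / (N : ℝ)) (hyperfilter ℕ) (𝓝 0) :=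
      (tendsto_const_div_atTop_nhds_zero_nat M).mono_left Nat.hyperfilter_le_atTop
    refine tendsto_nhds_unique hconv (squeeze_zero_norm' ?_ hzero)
    filter_upwards [hbig, hdepth x] with N hN hxN
    exact hM _ _ a N (v N) x α hN (fun ξ hξ => mem_box hξ) (hv N) (depth_nonneg hxs) hxN
  · have hx' : inner ℝ x pb.n = -a := hx
    have hxs : x ∈ s := hx'.le
    have hconv : Tendsto (fun N => ∑ i, pb.n i * flux (pb.A x) (fderiv ℝ (f N) x) i α -
        fderiv ℝ pb.g x pb.T α) (hyperfilter ℕ)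
        (𝓝 (∑ i, pb.n i * flux (pb.A x) (fderivWithin ℝ u s x) i α - fderiv ℝ pb.g x pb.T α)) := by
      refine Tendsto.sub_const (tendsto_finsetSum _ fun i _ => Tendsto.const_mul _ ?_) _
      exact tendsto_finsetSum _ fun j _ => tendsto_finsetSum _ fun β _ =>
        (hlim1 x hxs j β).const_mul _
    obtain ⟨M, hM⟩ := pb.exists_boundary_bound
    have hzero : Tendsto (fun N : ℕ => M / (N : ℝ)) (hyperfilter ℕ) (𝓝 0) :=
      (tendsto_const_div_atTop_nhds_zero_nat M).mono_left Nat.hyperfilter_le_atTop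
    refine sub_eq_zero.1 (tendsto_nhds_unique hconv (squeeze_zero_norm' ?_ hzero))
    filter_upwards [hbig] with N hN
    exact hM _ _ a N (v N) x α hN (fun ξ hξ => mem_box hξ) (hv N) (by rw [depth, hx']; ring)
  · intro l hl SA Sg hA hg x hx
    rw [abs_inner_add hx]
    refine le_of_tendsto (hlim0 x hx).norm ?_
    filter_upwards [hdepth x] with N hN
    exact (hv N).norm_approx_decay a hl hA hg (depth_nonneg hx) hN
  · intro k l SA Sg hA hg x hx
    rw [abs_inner_add hx]
    refine le_of_tendsto (hlim (k + 1) x hx).norm ?_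
    filter_upwards [hdepth x] with N hN
    exact (hv N).norm_iteratedFDeriv_approx_decay a hA hg (depth_nonneg hx) hN

end NeumannData

end

end HalfSpaceNeumann

end

/-! ### The theorem, with its regularity index and constants -/

theorem theorem3 (d : ℕ) (hd : 2 ≤ d) :
    ∃ k : ℕ → ℕ → ℕ, ∀ (m : ℕ) (μ : ℝ), 0 < μ →
      ∃ C : ℕ → ℕ → ℝ → ℝ,
        ∀ (A : EuclideanSpace ℝ (Fin d) → HalfSpaceNeumann.Coeff d m)
          (n T : EuclideanSpace ℝ (Fin d)) (a κ : ℝ)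
          (g : EuclideanSpace ℝ (Fin d) → EuclideanSpace ℝ (Fin m)),
          ContDiff ℝ ∞ A → HalfSpaceNeumann.IsPeriodic A → HalfSpaceNeumann.IsElliptic μ A →
          ContDiff ℝ ∞ g → HalfSpaceNeumann.IsPeriodic g →
          ‖n‖ = 1 → ‖T‖ ≤ 1 → inner ℝ T n = 0 →
          0 < κ → HalfSpaceNeumann.IsDiophantine n κ →
          ∃ u : EuclideanSpace ℝ (Fin d) → EuclideanSpace ℝ (Fin m),
            HalfSpaceNeumann.IsSmoothSolution A n a T g u ∧
            (∀ ℓ : ℕ, 1 ≤ ℓ → ∀ K : ℝ,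
              HalfSpaceNeumann.CkNormLE (k 0 ℓ) A K → HalfSpaceNeumann.CkNormLE (k 0 ℓ) g K →
              ∀ x ∈ HalfSpaceNeumann.closedHalfSpace n a,
                ‖u x‖ ≤ C 0 ℓ K / (κ * (1 + κ * |inner ℝ x n + a|) ^ ℓ)) ∧
            (∀ j : ℕ, 1 ≤ j → ∀ ℓ : ℕ, 1 ≤ ℓ → ∀ K : ℝ,
              HalfSpaceNeumann.CkNormLE (k j ℓ) A K → HalfSpaceNeumann.CkNormLE (k j ℓ) g K →
              ∀ x ∈ HalfSpaceNeumann.closedHalfSpace n a,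
                ‖iteratedFDerivWithin ℝ j u (HalfSpaceNeumann.closedHalfSpace n a) x‖ ≤
                  C j ℓ K / (1 + κ * |inner ℝ x n + a|) ^ ℓ) := by
  -- The orders are those of `exists_solution`, plus one for the extra moment of `g` and `2 * d` for
  -- the passage from `C^k` norms to moments. The case `j = 0` bounds `u` itself, and `j = k + 1`
  -- its derivatives.
  refine ⟨fun j l => Nat.casesOn j (2 * d + 5 + 4 * l + 1 + 2 * d)
    fun k => k + 2 * d + 1 + 4 * l + 1 + 2 * d, fun m μ hμ => ?_⟩
  -- The moments of `A` and `g` are replaced by their bounds in terms of `K`, so neither `κ`, `n`,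
  -- `T` nor `a` enters the constant.
  refine ⟨fun j l K => Nat.casesOn j
    (HalfSpaceNeumann.sizeConst d m μ
      (2 ^ (2 * d + 5 + 4 * l + 2 * d) * K * HalfSpaceNeumann.weightSum d)
      (2 ^ (2 * d + 5 + 4 * l + 1 + 2 * d) * K * HalfSpaceNeumann.weightSum d) l)
    fun k => HalfSpaceNeumann.derivConst d m μ
      (2 ^ (k + 2 * d + 1 + 4 * l + 2 * d) * K * HalfSpaceNeumann.weightSum d)
      (2 ^ (k + 2 * d + 1 + 4 * l + 1 + 2 * d) * K * HalfSpaceNeumann.weightSum d) k l, ?_⟩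
  intro A n T a κ g hA hpA hell hg hpg hn hT hTn hκ hdio
  obtain ⟨u, hu, hsize, hderiv⟩ := HalfSpaceNeumann.NeumannData.exists_solution
    ⟨A, n, T, κ, μ, g, hd, hμ, hA, hpA, hell, hg, hpg, hn, hT, hTn, hκ, hdio⟩ a
  refine ⟨u, hu, fun l hl K hKA hKg x hx => ?_, fun j hj l hl K hKA hKg x hx => ?_⟩
  · exact hsize l hl _ _
      (HalfSpaceNeumann.momentLE_tensorCoeff hA hpA fun i hi => hKA i (hi.trans (by simp)))
      (HalfSpaceNeumann.momentLE_vectorCoeff hg hpg hKg) x hx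
  · obtain ⟨k, rfl⟩ := Nat.exists_eq_add_of_le' hj
    exact hderiv k l _ _
      (HalfSpaceNeumann.momentLE_tensorCoeff hA hpA fun i hi => hKA i (hi.trans (by simp)))
      (HalfSpaceNeumann.momentLE_vectorCoeff hg hpg hKg) x hx
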